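/- **System.** A base station serves finitely many real-time (RT) users $i\in\mathcal N_R$ and at least one, finitely many, non-real-time (NRT) users $i\in\mathcal N_{NR}$; $\mathcal N=\mathcal N_R\cup\mathcal N_{NR}$. Slots have duration $T_s>0$, packets have length $L>0$, the peak power is $P_{\max}>0$ and the average power bound is $P_{avg}>0$. RT user $i$ has an arrival rate $\lambda_i\in[0,1]$ and a required delivery ratio $q_i\in[0,1]$. Channel gains take values in a finite set $\mathcal M\subset[0,\infty)$, and $\pi$ is a probability distribution on the fading states $m=(\gamma_i)_{i\in\mathcal N}\in\mathcal M^{\mathcal N}$. In slot $k=0,1,2,\dots$ there are arrival indicators $a_i(k)\in\{0,1\}$, $i\in\mathcal N$, and a fading state $\gamma(k)$. With respect to a filtration $(\mathcal F_k)$, the pair $(a(k),\gamma(k))$ is $\mathcal F_{k+1}$-measurable and independent of $\mathcal F_k$, with $\Pr(a_i(k)=1)=\lambda_i$ and $\Pr(\gamma(k)=m)=\pi_m$. Dependence within one slot is allowed; thus an RT user without a packet may be modelled as having gain $0$ in that slot. **Allocations.** An allocation for state $m$ is a pair of vectors $(\mu_i)_{i\in\mathcal N},(P_i)_{i\in\mathcal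 N}$ with $\mu_i\ge0$, $\sum_i\mu_i\le T_s$, $0\le P_i\le P_{\max}$, and, with $R_i=\log(1+P_i\gamma_i)$, for each RT user either $\mu_i=0$ or $\mu_iR_i=L$ (whole packets). A policy chooses random, measurable $\mu(k),P(k)$ for each slot; it is causal if $\mu(k),P(k)$ are $\mathcal F_{k+1}$-measurable for every $k$. All NRT arrivals are admitted: $Q_i(0)=0$, $Q_i(k+1)=(Q_i(k)+La_i(k)-\mu_i(k)R_i(k))^+$, $i\in\mathcal N_{NR}$. A policy *meets all constraints* if in every slot it uses an allocation for $\gamma(k)$ with $\sum_i\mu_i(k)=T_s$ and $$\limsup_k\mathbb E[Q_i(k)]<\infty\ (i\in\mathcal N_{NR}),\quad \liminf_K\frac1{LK}\sum_{k<K}\mu_i(k)R_i(k)\ge q_i\lambda_i\ \text{a.s.}\ (i\in\mathcal N_R),\quad \limsup_K\frac1{KT_s}\sum_{k<K}\sum_{i\in\mathcal N}P_i(k)\mu_i(k)\le P_{avg}\ \text{a.s.}$$ A vector $\lambda=(\lambda_i)_{i\in\mathcal N_{NR}}$ is *admissible* if, for some arrivals and fading states as above with these NRT rates, some causal policy meets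 all constraints. **Lambert region.** $\mathcal R$ is the set of $\lambda\in\mathbb R^{\mathcal N_{NR}}$ for which there are deterministic allocations $(\mu(k,m),P(k,m))$ for state $m$, $k\ge0$, $m\in\mathcal M^{\mathcal N}$, such that, with $D_i(k)=\frac1L\sum_m\pi_m\,\mu_i(k,m)\log(1+P_i(k,m)\gamma_i(m))$, where $\gamma_i(m)$ is the gain of user $i$ in state $m$, $$\lim_K\frac1K\sum_{k<K}D_i(k)=\lambda_i\ (i\in\mathcal N_{NR}),\quad \liminf_K\frac1K\sum_{k<K}D_i(k)\ge q_i\lambda_i\ (i\in\mathcal N_R),\quad \limsup_K\frac1{KT_s}\sum_{k<K}\sum_m\pi_m\sum_{i\in\mathcal N}\mu_i(k,m)P_i(k,m)\le P_{avg}.$$ **Lambert-Strict algorithm, all arrivals admitted.** Keep virtual queues $Y_i(0)=X(0)=0$, $Y_i(k+1)=(Y_i(k)+a_i(k)q_i-\mathbf 1[\mu_i(k)\ne0])^+$ for $i\in\mathcal N_R$, and $X(k+1)=(X(k)+\frac1{T_s}\sum_{i\in\mathcal N} P_i(k)\mu_i(k)-P_{avg})^+$. In each slot (dropping $k$): 1.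 For NRT users put $P_i=\min((T_sQ_i/X-1/\gamma_i)^+,P_{\max})$ (read as $0$ if $\gamma_i=0$; and if $X=0<\gamma_i$, as $P_{\max}$ when $Q_i>0$ and $0$ when $Q_i=0$) and $\Psi_i=Q_i\log(1+P_i\gamma_i)-XP_i/T_s$. Select an NRT user $i^*$ maximizing $\Psi_i$. 2. Consider every set $A\subseteq\mathcal N_R$, except those for which there are $i\in\mathcal N_R\setminus A$, $j\in A$ with $Y_i>Y_j$, $\gamma_i>\gamma_j$. For $i\in A$ put $P_i=\min\big(\frac1{\gamma_i}\big[\frac{\tilde\phi\gamma_i-1}{W_0(e^{-1}(\tilde\phi\gamma_i-1))}-1\big],P_{\max}\big)$ with $\tilde\phi=(\Psi_{i^*}+\phi)T_s/X$ (the quotient with $W_0$ is read as $e$ if $\tilde\phi\gamma_i=1$; $P_i=P_{\max}$ if $X=0$), where $W_0$ is the principal branch of the Lambert $W$ function; let $\mu_i$ be such that $\mu_i\log(1+P_i\gamma_i)=L$, and $\mu_{i^*}=T_s-\sum_{i\in A}\mu_i$; here $\phi\ge0$ is such that $\mu_{i^*}\ge0$ and $\phi\mu_{i^*}=0$ (sets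 $A$ for which this is impossible are discarded). 3. Among the remaining sets use one that maximizes $\sum_{i\in A}(Y_i-XP_i\mu_i/T_s)+\Psi_{i^*}\mu_{i^*}$; all users outside $A\cup\{i^*\}$ get $\mu_i=P_i=0$. Ties are broken in an arbitrary causal way. **Theorem.** Let arrivals and fading states as above, with NRT rates $\lambda$, be given. (a) There is a causal policy generated by the Lambert-Strict algorithm. If $(1+\epsilon)\lambda\in\mathcal R$ for some $\epsilon>0$, every such policy meets all constraints; in particular it stabilizes the NRT queues. (b) If $\lambda\notin\mathcal R$, no policy, not even one that knows the future, meets all constraints. (c) Consequently $\mathcal R$ is the capacity region: the closure of the set of admissible vectors $\lambda$ is $\mathcal R\cap[0,1]^{\mathcal N_{NR}}$ (rates of arrival indicators lie in $[0,1]$). -/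

import Mathlib

open MeasureTheory ProbabilityTheory Filter Topology

noncomputable section

namespace Downlink

/-- The users: `Sum.inl i` is a real-time (RT) user, `Sum.inr i` a non-real-time (NRT) user. -/
abbrev User (nR nN : ℕ) : Type := Fin nR ⊕ Fin nN

/-- The fixed data of the downlink system, everything except the NRT arrival rates. A fading state
assigns to every user one of the finitely many possible gains. -/
structure System (nR nN : ℕ) where
  /-- slot duration -/
  Ts : ℝ
  /-- packet length -/
  L : ℝ
  /-- peak power -/
  Pmax : ℝ
  /-- bound on the average power -/
  Pavg : ℝ
  /-- required delivery ratios of the RT users -/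
  q : Fin nR → ℝ
  /-- arrival rates of the RT users, in packets per slot -/
  rateR : Fin nR → ℝ
  /-- the finite set of possible channel gains -/
  gains : Finset ℝ
  /-- probabilities of the fading states -/
  prob : (User nR nN → gains) → ℝ
  Ts_pos : 0 < Ts
  L_pos : 0 < L
  Pmax_pos : 0 < Pmax
  Pavg_pos : 0 < Pavg
  q_mem : ∀ i, q i ∈ Set.Icc (0 : ℝ) 1
  rateR_mem : ∀ i, rateR i ∈ Set.Icc (0 : ℝ) 1
  gains_nonneg : ∀ g ∈ gains, 0 ≤ g
  prob_nonneg : ∀ m, 0 ≤ prob m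
  prob_sum : ∑ m, prob m = 1

/-- Transmission rate with power `p` over a channel with gain `g`. -/
def rate (p g : ℝ) : ℝ := Real.log (1 + p * g)

namespace System

variable {nR nN : ℕ} (S : System nR nN)

/-- Fading states. -/
abbrev State : Type := User nR nN → S.gains

/-- The restrictions on the durations `μ` and powers `P` of one slot with fading state `m`. An RT
user is either not scheduled or is given exactly the time that transmits its whole packet. -/
structure IsSlotAllocation (m : S.State) (μ P : User nR nN → ℝ) : Prop where
  time_nonneg : ∀ i, 0 ≤ μ i
  time_sum : ∑ i, μ i ≤ S.Ts
  power_nonneg : ∀ i, 0 ≤ P i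
  power_le : ∀ i, P i ≤ S.Pmax
  whole_packet : ∀ i : Fin nR,
    μ (Sum.inl i) = 0 ∨ μ (Sum.inl i) * rate (P (Sum.inl i)) (m (Sum.inl i)) = S.L

/-- Packets per slot delivered to user `i` by the state-dependent allocation `(μ, P)`, averaged over
the fading states. -/
def meanService (μ P : S.State → User nR nN → ℝ) (i : User nR nN) : ℝ :=
  (∑ m, μ m i * rate (P m i) (m i) * S.prob m) / S.L

/-- Transmission power of the state-dependent allocation `(μ, P)`, averaged over the slot and over
the fading states. -/
def meanPower (μ P : S.State → User nR nN → ℝ) : ℝ :=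
  (∑ m, (∑ i, μ m i * P m i) * S.prob m) / S.Ts

/-- The Lambert region, a set of NRT arrival rate vectors. -/
def lambertRegion : Set (Fin nN → ℝ) :=
  {lam | ∃ μ P : ℕ → S.State → User nR nN → ℝ,
    (∀ k m, S.IsSlotAllocation m (μ k m) (P k m)) ∧
    (∀ i : Fin nN, Tendsto
      (fun K : ℕ => (∑ k ∈ Finset.range K, S.meanService (μ k) (P k) (Sum.inr i)) / K)
      atTop (𝓝 (lam i))) ∧
    (∀ i : Fin nR, S.q i * S.rateR i ≤ liminf
      (fun K : ℕ => (∑ k ∈ Finset.range K, S.meanService (μ k) (P k) (Sum.inl i)) / K) atTop) ∧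
    limsup (fun K : ℕ => (∑ k ∈ Finset.range K, S.meanPower (μ k) (P k)) / K) atTop ≤ S.Pavg}

/-! ### Queues along one sample path, initially empty -/

/-- Queue of NRT user `i`, in bits, when all arrivals are admitted. -/
def queue (a : ℕ → User nR nN → ℝ) (g : ℕ → S.State) (μ P : ℕ → User nR nN → ℝ) (i : Fin nN) :
    ℕ → ℝ
  | 0 => 0
  | k + 1 => max (queue a g μ P i k + S.L * a k (Sum.inr i)
      - μ k (Sum.inr i) * rate (P k (Sum.inr i)) (g k (Sum.inr i))) 0

open Classical in
/-- Virtual queue of the delivery ratio constraint of RT user `i`. -/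
def deliveryQueue (a : ℕ → User nR nN → ℝ) (μ : ℕ → User nR nN → ℝ) (i : Fin nR) : ℕ → ℝ
  | 0 => 0
  | k + 1 => max (deliveryQueue a μ i k + a k (Sum.inl i) * S.q i
      - (if μ k (Sum.inl i) = 0 then 0 else 1)) 0

/-- Virtual queue of the average power constraint. -/
def powerQueue (μ P : ℕ → User nR nN → ℝ) : ℕ → ℝ
  | 0 => 0
  | k + 1 => max (powerQueue μ P k + (∑ i, P k i * μ k i) / S.Ts - S.Pavg) 0

/-! ### The Lambert-Strict algorithm -/

/-- Water-filling power of an NRT user with queue `Q` and gain `g`. At `X = 0` and at `g = 0` this is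
the limit of the formula of the last line. -/
def waterFilling (X Q g : ℝ) : ℝ :=
  open Classical in
  if g = 0 then 0
  else if X = 0 then (if Q = 0 then 0 else S.Pmax)
  else min (max (S.Ts * Q / X - 1 / g) 0) S.Pmax

/-- The weight of an NRT user, per second of transmission with the water-filling power. -/
def psiN (X Q g : ℝ) : ℝ :=
  Q * rate (S.waterFilling X Q g) g - X * S.waterFilling X Q g / S.Ts

/-- Principal branch of the Lambert W function: for `z ≥ -1/e`, the `w ≥ -1` with `w * exp w = z`. -/
def lambertW0 (z : ℝ) : ℝ :=
  Function.invFunOn (fun w : ℝ => w * Real.exp w) (Set.Ici (-1)) z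

/-- `z / W₀(z / e)`, continuously extended to `z = 0`. -/
def lambertRatio (z : ℝ) : ℝ :=
  open Classical in
  if z = 0 then Real.exp 1 else z / lambertW0 (z / Real.exp 1)

/-- Lambert power of a scheduled RT user with gain `g`, where `ψ` is the weight of the selected NRT
user and `φ` the multiplier. At `X = 0` the argument `(ψ + φ) * Ts / X` is read as infinite. -/
def lambertPower (X ψ φ g : ℝ) : ℝ :=
  open Classical in
  if X = 0 then S.Pmax
  else min (1 / g * (lambertRatio ((ψ + φ) * S.Ts / X * g - 1) - 1)) S.Pmax

/-- The set `A` of RT users is not skipped by the algorithm, and its loop assigns to the RT users the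
powers `p` and the durations `t`, and to the selected NRT user the remaining time `tN`. -/
structure IsCandidate (X ψ : ℝ) (Y g : Fin nR → ℝ) (A : Finset (Fin nR)) (p t : Fin nR → ℝ)
    (tN : ℝ) : Prop where
  not_skipped : ¬ ∃ i, i ∉ A ∧ ∃ j, j ∈ A ∧ Y j < Y i ∧ g j < g i
  power : ∃ φ : ℝ, 0 ≤ φ ∧ φ * tN = 0 ∧ ∀ i ∈ A, p i = S.lambertPower X ψ φ (g i)
  packet : ∀ i ∈ A, t i * rate (p i) (g i) = S.L
  unscheduled : ∀ i, i ∉ A → p i = 0 ∧ t i = 0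
  remaining : tN = S.Ts - ∑ i, t i
  remaining_nonneg : 0 ≤ tN

/-- The value by which the algorithm compares the candidate sets. -/
def candidateValue (X ψ : ℝ) (Y : Fin nR → ℝ) (A : Finset (Fin nR)) (p t : Fin nR → ℝ) (tN : ℝ) :
    ℝ :=
  ∑ i ∈ A, (Y i - X * p i * t i / S.Ts) + ψ * tN

/-- `(μ, P)` is an output of the algorithm, for some way of breaking ties, in a slot with queues `Q`,
virtual queues `Y`, `X`, and fading state `m`. -/
def IsLambertStrict (Q : Fin nN → ℝ) (Y : Fin nR → ℝ) (X : ℝ) (m : S.State)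
    (μ P : User nR nN → ℝ) : Prop :=
  ∃ j : Fin nN,
    (∀ i, S.psiN X (Q i) (m (Sum.inr i)) ≤ S.psiN X (Q j) (m (Sum.inr j))) ∧
    P (Sum.inr j) = S.waterFilling X (Q j) (m (Sum.inr j)) ∧
    (∀ i, i ≠ j → P (Sum.inr i) = 0 ∧ μ (Sum.inr i) = 0) ∧
    ∃ A : Finset (Fin nR),
      S.IsCandidate X (S.psiN X (Q j) (m (Sum.inr j))) Y (fun i => m (Sum.inl i)) A
        (fun i => P (Sum.inl i)) (fun i => μ (Sum.inl i)) (μ (Sum.inr j)) ∧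
      ∀ A' p t tN,
        S.IsCandidate X (S.psiN X (Q j) (m (Sum.inr j))) Y (fun i => m (Sum.inl i)) A' p t tN →
        S.candidateValue X (S.psiN X (Q j) (m (Sum.inr j))) Y A' p t tN ≤
          S.candidateValue X (S.psiN X (Q j) (m (Sum.inr j))) Y A
            (fun i => P (Sum.inl i)) (fun i => μ (Sum.inl i)) (μ (Sum.inr j))

/-! ### The stochastic system -/

section Stochastic

variable {Ω : Type*} {mΩ : MeasurableSpace Ω}

/-- Arrivals `a` (indicators) and fading states `γ` of the slots, for NRT arrival rates `lam`. In
every slot they are independent of the past `ℱ k`, and hence independent over time. Within one slot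
no independence is required. -/
structure IsEnvironment (lam : Fin nN → ℝ) (Pr : Measure Ω) (ℱ : Filtration ℕ mΩ)
    (a : ℕ → Ω → User nR nN → ℝ) (γ : ℕ → Ω → S.State) : Prop where
  arrival : ∀ k ω i, a k ω i = 0 ∨ a k ω i = 1
  meas : ∀ k, Measurable[ℱ (k + 1)] (fun ω => (a k ω, γ k ω))
  indep : ∀ k, Indep (MeasurableSpace.comap (fun ω => (a k ω, γ k ω)) inferInstance) (ℱ k) Pr
  rate_RT : ∀ k i, Pr.real {ω | a k ω (Sum.inl i) = 1} = S.rateR i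
  rate_NRT : ∀ k i, Pr.real {ω | a k ω (Sum.inr i) = 1} = lam i
  state : ∀ k m, Pr.real {ω | γ k ω = m} = S.prob m

/-- A policy that does not anticipate the future: the decisions of slot `k` may depend on the past,
on the arrivals and gains of slot `k`, and on private randomization. -/
def IsCausal (ℱ : Filtration ℕ mΩ) (μ P : ℕ → Ω → User nR nN → ℝ) : Prop :=
  ∀ k, Measurable[ℱ (k + 1)] (μ k) ∧ Measurable[ℱ (k + 1)] (P k)

/-- The policy `(μ, P)` is generated by the Lambert-Strict algorithm with all arrivals admitted. -/
def FollowsLambertStrict (a : ℕ → Ω → User nR nN → ℝ) (γ : ℕ → Ω → S.State)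
    (μ P : ℕ → Ω → User nR nN → ℝ) : Prop :=
  ∀ k ω, S.IsLambertStrict
    (fun i => S.queue (fun l => a l ω) (fun l => γ l ω) (fun l => μ l ω) (fun l => P l ω) i k)
    (fun i => S.deliveryQueue (fun l => a l ω) (fun l => μ l ω) i k)
    (S.powerQueue (fun l => μ l ω) (fun l => P l ω) k)
    (γ k ω) (μ k ω) (P k ω)

/-- With all arrivals admitted, the policy `(μ, P)` stabilizes the NRT queues and meets the delivery
ratio, average power, peak power and time constraints. -/
structure MeetsConstraints (Pr : Measure Ω) (a : ℕ → Ω → User nR nN → ℝ) (γ : ℕ → Ω → S.State)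
    (μ P : ℕ → Ω → User nR nN → ℝ) : Prop where
  allocation : ∀ k ω, S.IsSlotAllocation (γ k ω) (μ k ω) (P k ω)
  full_slot : ∀ k ω, ∑ i, μ k ω i = S.Ts
  stable : ∀ i : Fin nN, limsup (fun k : ℕ => ∫⁻ ω, ENNReal.ofReal
    (S.queue (fun l => a l ω) (fun l => γ l ω) (fun l => μ l ω) (fun l => P l ω) i k) ∂Pr) atTop < ⊤
  delivery : ∀ i : Fin nR, ∀ᵐ ω ∂Pr, S.q i * S.rateR i ≤ liminf (fun K : ℕ =>
    (∑ k ∈ Finset.range K, μ k ω (Sum.inl i) * rate (P k ω (Sum.inl i)) (γ k ω (Sum.inl i)))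
      / (S.L * K)) atTop
  avg_power : ∀ᵐ ω ∂Pr, limsup (fun K : ℕ =>
    (∑ k ∈ Finset.range K, ∑ i, P k ω i * μ k ω i) / (K * S.Ts)) atTop ≤ S.Pavg

end Stochastic

/-- `lam` is admissible: for arrivals with these NRT rates, some causal policy meets all
constraints. -/
def IsAdmissible (lam : Fin nN → ℝ) : Prop :=
  ∃ (Ω : Type) (mΩ : MeasurableSpace Ω) (Pr : Measure Ω) (ℱ : Filtration ℕ mΩ)
    (a : ℕ → Ω → User nR nN → ℝ) (γ : ℕ → Ω → S.State) (μ P : ℕ → Ω → User nR nN → ℝ),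
    IsProbabilityMeasure Pr ∧ S.IsEnvironment lam Pr ℱ a γ ∧ IsCausal ℱ μ P ∧
    S.MeetsConstraints Pr a γ μ P

end System

end Downlink

end

noncomputable section

set_option linter.unusedSectionVars false

namespace Downlink

/-! ### Convex geometry -/

section Geometry

variable {E : Type*} [NormedAddCommGroup E] [InnerProductSpace ℝ E]

/-! All queues form one vector `w`: the power queue, the delivery queues and the NRT queues. A slot
adds `inflow - outcome` and takes positive parts. The argument compares the mean inflow `target lam`
with `meanSupport`, the support function of the possible outcomes averaged over the fading states.

The region is given by linear inequalities (`mem_lambertRegion_iff`): a nonnegative `lam` belongs to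
it iff `⟪v, target lam⟫ ≤ meanSupport v` for all `v ≥ 0`. Necessity is averaging. For sufficiency,
deterministic queues fed with the target and served by nearly maximal outcomes grow at most like
`√k`, and the services themselves are the required allocations.

The algorithm is a max-weight rule (`IsLambertStrict.optimal`): its outcome maximizes `⟪w, ·⟫` over
all allocations of the slot. For a given price of time the Lambert power minimizes the cost per bit,
`φ` is the multiplier of the slot length, and a skipped set is beaten after exchanging two users.

Under the support inequality the squared norm of `w` has bounded drift, so its mean is `O(k)` and `w
/ k → 0` almost surely. This yields the delivery and power constraints. Stability of the NRT queues
needs more: enlarging `lam` creates no slack in the RT directions, so the norm of `w` need not have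
negative drift. Instead, the distance of `w` from `tightCone`, the cone of directions without slack,
is used. Points of this cone vanish at every NRT user of positive rate, so the distance dominates
these queues; users of rate zero almost surely have empty queues. The slack is at least proportional
to the distance (`exists_slack_dist`). In the NRT and power directions this holds because shortened
NRT transmissions spare power (`exists_slack`). In the RT directions it is a Hoffman bound: whole
packets leave only finitely many RT outcomes (`finite_excessRT`). With the projection of `w` onto
the cone as reference point, the squared distance then has negative drift far from the cone, and an
exponential moment bounds the mean distance.

For the converse, stability and Fatou's lemma give `Q / K` arbitrarily small at infinitely many `K`.
On one typical sample path the averaged outcomes therefore nearly dominate the target, while their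
weight is at most the averaged support. Causality plays no role. Finally, the region is closed, and
contracting any of its vectors with entries in `[0,1]` gives admissible rates in an i.i.d.
environment. -/

theorem norm_sub_le_of_inner_nonpos {x p y : E} (h : inner ℝ (x - p) (y - p) ≤ 0) :
    ‖x - p‖ ≤ ‖x - y‖ := by
  have h1 : ‖x - y‖ ^ 2 = ‖x - p‖ ^ 2 - 2 * inner ℝ (x - p) (y - p) + ‖y - p‖ ^ 2 := by
    rw [← norm_sub_sq_real]; congr 2; abel
  have h2 : ‖x - p‖ ^ 2 ≤ ‖x - y‖ ^ 2 := by nlinarith [sq_nonneg ‖y - p‖]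
  exact (abs_le_of_sq_le_sq' h2 (norm_nonneg _)).2

/-- The metric projection onto a nonempty closed convex set. -/
theorem exists_metricProjection [CompleteSpace E] {K : Set E} (hne : K.Nonempty)
    (hcl : IsClosed K) (hK : Convex ℝ K) :
    ∃ p : E → E, LipschitzWith 1 p ∧ (∀ x, p x ∈ K) ∧
      ∀ x, ∀ y ∈ K, inner ℝ (x - p x) (y - p x) ≤ 0 := by
  have h : ∀ x : E, ∃ v ∈ K, ∀ y ∈ K, inner ℝ (x - v) (y - v) ≤ 0 := by
    intro x
    obtain ⟨v, hv, h⟩ := exists_norm_eq_iInf_of_complete_convex hne hcl.isComplete hK x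
    exact ⟨v, hv, (norm_eq_iInf_iff_real_inner_le_zero hK hv).1 h⟩
  choose p hp hvar using h
  refine ⟨p, LipschitzWith.of_dist_le_mul fun x y => ?_, hp, hvar⟩
  have h1 := hvar x (p y) (hp y)
  have h2 := hvar y (p x) (hp x)
  -- Adding the two variational inequalities makes the projection firmly nonexpansive;
  -- Cauchy–Schwarz then gives the constant 1.
  have h3 : ‖p x - p y‖ ^ 2 ≤ inner ℝ (x - y) (p x - p y) := by
    have e : inner ℝ (x - y) (p x - p y) - ‖p x - p y‖ ^ 2
        = -(inner ℝ (x - p x) (p y - p x)) - inner ℝ (y - p y) (p x - p y) := by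
      rw [← real_inner_self_eq_norm_sq]
      simp only [inner_sub_left, inner_sub_right]
      ring
    linarith
  have h4 := real_inner_le_norm (x - y) (p x - p y)
  rw [dist_eq_norm, dist_eq_norm]
  simp only [NNReal.coe_one, one_mul]
  by_contra hlt
  push Not at hlt
  have h5 : 0 < ‖p x - p y‖ := lt_of_le_of_lt (norm_nonneg _) hlt
  nlinarith

/-- If a unit vector `z` of the polar had `⟪g, z⟫ ≤ 0` for all `g ∈ J`, it could be tested against
itself, giving `‖z‖² ≤ 0`. So the sum of the positive parts of `⟪g, z⟫` is positive on the compact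
set of such unit vectors, hence bounded below, and some `g` carries its share. -/
theorem exists_inner_ge_of_polar [FiniteDimensional ℝ E] (J : Finset E) :
    ∃ κ : ℝ, 0 < κ ∧ ∀ z : E, (∀ u, (∀ g ∈ J, inner ℝ g u ≤ 0) → inner ℝ z u ≤ 0) →
      z = 0 ∨ ∃ g ∈ J, κ * ‖z‖ ≤ inner ℝ g z := by
  set Z : Set E := {z | ‖z‖ = 1 ∧ ∀ u, (∀ g ∈ J, inner ℝ g u ≤ 0) → inner ℝ z u ≤ 0} with hZ
  have hcl : IsClosed Z := by
    have : Z = {z | ‖z‖ = 1} ∩ ⋂ u : {u : E // ∀ g ∈ J, inner ℝ g u ≤ 0},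
        {z | inner ℝ z (u : E) ≤ 0} := by
      ext z; simp [hZ]
    rw [this]
    exact (isClosed_eq continuous_norm continuous_const).inter
      (isClosed_iInter fun u => isClosed_le (by fun_prop) continuous_const)
  have hcomp : IsCompact Z := by
    refine (isCompact_closedBall (0 : E) 1).of_isClosed_subset hcl fun z hz => ?_
    simp [hz.1]
  have hpos : ∀ z ∈ Z, 0 < ∑ g ∈ J, max (inner ℝ g z) 0 := by
    intro z hz
    refine lt_of_le_of_ne (Finset.sum_nonneg fun g _ => le_max_right _ _) fun h0 => ?_
    have h1 := (Finset.sum_eq_zero_iff_of_nonneg fun g _ => le_max_right _ _).1 h0.symm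
    have h2 := hz.2 z fun g hg => by have := h1 g hg; simpa using this
    rw [real_inner_self_eq_norm_sq, hz.1] at h2
    norm_num at h2
  obtain ⟨κ, hκ, hb⟩ : ∃ κ : ℝ, 0 < κ ∧ ∀ z ∈ Z, κ ≤ ∑ g ∈ J, max (inner ℝ g z) 0 := by
    rcases Z.eq_empty_or_nonempty with he | hne
    · exact ⟨1, one_pos, by simp [he]⟩
    · obtain ⟨z0, hz0, hmin⟩ := hcomp.exists_isMinOn hne
        (f := fun z => ∑ g ∈ J, max (inner ℝ g z) 0) (by fun_prop)
      exact ⟨_, hpos z0 hz0, fun z hz => hmin hz⟩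
  -- The `+ 1` admits empty `J` and makes the pigeonhole inequality strict.
  refine ⟨κ / (J.card + 1), by positivity, fun z hz => ?_⟩
  by_cases hz0 : z = 0
  · exact Or.inl hz0
  right
  have hn : 0 < ‖z‖ := norm_pos_iff.2 hz0
  have hz1 : ‖z‖⁻¹ • z ∈ Z := by
    refine ⟨by rw [norm_smul]; simp [hn.ne'], fun u hu => ?_⟩
    rw [inner_smul_left]
    exact mul_nonpos_of_nonneg_of_nonpos (by simp) (hz u hu)
  have h1 := hb _ hz1
  by_contra hcon
  push Not at hcon
  have h2 : ∑ g ∈ J, max (inner ℝ g (‖z‖⁻¹ • z)) 0 ≤ ∑ g ∈ J, κ / (J.card + 1) := by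
    refine Finset.sum_le_sum fun g hg => max_le ?_ (by positivity)
    rw [inner_smul_right, inv_mul_le_iff₀ hn]
    linarith [hcon g hg]
  rw [Finset.sum_const, nsmul_eq_mul] at h2
  have h3 : (J.card : ℝ) * (κ / (J.card + 1)) < κ := by
    rw [← mul_div_assoc, div_lt_iff₀ (by positivity)]
    nlinarith
  linarith

/-- The Hoffman error bound for a polyhedral cone. -/
theorem exists_hoffman_bound [FiniteDimensional ℝ E] {G : Set E} (hG : G.Finite) :
    ∃ κ : ℝ, 0 < κ ∧ ∀ x : E, ∃ y : E, (∀ g ∈ G, inner ℝ g y ≤ 0) ∧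
      (x = y ∨ ∃ g ∈ G, κ * ‖x - y‖ ≤ inner ℝ g x) := by
  classical
  choose κ hκ hb using exists_inner_ge_of_polar (E := E)
  obtain ⟨F, rfl⟩ := hG.exists_finset_coe
  -- The active set at the projection depends on `x`, but there are only finitely many subsets of
  -- `F`, so one constant serves them all.
  obtain ⟨κ0, hκ0, hmin⟩ : ∃ κ0 : ℝ, 0 < κ0 ∧ ∀ J ∈ F.powerset, κ0 ≤ κ J := by
    obtain ⟨J0, _, h0⟩ := F.powerset.exists_min_image κ ⟨∅, by simp⟩
    exact ⟨κ J0, hκ J0, h0⟩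
  refine ⟨κ0, hκ0, fun x => ?_⟩
  set K : Set E := {y | ∀ g ∈ F, inner ℝ g y ≤ 0} with hK
  have hcl : IsClosed K := by
    have : K = ⋂ g : F, {y | inner ℝ (g : E) y ≤ 0} := by ext; simp [hK]
    rw [this]
    exact isClosed_iInter fun g => isClosed_le (by fun_prop) continuous_const
  have hconv : Convex ℝ K := by
    intro y hy z hz a b ha hb _ g hg
    rw [inner_add_right, inner_smul_right, inner_smul_right]
    nlinarith [hy g hg, hz g hg]
  have hcomplete : CompleteSpace E := FiniteDimensional.complete ℝ E
  obtain ⟨p, -, hp, hvar⟩ := exists_metricProjection (K := K) ⟨0, by simp [hK]⟩ hcl hconv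
  refine ⟨p x, fun g hg => hp x g (by simpa using hg), ?_⟩
  -- The constraints active at the projection. A short step from `p x` in a direction allowed by
  -- them stays in the cone, since the other constraints are strict; hence `x - p x` is in the polar
  -- of the active constraints.
  set J := F.filter fun g => inner ℝ g (p x) = 0 with hJ
  have hpolar : ∀ u, (∀ g ∈ J, inner ℝ g u ≤ 0) → inner ℝ (x - p x) u ≤ 0 := by
    intro u hu
    have hev : ∀ᶠ t : ℝ in 𝓝[>] 0, p x + t • u ∈ K := by
      have : ∀ g ∈ F, ∀ᶠ t : ℝ in 𝓝[>] 0, inner ℝ g (p x + t • u) ≤ 0 := by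
        intro g hg
        by_cases h0 : inner ℝ g (p x) = 0
        · filter_upwards [self_mem_nhdsWithin] with t ht
          rw [inner_add_right, inner_smul_right, h0, zero_add]
          exact mul_nonpos_of_nonneg_of_nonpos (le_of_lt ht) (hu g (by simp [hJ, hg, h0]))
        · have hlt : inner ℝ g (p x) < 0 := lt_of_le_of_ne (hp x g hg) h0
          have hc : Continuous fun t : ℝ => inner ℝ g (p x + t • u) := by fun_prop
          have : ∀ᶠ t : ℝ in 𝓝 0, inner ℝ g (p x + t • u) < 0 :=
            hc.continuousAt.eventually_lt continuousAt_const (by simpa using hlt)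
          exact (this.filter_mono nhdsWithin_le_nhds).mono fun t ht => ht.le
      simpa [hK] using (Finset.eventually_all F).2 this
    obtain ⟨t, ht, htpos⟩ := (hev.and self_mem_nhdsWithin).exists
    have h1 := hvar x _ ht
    rw [add_sub_cancel_left, inner_smul_right] at h1
    exact nonpos_of_mul_nonpos_right h1 htpos
  rcases hb J (x - p x) hpolar with h0 | ⟨g, hg, hge⟩
  · exact Or.inl (sub_eq_zero.1 h0)
  · right
    rw [hJ, Finset.mem_filter] at hg
    refine ⟨g, by simpa using hg.1, ?_⟩
    rw [inner_sub_right, hg.2, sub_zero] at hge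
    refine le_trans ?_ hge
    exact mul_le_mul_of_nonneg_right (hmin J (by simp [hJ])) (norm_nonneg _)

/-- The support function of a set. -/
def support (O : Set E) (w : E) : ℝ := sSup ((fun o => inner ℝ w o) '' O)

variable {O : Set E} {C : ℝ}

theorem inner_le_support (hC : ∀ o ∈ O, ‖o‖ ≤ C) (w : E) {o : E} (ho : o ∈ O) :
    inner ℝ w o ≤ support O w := by
  refine le_csSup ⟨‖w‖ * C, ?_⟩ ⟨o, ho, rfl⟩
  rintro _ ⟨o, ho, rfl⟩
  exact (real_inner_le_norm w o).trans (mul_le_mul_of_nonneg_left (hC o ho) (norm_nonneg _))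

theorem support_le (hne : O.Nonempty) {w : E} {c : ℝ} (h : ∀ o ∈ O, inner ℝ w o ≤ c) :
    support O w ≤ c :=
  csSup_le (hne.image _) (by rintro _ ⟨o, ho, rfl⟩; exact h o ho)

theorem exists_support_sub_lt (hne : O.Nonempty) (w : E) {δ : ℝ} (hδ : 0 < δ) :
    ∃ o ∈ O, support O w - δ < inner ℝ w o := by
  obtain ⟨_, ⟨o, ho, rfl⟩, h⟩ := exists_lt_of_lt_csSup (hne.image fun o => inner ℝ w o)
    (sub_lt_self (support O w) hδ)
  exact ⟨o, ho, h⟩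

theorem support_le_add (hne : O.Nonempty) (hC : ∀ o ∈ O, ‖o‖ ≤ C) (w w' : E) :
    support O w ≤ support O w' + C * ‖w - w'‖ := by
  refine support_le hne fun o ho => ?_
  have h1 := inner_le_support hC w' ho
  have h2 := (real_inner_le_norm (w - w') o).trans
    (mul_le_mul_of_nonneg_left (hC o ho) (norm_nonneg _))
  rw [inner_sub_left] at h2
  linarith

theorem continuous_support (hne : O.Nonempty) (hC : ∀ o ∈ O, ‖o‖ ≤ C) :
    Continuous (support O) := by
  have hC0 : 0 ≤ C := let ⟨o, ho⟩ := hne; (norm_nonneg o).trans (hC o ho)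
  refine (LipschitzWith.of_le_add_mul (K := C.toNNReal) fun x y => ?_).continuous
  rw [Real.coe_toNNReal _ hC0, dist_eq_norm]
  exact support_le_add hne hC x y

theorem abs_support_le (hne : O.Nonempty) (hC : ∀ o ∈ O, ‖o‖ ≤ C) (w : E) :
    |support O w| ≤ C * ‖w‖ := by
  rw [abs_le]
  constructor
  · obtain ⟨o, ho⟩ := hne
    have h1 := inner_le_support hC w ho
    have h2 := (abs_le.1 (abs_real_inner_le_norm w o)).1
    have h3 := mul_le_mul_of_nonneg_left (hC o ho) (norm_nonneg w)
    linarith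
  · refine support_le hne fun o ho => ?_
    have h3 := mul_le_mul_of_nonneg_left (hC o ho) (norm_nonneg w)
    linarith [real_inner_le_norm w o]

end Geometry

/-! ### Vectors of queues -/

section PosVec

variable {J : Type*}

/-- Componentwise positive part. -/
def posVec (x : EuclideanSpace ℝ J) : EuclideanSpace ℝ J := WithLp.toLp 2 fun j => max (x j) 0

@[simp] theorem posVec_apply (x : EuclideanSpace ℝ J) (j : J) : posVec x j = max (x j) 0 := rfl

variable [Fintype J]

/-- The positive part is the projection onto the orthant. It is stated for any nonnegative reference
point, because drifts are taken relative to points other than the origin. -/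
theorem norm_posVec_sub_le (x : EuclideanSpace ℝ J) {y : EuclideanSpace ℝ J} (hy : ∀ j, 0 ≤ y j) :
    ‖posVec x - y‖ ≤ ‖x - y‖ := by
  refine (abs_le_of_sq_le_sq' ?_ (norm_nonneg _)).2
  rw [EuclideanSpace.real_norm_sq_eq, EuclideanSpace.real_norm_sq_eq]
  refine Finset.sum_le_sum fun j _ => ?_
  simp only [PiLp.sub_apply, posVec_apply]
  rcases le_total 0 (x j) with h | h
  · rw [max_eq_left h]
  · rw [max_eq_right h]; nlinarith [hy j]

theorem norm_posVec_sub_self_le (x : EuclideanSpace ℝ J) {y : EuclideanSpace ℝ J}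
    (hy : ∀ j, 0 ≤ y j) : ‖posVec (y + x) - y‖ ≤ ‖x‖ := by
  simpa using norm_posVec_sub_le (y + x) hy

theorem inner_euclidean (x y : EuclideanSpace ℝ J) : inner ℝ x y = ∑ j, x j * y j := by
  simp [PiLp.inner_apply, mul_comm]

theorem abs_coord_le_norm (x : EuclideanSpace ℝ J) (j : J) : |x j| ≤ ‖x‖ := by
  simpa using PiLp.norm_apply_le x j

end PosVec

/-! ### Bounded random variables -/

section Bounded

variable {Ω : Type*} {mΩ : MeasurableSpace Ω}

/-- A bounded measurable function. -/
structure BddMeas {Ω : Type*} [MeasurableSpace Ω] (f : Ω → ℝ) : Prop where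
  meas : Measurable f
  bdd : ∃ B, ∀ ω, |f ω| ≤ B

namespace BddMeas

variable {f g : Ω → ℝ}

theorem const (c : ℝ) : BddMeas fun _ : Ω => c := ⟨measurable_const, |c|, fun _ => le_rfl⟩

theorem add (hf : BddMeas f) (hg : BddMeas g) : BddMeas fun ω => f ω + g ω := by
  obtain ⟨hf, A, hA⟩ := hf
  obtain ⟨hg, B, hB⟩ := hg
  exact ⟨hf.add hg, A + B, fun ω => (abs_add_le _ _).trans (add_le_add (hA ω) (hB ω))⟩

theorem mul (hf : BddMeas f) (hg : BddMeas g) : BddMeas fun ω => f ω * g ω := by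
  obtain ⟨hf, A, hA⟩ := hf
  obtain ⟨hg, B, hB⟩ := hg
  refine ⟨hf.mul hg, A * B, fun ω => ?_⟩
  rw [abs_mul]
  exact mul_le_mul (hA ω) (hB ω) (abs_nonneg _) ((abs_nonneg _).trans (hA ω))

theorem const_mul (c : ℝ) (hf : BddMeas f) : BddMeas fun ω => c * f ω := (const c).mul hf

theorem neg (hf : BddMeas f) : BddMeas fun ω => -f ω := by simpa using hf.const_mul (-1)

theorem sub (hf : BddMeas f) (hg : BddMeas g) : BddMeas fun ω => f ω - g ω := by
  simpa [sub_eq_add_neg] using hf.add hg.neg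

theorem sum {ι : Type*} {s : Finset ι} {F : ι → Ω → ℝ} (h : ∀ i ∈ s, BddMeas (F i)) :
    BddMeas fun ω => ∑ i ∈ s, F i ω := by
  classical
  induction s using Finset.induction_on with
  | empty => simpa using const 0
  | insert a s ha ih =>
    simp only [Finset.sum_insert ha]
    exact (h a (by simp)).add (ih fun i hi => h i (by simp [hi]))

theorem indicator (hf : BddMeas f) {s : Set Ω} (hs : MeasurableSet s) :
    BddMeas (s.indicator f) := by
  obtain ⟨hf, A, hA⟩ := hf
  refine ⟨hf.indicator hs, A, fun ω => ?_⟩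
  by_cases h : ω ∈ s
  · simpa [h] using hA ω
  · simpa [h] using (abs_nonneg _).trans (hA ω)

theorem integrable {Pr : Measure Ω} [IsFiniteMeasure Pr] (hf : BddMeas f) : Integrable f Pr := by
  obtain ⟨hf, A, hA⟩ := hf
  exact Integrable.of_bound hf.aestronglyMeasurable A (ae_of_all _ hA)

end BddMeas

/-- Second-order expansion of the exponential, `|eˣ - 1 - x| ≤ x²` for `|x| ≤ 1`, at `x = θ (U' -
U)`. -/
theorem exp_increment_le {θ M U U' : ℝ} (hθ : 0 ≤ θ) (hθM : θ * M ≤ 1) (h : |U' - U| ≤ M) :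
    Real.exp (θ * U') ≤ Real.exp (θ * U) * (1 + θ * (U' - U) + θ ^ 2 * M ^ 2) := by
  have h1 : |θ * (U' - U)| ≤ θ * M := by
    rw [abs_mul, abs_of_nonneg hθ]; exact mul_le_mul_of_nonneg_left h hθ
  have h2 := (abs_le.1 (Real.abs_exp_sub_one_sub_id_le (h1.trans hθM))).2
  have h3 : (θ * (U' - U)) ^ 2 ≤ θ ^ 2 * M ^ 2 := by
    rw [← mul_pow, ← sq_abs]; exact pow_le_pow_left₀ (abs_nonneg _) h1 2
  have h4 : Real.exp (θ * U') = Real.exp (θ * U) * Real.exp (θ * (U' - U)) := by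
    rw [← Real.exp_add]; ring_nf
  rw [h4]
  exact mul_le_mul_of_nonneg_left (by linarith) (Real.exp_pos _).le

/-- A process with bounded increments whose drift is negative when it is large has bounded mean. -/
theorem exists_integral_le_of_drift {Pr : Measure Ω} [IsProbabilityMeasure Pr] {U : ℕ → Ω → ℝ}
    (hU : ∀ k, BddMeas (U k)) (h0 : ∀ ω, U 0 ω = 0) {M η U₀ : ℝ}
    (hM : 0 ≤ M) (hη : 0 < η) (hincr : ∀ k ω, |U (k + 1) ω - U k ω| ≤ M)
    (hdrift : ∀ θ : ℝ, 0 < θ → ∀ k,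
      ∫ ω, {ω | U₀ ≤ U k ω}.indicator (fun ω => Real.exp (θ * U k ω)) ω *
          (U (k + 1) ω - U k ω) ∂Pr ≤
        -η * ∫ ω, {ω | U₀ ≤ U k ω}.indicator (fun ω => Real.exp (θ * U k ω)) ω ∂Pr) :
    ∃ B : ℝ, ∀ k, ∫ ω, U k ω ∂Pr ≤ B := by
  -- The first bound makes the expansion of the exponential valid, the second keeps its quadratic
  -- term below half of the drift, and the third keeps the factor `1 - θ * η / 2` nonnegative.
  set θ : ℝ := min (1 / (M + 1)) (min (η / (2 * (M + 1) ^ 2)) (1 / η)) with hθdef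
  have hθ : 0 < θ := by
    simp only [hθdef, lt_min_iff]; refine ⟨?_, ?_, ?_⟩ <;> positivity
  have hθ1 : θ * (M + 1) ≤ 1 := by
    have : θ ≤ 1 / (M + 1) := min_le_left _ _
    rwa [le_div_iff₀ (by positivity)] at this
  have hθM : θ * M ≤ 1 := by nlinarith
  have hθ2 : θ * M ^ 2 ≤ η / 2 := by
    have : θ ≤ η / (2 * (M + 1) ^ 2) := (min_le_right _ _).trans (min_le_left _ _)
    rw [le_div_iff₀ (by positivity)] at this
    nlinarith
  have hθ3 : θ * η ≤ 1 := by
    have : θ ≤ 1 / η := (min_le_right _ _).trans (min_le_right _ _)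
    rwa [le_div_iff₀ hη] at this
  have hE : ∀ k, BddMeas fun ω => Real.exp (θ * U k ω) := by
    intro k
    obtain ⟨hm, B, hB⟩ := hU k
    refine ⟨(hm.const_mul θ).exp, Real.exp (θ * B), fun ω => ?_⟩
    rw [abs_of_pos (Real.exp_pos _), Real.exp_le_exp]
    exact mul_le_mul_of_nonneg_left ((le_abs_self _).trans (hB ω)) hθ.le
  -- Starting below `U₀`, one step cannot exceed `U₀ + M`; `D` covers this case, where nothing is
  -- known about the drift.
  set D := Real.exp (θ * (U₀ + M)) with hD
  have hstep : ∀ k, ∫ ω, Real.exp (θ * U (k + 1) ω) ∂Pr ≤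
      (1 - θ * η / 2) * ∫ ω, Real.exp (θ * U k ω) ∂Pr + D := by
    intro k
    set s : Set Ω := {ω | U₀ ≤ U k ω} with hs
    have hsm : MeasurableSet s := measurableSet_le measurable_const (hU k).meas
    set H : Ω → ℝ := s.indicator (fun ω => Real.exp (θ * U k ω)) with hH
    have hHb : BddMeas H := (hE k).indicator hsm
    have hpt : ∀ ω, Real.exp (θ * U (k + 1) ω) ≤
        (1 + θ ^ 2 * M ^ 2) * H ω + θ * (H ω * (U (k + 1) ω - U k ω)) + D := by
      intro ω
      by_cases h : ω ∈ s
      · have := exp_increment_le hθ.le hθM (hincr k ω)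
        have hHω : H ω = Real.exp (θ * U k ω) := by simp [hH, h]
        rw [hHω]
        have : 0 < D := Real.exp_pos _
        nlinarith
      · have hHω : H ω = 0 := by simp [hH, h]
        rw [hHω, hD]
        have h1 : U k ω < U₀ := by simpa [hs] using h
        have h2 := (abs_le.1 (hincr k ω)).2
        simp only [mul_zero, zero_mul, zero_add]
        rw [Real.exp_le_exp]
        exact mul_le_mul_of_nonneg_left (by linarith) hθ.le
    have hHU : BddMeas fun ω => H ω * (U (k + 1) ω - U k ω) := hHb.mul ((hU _).sub (hU _))
    have h1 := integral_mono (hE (k + 1)).integrable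
      (((hHb.const_mul (1 + θ ^ 2 * M ^ 2)).add (hHU.const_mul θ)).add (BddMeas.const D)).integrable
      (μ := Pr) hpt
    rw [integral_add ((hHb.const_mul _).add (hHU.const_mul θ)).integrable
      (BddMeas.const D).integrable,
      integral_add (hHb.const_mul _).integrable (hHU.const_mul θ).integrable,
      integral_const_mul, integral_const_mul] at h1
    simp only [integral_const, probReal_univ, smul_eq_mul, one_mul] at h1
    have h2 := hdrift θ hθ k
    have h3 : ∫ ω, H ω ∂Pr ≤ ∫ ω, Real.exp (θ * U k ω) ∂Pr := by
      refine integral_mono hHb.integrable (hE k).integrable fun ω => ?_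
      exact Set.indicator_le_self' (fun _ _ => (Real.exp_pos _).le) ω
    have h4 : 0 ≤ ∫ ω, H ω ∂Pr := integral_nonneg fun ω =>
      Set.indicator_nonneg (fun _ _ => (Real.exp_pos _).le) ω
    have h5 : θ * (∫ ω, H ω * (U (k + 1) ω - U k ω) ∂Pr) ≤ θ * (-η * ∫ ω, H ω ∂Pr) :=
      mul_le_mul_of_nonneg_left h2 hθ.le
    have h6 : θ ^ 2 * M ^ 2 ≤ θ * η / 2 := by nlinarith
    nlinarith
  -- The second entry is the fixed point of the recursion `hstep`, and 1 is the initial value of the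
  -- exponential.
  set R := max 1 (D * (2 / (θ * η))) with hR
  have hbound : ∀ k, ∫ ω, Real.exp (θ * U k ω) ∂Pr ≤ R := by
    intro k
    induction k with
    | zero => simp [h0, hR]
    | succ k ih =>
      refine (hstep k).trans ?_
      have h1 : 0 ≤ 1 - θ * η / 2 := by linarith
      have h2 : D ≤ θ * η / 2 * R := by
        have : D * (2 / (θ * η)) ≤ R := le_max_right _ _
        have h3 : D = θ * η / 2 * (D * (2 / (θ * η))) := by field_simp
        rw [h3]
        exact mul_le_mul_of_nonneg_left this (by positivity)
      nlinarith
  refine ⟨R / θ, fun k => ?_⟩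
  rw [le_div_iff₀ hθ, mul_comm, ← integral_const_mul]
  refine le_trans (integral_mono ((hU k).const_mul θ).integrable (hE k).integrable fun ω => ?_)
    (hbound k)
  have := Real.add_one_le_exp (θ * U k ω)
  simp only
  linarith

end Bounded

/-! ### Max-weight processes -/

section MaxWeight

variable {Ω : Type*} {mΩ : MeasurableSpace Ω} {J M : Type*} [Fintype J] [Fintype M]

/-- The mean support function of a random set. -/
def meanSupport (π : M → ℝ) (O : M → Set (EuclideanSpace ℝ J)) (w : EuclideanSpace ℝ J) : ℝ :=
  ∑ m, π m * support (O m) w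

/-- Queues `w` with arrivals `β` and services `c`, where `c` maximizes the weight `⟪w, c⟫` over the
services possible in the current state `γ`. -/
structure IsMaxWeight (Pr : Measure Ω) (ℱ 𝒢 : ℕ → MeasurableSpace Ω)
    (O : M → Set (EuclideanSpace ℝ J)) (π : M → ℝ) (b : EuclideanSpace ℝ J) (C : ℝ)
    (w β c : ℕ → Ω → EuclideanSpace ℝ J) (γ : ℕ → Ω → M) : Prop where
  zero : ∀ ω, w 0 ω = 0
  succ : ∀ k ω, w (k + 1) ω = posVec (w k ω + (β k ω - c k ω))
  past_le : ∀ k, ℱ k ≤ mΩ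
  current_le : ∀ k, 𝒢 k ≤ mΩ
  indep : ∀ k, Indep (𝒢 k) (ℱ k) Pr
  meas : ∀ k, Measurable[ℱ k] (w k)
  meas_arrival : ∀ k j, Measurable[𝒢 k] fun ω => β k ω j
  meas_state : ∀ k m, MeasurableSet[𝒢 k] {ω | γ k ω = m}
  mean_arrival : ∀ k j, ∫ ω, β k ω j ∂Pr = b j
  prob_state : ∀ k m, Pr.real {ω | γ k ω = m} = π m
  nonempty : ∀ m, (O m).Nonempty
  bound : ∀ m, ∀ o ∈ O m, ‖o‖ ≤ C
  bound_arrival : ∀ k ω, ‖β k ω‖ ≤ C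
  mem : ∀ k ω, c k ω ∈ O (γ k ω)
  optimal : ∀ k ω, ∀ o ∈ O (γ k ω), inner ℝ (w k ω) o ≤ inner ℝ (w k ω) (c k ω)

namespace IsMaxWeight

variable {Pr : Measure Ω} [IsProbabilityMeasure Pr] {ℱ 𝒢 : ℕ → MeasurableSpace Ω}
  {O : M → Set (EuclideanSpace ℝ J)} {π : M → ℝ} {b : EuclideanSpace ℝ J} {C : ℝ}
  {w β c : ℕ → Ω → EuclideanSpace ℝ J} {γ : ℕ → Ω → M}
  (h : IsMaxWeight Pr ℱ 𝒢 O π b C w β c γ)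

include h

theorem nonneg (k : ℕ) (ω : Ω) (j : J) : 0 ≤ w k ω j := by
  cases k with
  | zero => simp [h.zero]
  | succ k => rw [h.succ]; exact le_max_right _ _

theorem norm_step_le (k : ℕ) (ω : Ω) : ‖β k ω - c k ω‖ ≤ 2 * C := by
  have h1 := norm_sub_le (β k ω) (c k ω)
  have h2 := h.bound_arrival k ω
  have h3 := h.bound _ _ (h.mem k ω)
  linarith

theorem norm_sub_le (k : ℕ) (ω : Ω) : ‖w (k + 1) ω - w k ω‖ ≤ 2 * C := by
  rw [h.succ]
  exact (norm_posVec_sub_self_le _ (h.nonneg k ω)).trans (h.norm_step_le k ω)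

theorem norm_le (k : ℕ) (ω : Ω) : ‖w k ω‖ ≤ 2 * C * k := by
  induction k with
  | zero => simp [h.zero]
  | succ k ih =>
    have h1 := h.norm_sub_le k ω
    have h2 := norm_add_le (w (k + 1) ω - w k ω) (w k ω)
    rw [sub_add_cancel] at h2
    push_cast
    linarith

theorem measurable (k : ℕ) : Measurable (w k) := (h.meas k).mono (h.past_le k) le_rfl

theorem bddMeas_comp {f : EuclideanSpace ℝ J → ℝ} (hf : Measurable f) {k : ℕ}
    (hb : ∃ B, ∀ ω, |f (w k ω)| ≤ B) : BddMeas fun ω => f (w k ω) :=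
  ⟨hf.comp (h.measurable k), hb⟩

/-- Bounded increments confine `w k` to a ball depending on `k`, so no integrability question arises
at a fixed time. -/
theorem bddMeas_comp_of_continuous {f : EuclideanSpace ℝ J → ℝ} (hf : Continuous f) (k : ℕ) :
    BddMeas fun ω => f (w k ω) := by
  refine h.bddMeas_comp hf.measurable ?_
  obtain ⟨B, hB⟩ := (isCompact_closedBall (0 : EuclideanSpace ℝ J) (2 * C * k)).exists_bound_of_continuousOn
    hf.continuousOn
  exact ⟨B, fun ω => hB _ (by simpa using h.norm_le k ω)⟩

theorem integral_mul_eq {f : EuclideanSpace ℝ J → ℝ} (hf : Measurable f) {k : ℕ} {Z : Ω → ℝ}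
    (hZ : Measurable[𝒢 k] Z) :
    ∫ ω, f (w k ω) * Z ω ∂Pr = (∫ ω, f (w k ω) ∂Pr) * ∫ ω, Z ω ∂Pr := by
  refine IndepFun.integral_fun_mul_eq_mul_integral ?_
    (hf.comp (h.measurable k)).aestronglyMeasurable
    (hZ.mono (h.current_le k) le_rfl).aestronglyMeasurable
  rw [IndepFun_iff_Indep]
  refine indep_of_indep_of_le_left (indep_of_indep_of_le_right (h.indep k).symm hZ.comap_le) ?_
  exact (hf.comp (h.meas k)).comap_le

theorem bddMeas_arrival (k : ℕ) (j : J) : BddMeas fun ω => β k ω j :=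
  ⟨(h.meas_arrival k j).mono (h.current_le k) le_rfl, C,
    fun ω => (abs_coord_le_norm _ j).trans (h.bound_arrival k ω)⟩

/-- The present is independent of `w k`, so the arrivals may be replaced by their mean. Weighting
with an arbitrary function `f` of `w k` takes the place of conditioning on the past. -/
theorem integral_inner_arrival {f : EuclideanSpace ℝ J → ℝ}
    {v : EuclideanSpace ℝ J → EuclideanSpace ℝ J} (hf : Measurable f) {k : ℕ}
    (hb : ∃ B, ∀ ω, |f (w k ω)| ≤ B) (hv : Continuous v) :
    BddMeas (fun ω => f (w k ω) * inner ℝ (v (w k ω)) (β k ω)) ∧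
    ∫ ω, f (w k ω) * inner ℝ (v (w k ω)) (β k ω) ∂Pr =
      ∫ ω, f (w k ω) * inner ℝ (v (w k ω)) b ∂Pr := by
  have hvj : ∀ j, Continuous fun x => v x j := fun j => by fun_prop
  have hbd : ∀ j, BddMeas fun ω => f (w k ω) * v (w k ω) j := fun j =>
    (h.bddMeas_comp hf hb).mul (h.bddMeas_comp_of_continuous (hvj j) k)
  simp only [inner_euclidean, Finset.mul_sum, ← mul_assoc]
  have h1 : ∀ j, BddMeas fun ω => f (w k ω) * v (w k ω) j * β k ω j := fun j =>
    (hbd j).mul (h.bddMeas_arrival k j)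
  refine ⟨BddMeas.sum fun j _ => h1 j, ?_⟩
  rw [integral_finsetSum _ fun j _ => (h1 j).integrable,
    integral_finsetSum _ fun j _ => ((hbd j).mul (BddMeas.const (b j))).integrable]
  refine Finset.sum_congr rfl fun j _ => ?_
  rw [h.integral_mul_eq (f := fun x => f x * v x j) (hf.mul (hvj j).measurable)
    (h.meas_arrival k j), h.mean_arrival, integral_mul_const]

/-- Splitting over the finitely many states leaves, for each state, a function of the past times an
indicator of the present. -/
theorem integral_support {f : EuclideanSpace ℝ J → ℝ}
    {v : EuclideanSpace ℝ J → EuclideanSpace ℝ J} (hf : Measurable f) {k : ℕ}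
    (hb : ∃ B, ∀ ω, |f (w k ω)| ≤ B) (hv : Continuous v) :
    BddMeas (fun ω => f (w k ω) * support (O (γ k ω)) (v (w k ω))) ∧
    ∫ ω, f (w k ω) * support (O (γ k ω)) (v (w k ω)) ∂Pr =
      ∫ ω, f (w k ω) * meanSupport π O (v (w k ω)) ∂Pr := by
  classical
  have hsv : ∀ m, Continuous fun x => support (O m) (v x) := fun m =>
    (continuous_support (h.nonempty m) (h.bound m)).comp hv
  have hbd : ∀ m, BddMeas fun ω => f (w k ω) * support (O m) (v (w k ω)) := fun m =>
    (h.bddMeas_comp hf hb).mul (h.bddMeas_comp_of_continuous (hsv m) k)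
  have hind : ∀ m, Measurable[𝒢 k] ({ω | γ k ω = m}.indicator fun _ => (1 : ℝ)) := fun m =>
    (measurable_const (a := (1 : ℝ))).indicator (h.meas_state k m)
  have hindb : ∀ m, BddMeas ({ω | γ k ω = m}.indicator fun _ => (1 : ℝ)) := fun m =>
    (BddMeas.const 1).indicator (h.current_le k _ (h.meas_state k m))
  have e : (fun ω => f (w k ω) * support (O (γ k ω)) (v (w k ω))) = fun ω =>
      ∑ m, f (w k ω) * support (O m) (v (w k ω)) *
        {ω | γ k ω = m}.indicator (fun _ => (1 : ℝ)) ω := by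
    funext ω
    simp [Set.indicator_apply]
  have h1 : ∀ m, BddMeas fun ω => f (w k ω) * support (O m) (v (w k ω)) *
        {ω | γ k ω = m}.indicator (fun _ => (1 : ℝ)) ω := fun m => (hbd m).mul (hindb m)
  rw [e]
  refine ⟨BddMeas.sum fun m _ => h1 m, ?_⟩
  simp only [meanSupport, Finset.mul_sum]
  have h2 : ∀ m, BddMeas fun ω => f (w k ω) * (π m * support (O m) (v (w k ω))) := fun m => by
    have := (hbd m).const_mul (π m)
    convert this using 2
    ring
  rw [integral_finsetSum _ fun m _ => (h1 m).integrable,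
    integral_finsetSum _ fun m _ => (h2 m).integrable]
  refine Finset.sum_congr rfl fun m _ => ?_
  rw [h.integral_mul_eq (f := fun x => f x * support (O m) (v x)) (hf.mul (hsv m).measurable)
    (hind m), integral_indicator_const _ (h.current_le k _ (h.meas_state k m)), h.prob_state,
    ← integral_mul_const]
  congr 1
  funext ω
  simp only [smul_eq_mul]
  ring

theorem continuous_meanSupport : Continuous (meanSupport π O) := by
  unfold meanSupport
  exact continuous_finsetSum _ fun m _ =>
    continuous_const.mul (continuous_support (h.nonempty m) (h.bound m))

/-- Max-weight service attains the support in direction `w`, while in direction `y` any service is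
at most the support. So `⟪w - y, c⟫` is at least the difference of the two supports. -/
theorem norm_sq_step_le (k : ℕ) (ω : Ω) {y : EuclideanSpace ℝ J} (hy : ∀ j, 0 ≤ y j) :
    ‖w (k + 1) ω - y‖ ^ 2 - ‖w k ω - y‖ ^ 2 ≤ 2 * inner ℝ (w k ω - y) (β k ω)
      - 2 * support (O (γ k ω)) (w k ω) + 2 * support (O (γ k ω)) y + 4 * C ^ 2 := by
  have h1 : ‖w (k + 1) ω - y‖ ≤ ‖(w k ω - y) + (β k ω - c k ω)‖ := by
    rw [h.succ]
    refine (norm_posVec_sub_le _ hy).trans (le_of_eq ?_)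
    congr 1; abel
  have h2 : ‖w (k + 1) ω - y‖ ^ 2 ≤ ‖(w k ω - y) + (β k ω - c k ω)‖ ^ 2 :=
    pow_le_pow_left₀ (norm_nonneg _) h1 2
  rw [norm_add_sq_real, inner_sub_right] at h2
  have h3 : ‖β k ω - c k ω‖ ^ 2 ≤ (2 * C) ^ 2 :=
    pow_le_pow_left₀ (norm_nonneg _) (h.norm_step_le k ω) 2
  have h4 : support (O (γ k ω)) (w k ω) ≤ inner ℝ (w k ω) (c k ω) :=
    support_le (h.nonempty _) (h.optimal k ω)
  have h5 := inner_le_support (h.bound _) y (h.mem k ω)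
  have h6 : inner ℝ (w k ω - y) (c k ω) = inner ℝ (w k ω) (c k ω) - inner ℝ y (c k ω) :=
    inner_sub_left _ _ _
  nlinarith

/-- The drift of the squared distance to a moving reference point. -/
theorem integral_drift_le {f : EuclideanSpace ℝ J → ℝ}
    {p : EuclideanSpace ℝ J → EuclideanSpace ℝ J} (hf : Measurable f) {k : ℕ}
    (hb : ∃ B, ∀ ω, |f (w k ω)| ≤ B) (hf0 : ∀ x, 0 ≤ f x) (hp : Continuous p)
    (hp0 : ∀ x j, 0 ≤ p x j) :
    ∫ ω, f (w k ω) * (‖w (k + 1) ω - p (w k ω)‖ ^ 2 - ‖w k ω - p (w k ω)‖ ^ 2) ∂Pr ≤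
      ∫ ω, f (w k ω) * (2 * (inner ℝ (w k ω - p (w k ω)) b - meanSupport π O (w k ω)
        + meanSupport π O (p (w k ω))) + 4 * C ^ 2) ∂Pr := by
  have hfb := h.bddMeas_comp hf hb
  obtain ⟨b1, e1⟩ := h.integral_inner_arrival hf hb (v := fun x => x - p x) (by fun_prop)
  obtain ⟨b2, e2⟩ := h.integral_support hf hb continuous_id
  obtain ⟨b3, e3⟩ := h.integral_support hf hb hp
  have hcm := h.continuous_meanSupport
  have c1 : BddMeas fun ω => f (w k ω) * inner ℝ (w k ω - p (w k ω)) b :=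
    hfb.mul (h.bddMeas_comp_of_continuous (f := fun x => inner ℝ (x - p x) b) (by fun_prop) k)
  have c2 : BddMeas fun ω => f (w k ω) * meanSupport π O (w k ω) :=
    hfb.mul (h.bddMeas_comp_of_continuous hcm k)
  have c3 : BddMeas fun ω => f (w k ω) * meanSupport π O (p (w k ω)) :=
    hfb.mul (h.bddMeas_comp_of_continuous (hcm.comp hp) k)
  have c4 : BddMeas fun ω => f (w k ω) * (4 * C ^ 2) := hfb.mul (BddMeas.const _)
  have key : ∫ ω, (2 * (f (w k ω) * inner ℝ (w k ω - p (w k ω)) (β k ω))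
      - 2 * (f (w k ω) * support (O (γ k ω)) (w k ω))
      + 2 * (f (w k ω) * support (O (γ k ω)) (p (w k ω))) + f (w k ω) * (4 * C ^ 2)) ∂Pr =
      ∫ ω, (2 * (f (w k ω) * inner ℝ (w k ω - p (w k ω)) b)
      - 2 * (f (w k ω) * meanSupport π O (w k ω))
      + 2 * (f (w k ω) * meanSupport π O (p (w k ω))) + f (w k ω) * (4 * C ^ 2)) ∂Pr := by
    rw [integral_add, integral_add, integral_sub, integral_const_mul, integral_const_mul,
      integral_const_mul, integral_add, integral_add, integral_sub, integral_const_mul,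
      integral_const_mul, integral_const_mul, e1, e3]
    · simp only [id] at e2
      rw [e2]
    · exact (c1.const_mul 2).integrable
    · exact (c2.const_mul 2).integrable
    · exact ((c1.const_mul 2).sub (c2.const_mul 2)).integrable
    · exact (c3.const_mul 2).integrable
    · exact (((c1.const_mul 2).sub (c2.const_mul 2)).add (c3.const_mul 2)).integrable
    · exact c4.integrable
    · exact (b1.const_mul 2).integrable
    · exact (b2.const_mul 2).integrable
    · exact ((b1.const_mul 2).sub (b2.const_mul 2)).integrable
    · exact (b3.const_mul 2).integrable
    · exact (((b1.const_mul 2).sub (b2.const_mul 2)).add (b3.const_mul 2)).integrable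
    · exact c4.integrable
  have hR : BddMeas fun ω => 2 * (f (w k ω) * inner ℝ (w k ω - p (w k ω)) (β k ω))
      - 2 * (f (w k ω) * support (O (γ k ω)) (w k ω))
      + 2 * (f (w k ω) * support (O (γ k ω)) (p (w k ω))) + f (w k ω) * (4 * C ^ 2) :=
    (((b1.const_mul 2).sub (b2.const_mul 2)).add (b3.const_mul 2)).add c4
  have hL : BddMeas fun ω =>
      f (w k ω) * (‖w (k + 1) ω - p (w k ω)‖ ^ 2 - ‖w k ω - p (w k ω)‖ ^ 2) := by
    refine hfb.mul (BddMeas.sub ?_ (h.bddMeas_comp_of_continuous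
      (f := fun x => ‖x - p x‖ ^ 2) (by fun_prop) k))
    obtain ⟨-, B, hB⟩ := h.bddMeas_comp_of_continuous (f := fun x => ‖p x‖) (by fun_prop) k
    refine ⟨?_, (2 * C * (k + 1) + B) ^ 2, fun ω => ?_⟩
    · exact ((h.measurable (k + 1)).sub (hp.measurable.comp (h.measurable k))).norm.pow_const 2
    · rw [abs_of_nonneg (by positivity)]
      refine pow_le_pow_left₀ (norm_nonneg _) ((_root_.norm_sub_le _ _).trans ?_) 2
      have h1 := h.norm_le (k + 1) ω
      have h2 := (le_abs_self _).trans (hB ω)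
      push_cast at h1
      linarith
  calc _ ≤ _ := integral_mono hL.integrable hR.integrable fun ω => by
        have := mul_le_mul_of_nonneg_left (h.norm_sq_step_le k ω (hp0 (w k ω))) (hf0 (w k ω))
        simp only
        linarith
    _ = _ := key
    _ = _ := by congr 1; funext ω; ring

end IsMaxWeight

end MaxWeight

/-! ### Growth of max-weight processes -/

/-- Nonnegative random variables with summable means tend to zero almost surely. -/
theorem ae_tendsto_zero_of_summable_integral {Ω : Type*} {mΩ : MeasurableSpace Ω} {Pr : Measure Ω}
    {f : ℕ → Ω → ℝ} (hf : ∀ n, Integrable (f n) Pr) (h0 : ∀ n ω, 0 ≤ f n ω)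
    (hs : Summable fun n => ∫ ω, f n ω ∂Pr) :
    ∀ᵐ ω ∂Pr, Tendsto (fun n => f n ω) atTop (𝓝 0) := by
  have h1 : ∫⁻ ω, ∑' n, ENNReal.ofReal (f n ω) ∂Pr ≠ ⊤ := by
    rw [lintegral_tsum fun n => (hf n).aestronglyMeasurable.aemeasurable.ennreal_ofReal]
    have : ∀ n, ∫⁻ ω, ENNReal.ofReal (f n ω) ∂Pr = ENNReal.ofReal (∫ ω, f n ω ∂Pr) := fun n =>
      (ofReal_integral_eq_lintegral_ofReal (hf n) (ae_of_all _ (h0 n))).symm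
    simp only [this]
    exact hs.tsum_ofReal_ne_top
  have h2 := ae_lt_top' (AEMeasurable.tsum fun n =>
    (hf n).aestronglyMeasurable.aemeasurable.ennreal_ofReal) h1
  filter_upwards [h2] with ω hω
  have h3 := ENNReal.tendsto_atTop_zero_of_tsum_ne_top hω.ne
  have h4 := (ENNReal.tendsto_toReal ENNReal.zero_ne_top).comp h3
  simpa [Function.comp_def, ENNReal.toReal_ofReal (h0 _ ω)] using h4

/-- Control of a sequence with bounded increments along the squares. -/
theorem tendsto_div_of_tendsto_squares {x : ℕ → ℝ} {M : ℝ} (h0 : ∀ k, 0 ≤ x k)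
    (hincr : ∀ k, x (k + 1) ≤ x k + M)
    (hsq : Tendsto (fun n : ℕ => x (n ^ 2) / (n : ℝ) ^ 2) atTop (𝓝 0)) :
    Tendsto (fun k : ℕ => x k / k) atTop (𝓝 0) := by
  set M' := max M 0 with hM'
  have hM0 : 0 ≤ M' := le_max_right _ _
  have hincr' : ∀ k l, x (k + l) ≤ x k + M' * l := by
    intro k l
    induction l with
    | zero => simp
    | succ l ih =>
      have := hincr (k + l)
      have : M ≤ M' := le_max_left _ _
      push_cast
      rw [← add_assoc]
      linarith
  have hsqrt : Tendsto Nat.sqrt atTop atTop := by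
    refine tendsto_atTop.2 fun n => ?_
    filter_upwards [eventually_ge_atTop (n * n)] with k hk
    exact Nat.le_sqrt.2 hk
  have hlim : Tendsto (fun k : ℕ => x (k.sqrt ^ 2) / (k.sqrt : ℝ) ^ 2 + 2 * M' / (k.sqrt : ℝ)) atTop
      (𝓝 0) := by
    have h1 := hsq.comp hsqrt
    have h2 := (tendsto_const_div_atTop_nhds_zero_nat (2 * M')).comp hsqrt
    simpa [Function.comp_def] using h1.add h2
  refine squeeze_zero' (Eventually.of_forall fun k => div_nonneg (h0 k) (Nat.cast_nonneg k)) ?_ hlim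
  filter_upwards [eventually_ge_atTop 1] with k hk
  set n := k.sqrt with hn
  have hn1 : 1 ≤ n := Nat.le_sqrt.2 (by simpa using hk)
  have hle : n ^ 2 ≤ k := by rw [pow_two]; exact Nat.sqrt_le k
  -- Between consecutive squares there are at most `2n` increments, negligible against `n²`.
  have hlt : k ≤ n ^ 2 + 2 * n := by
    have := Nat.sqrt_le_add k; rw [← hn] at this; rw [pow_two]; omega
  have hx : x k ≤ x (n ^ 2) + M' * (2 * n) := by
    have h1 := hincr' (n ^ 2) (k - n ^ 2)
    rw [Nat.add_sub_cancel' hle] at h1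
    have h2 : ((k - n ^ 2 : ℕ) : ℝ) ≤ 2 * n := by
      have : k - n ^ 2 ≤ 2 * n := by omega
      exact_mod_cast this
    nlinarith
  have hnpos : (0 : ℝ) < n := by exact_mod_cast hn1
  have hle' : (n : ℝ) ^ 2 ≤ k := by exact_mod_cast hle
  calc x k / k ≤ x k / (n : ℝ) ^ 2 := div_le_div_of_nonneg_left (h0 k) (by positivity) hle'
    _ ≤ (x (n ^ 2) + M' * (2 * n)) / (n : ℝ) ^ 2 := by gcongr
    _ = _ := by field_simp

namespace IsMaxWeight

variable {Ω : Type*} {mΩ : MeasurableSpace Ω} {J M : Type*} [Fintype J] [Fintype M]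
  {Pr : Measure Ω} [IsProbabilityMeasure Pr] {ℱ 𝒢 : ℕ → MeasurableSpace Ω}
  {O : M → Set (EuclideanSpace ℝ J)} {π : M → ℝ} {b : EuclideanSpace ℝ J} {C : ℝ}
  {w β c : ℕ → Ω → EuclideanSpace ℝ J} {γ : ℕ → Ω → M}
  (h : IsMaxWeight Pr ℱ 𝒢 O π b C w β c γ)

include h

theorem meanSupport_zero : meanSupport π O 0 = 0 := by
  refine Finset.sum_eq_zero fun m _ => ?_
  have := abs_support_le (h.nonempty m) (h.bound m) 0
  simp only [norm_zero, mul_zero, abs_nonpos_iff] at this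
  rw [this, mul_zero]

/-- With reference point 0 and nonnegative slack, only the constant `4 * C ^ 2` of the drift
survives each step. -/
theorem integral_norm_sq_le
    (hb : ∀ v : EuclideanSpace ℝ J, (∀ j, 0 ≤ v j) → inner ℝ v b ≤ meanSupport π O v) (k : ℕ) :
    ∫ ω, ‖w k ω‖ ^ 2 ∂Pr ≤ 4 * C ^ 2 * k := by
  have hbd : ∀ k, BddMeas fun ω => ‖w k ω‖ ^ 2 := fun k =>
    h.bddMeas_comp_of_continuous (f := fun x => ‖x‖ ^ 2) (by fun_prop) k
  induction k with
  | zero => simp [h.zero]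
  | succ k ih =>
    have h1 := h.integral_drift_le (f := fun _ => 1) (p := fun _ => 0) (k := k) measurable_const
      ⟨1, by simp⟩ (by simp) continuous_const (by simp)
    simp only [one_mul, sub_zero, h.meanSupport_zero, add_zero] at h1
    rw [integral_sub (hbd _).integrable (hbd _).integrable] at h1
    have h2 : ∫ ω, (2 * (inner ℝ (w k ω) b - meanSupport π O (w k ω)) + 4 * C ^ 2) ∂Pr ≤
        ∫ _, (4 * C ^ 2) ∂Pr := by
      refine integral_mono (BddMeas.integrable ?_) (BddMeas.const _).integrable fun ω => ?_
      · have := h.continuous_meanSupport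
        exact h.bddMeas_comp_of_continuous
          (f := fun x => 2 * (inner ℝ x b - meanSupport π O x) + 4 * C ^ 2) (by fun_prop) k
      · have := hb (w k ω) (h.nonneg k ω)
        simp only
        linarith
    simp only [integral_const, probReal_univ, smul_eq_mul, one_mul] at h2
    push_cast
    linarith

/-- At times `n²` the means of `‖w‖² / n⁴` are at most `4C² / n²`, hence summable; bounded
increments fill the gaps between the squares. -/
theorem ae_tendsto_div
    (hb : ∀ v : EuclideanSpace ℝ J, (∀ j, 0 ≤ v j) → inner ℝ v b ≤ meanSupport π O v) :
    ∀ᵐ ω ∂Pr, ∀ j, Tendsto (fun k : ℕ => w k ω j / k) atTop (𝓝 0) := by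
  have hbd : ∀ k, BddMeas fun ω => ‖w k ω‖ ^ 2 := fun k =>
    h.bddMeas_comp_of_continuous (f := fun x => ‖x‖ ^ 2) (by fun_prop) k
  have h1 : ∀ᵐ ω ∂Pr, Tendsto (fun n : ℕ => ‖w (n ^ 2) ω‖ ^ 2 / ((n : ℝ) ^ 2) ^ 2) atTop (𝓝 0) := by
    refine ae_tendsto_zero_of_summable_integral (fun n => ((hbd _).integrable).div_const _)
      (fun n ω => by positivity) ?_
    have hs : Summable fun n : ℕ => 4 * C ^ 2 * (1 / (n : ℝ) ^ 2) :=
      (Real.summable_one_div_nat_pow.2 one_lt_two).mul_left _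
    refine Summable.of_nonneg_of_le (fun n => integral_nonneg fun ω => by positivity)
      (fun n => ?_) hs
    rw [integral_div]
    have h2 := h.integral_norm_sq_le hb (n ^ 2)
    push_cast at h2
    rcases Nat.eq_zero_or_pos n with rfl | hn
    · simp
    · have hn : (0 : ℝ) < n := by exact_mod_cast hn
      rw [div_le_iff₀ (by positivity)]
      refine h2.trans (le_of_eq ?_)
      field_simp
  filter_upwards [h1] with ω hω j
  have h2 : Tendsto (fun n : ℕ => ‖w (n ^ 2) ω‖ / (n : ℝ) ^ 2) atTop (𝓝 0) := by
    have := (Real.continuous_sqrt.tendsto 0).comp hω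
    rw [Real.sqrt_zero] at this
    refine this.congr fun n => ?_
    simp only [Function.comp]
    rw [← div_pow, Real.sqrt_sq (by positivity)]
  have h3 : Tendsto (fun k : ℕ => ‖w k ω‖ / k) atTop (𝓝 0) :=
    tendsto_div_of_tendsto_squares (M := 2 * C) (fun k => norm_nonneg _) (fun k => by
      have h4 := h.norm_sub_le k ω
      have h5 := norm_add_le (w (k + 1) ω - w k ω) (w k ω)
      rw [sub_add_cancel] at h5
      linarith) h2
  refine squeeze_zero (fun k => div_nonneg (h.nonneg k ω j) (Nat.cast_nonneg k)) (fun k => ?_) h3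
  gcongr
  exact (le_abs_self _).trans (abs_coord_le_norm _ j)

/-- If the drift is at least proportional to the distance from a convex cone `K` of directions
without slack, the mean distance from `K` stays bounded. -/
theorem exists_integral_norm_sub_le {K : Set (EuclideanSpace ℝ J)}
    (hcl : IsClosed K) (hK : Convex ℝ K) (h0 : (0 : EuclideanSpace ℝ J) ∈ K)
    (hnn : ∀ y ∈ K, ∀ j, 0 ≤ y j) (hKb : ∀ y ∈ K, meanSupport π O y ≤ inner ℝ y b)
    {κ : ℝ} (hκ : 0 < κ)
    (hslack : ∀ k, ∀ᵐ ω ∂Pr, ∃ y ∈ K,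
      κ * ‖w k ω - y‖ ≤ meanSupport π O (w k ω) - inner ℝ (w k ω) b) :
    ∃ p : EuclideanSpace ℝ J → EuclideanSpace ℝ J, (∀ x, p x ∈ K) ∧
      (∀ k, Integrable (fun ω => ‖w k ω - p (w k ω)‖) Pr) ∧
      ∃ B : ℝ, ∀ k, ∫ ω, ‖w k ω - p (w k ω)‖ ∂Pr ≤ B := by
  obtain ⟨p, hlip, hp, hvar⟩ := exists_metricProjection ⟨0, h0⟩ hcl hK
  have hpc : Continuous p := hlip.continuous
  have hmin : ∀ x, ∀ y ∈ K, ‖x - p x‖ ≤ ‖x - y‖ := fun x y hy =>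
    norm_sub_le_of_inner_nonpos (hvar x y hy)
  set d : EuclideanSpace ℝ J → ℝ := fun x => ‖x - p x‖ with hd
  have hdc : Continuous d := by fun_prop
  have hd0 : ∀ x, 0 ≤ d x := fun x => norm_nonneg _
  have hdle : ∀ x y, d x ≤ d y + ‖x - y‖ := by
    intro x y
    refine (hmin x (p y) (hp y)).trans ?_
    have : x - p y = (y - p y) + (x - y) := by abel
    rw [this]
    exact norm_add_le _ _
  have hU : ∀ k, BddMeas fun ω => d (w k ω) := fun k => h.bddMeas_comp_of_continuous hdc k
  refine ⟨p, hp, fun k => (hU k).integrable, ?_⟩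
  have hC : 0 ≤ C := by
    obtain ⟨ω⟩ := nonempty_of_isProbabilityMeasure Pr
    exact (norm_nonneg _).trans (h.bound_arrival 0 ω)
  -- Beyond this distance `κ * d` exceeds the constant `4 * C ^ 2` of the quadratic drift.
  set U₀ : ℝ := (4 * C ^ 2 + 1) / κ with hU₀
  have hU₀pos : 0 < U₀ := by positivity
  have hp00 : p 0 = 0 := by
    have := hmin 0 0 h0
    simpa using this
  refine exists_integral_le_of_drift (U := fun k ω => d (w k ω)) (M := 2 * C) (η := κ / 2)
    (U₀ := U₀) hU (fun ω => by simp [hd, h.zero, hp00]) (by positivity) (by positivity)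
    (fun k ω => ?_) fun θ hθ k => ?_
  · have h1 := h.norm_sub_le k ω
    have h2 := hdle (w (k + 1) ω) (w k ω)
    have h3 := hdle (w k ω) (w (k + 1) ω)
    rw [norm_sub_rev] at h3
    rw [abs_le]; constructor <;> linarith
  · set H : EuclideanSpace ℝ J → ℝ := {x | U₀ ≤ d x}.indicator fun x => Real.exp (θ * d x) with hH
    have hHm : Measurable H := by
      refine Measurable.indicator ?_ (measurableSet_le measurable_const hdc.measurable)
      exact (Continuous.measurable (by fun_prop))
    have hH0 : ∀ x, 0 ≤ H x := fun x => Set.indicator_nonneg (fun _ _ => (Real.exp_pos _).le) x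
    have hHlow : ∀ x, H x ≠ 0 → U₀ ≤ d x := fun x hx => by
      by_contra hcon
      exact hx (by simp [hH, hcon])
    obtain ⟨B, hB⟩ : ∃ B, ∀ ω, |H (w k ω)| ≤ B := by
      obtain ⟨-, B, hB⟩ := h.bddMeas_comp_of_continuous (f := fun x => Real.exp (θ * d x))
        (by fun_prop) k
      refine ⟨B, fun ω => ?_⟩
      by_cases hx : U₀ ≤ d (w k ω)
      · simpa [hH, hx] using hB ω
      · simpa [hH, hx] using (abs_nonneg _).trans (hB ω)
    -- This weight converts the drift of `d²` into that of `d`, through `2 d (d' - d) ≤ d'² - d²`.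
    -- Where `H` is nonzero the maximum is `d`; elsewhere it only keeps the denominator positive.
    set f : EuclideanSpace ℝ J → ℝ := fun x => H x / (2 * max (d x) U₀) with hf
    have hf0 : ∀ x, 0 ≤ f x := fun x => div_nonneg (hH0 x) (by positivity)
    have hfm : Measurable f :=
      hHm.div (measurable_const.mul (hdc.measurable.max measurable_const))
    have hfB : ∃ B, ∀ ω, |f (w k ω)| ≤ B := by
      refine ⟨B / (2 * U₀), fun ω => ?_⟩
      rw [abs_of_nonneg (hf0 _)]
      have h1 := (le_abs_self _).trans (hB ω)
      have h2 : 0 ≤ B := (hH0 _).trans h1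
      have h3 : 2 * U₀ ≤ 2 * max (d (w k ω)) U₀ := by
        have := le_max_right (d (w k ω)) U₀; linarith
      exact div_le_div₀ h2 h1 (by positivity) h3
    have hfH : ∀ x, f x * (2 * d x) = H x := by
      intro x
      by_cases hx : H x = 0
      · simp [hf, hx]
      · have h1 := hHlow x hx
        have h2 : max (d x) U₀ = d x := max_eq_left h1
        simp only [hf, h2]
        have : 0 < d x := hU₀pos.trans_le h1
        field_simp
    have h1 := h.integral_drift_le hfm hfB hf0 hpc fun x j => hnn _ (hp x) j
    have e : ∀ ω, {ω | U₀ ≤ d (w k ω)}.indicator (fun ω => Real.exp (θ * d (w k ω))) ω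
        = H (w k ω) := fun ω => rfl
    simp only [e]
    have hHb : BddMeas fun ω => H (w k ω) := h.bddMeas_comp hHm ⟨B, hB⟩
    have hfb : BddMeas fun ω => f (w k ω) := h.bddMeas_comp hfm hfB
    have hms := h.continuous_meanSupport
    have hwp : BddMeas fun ω => ‖w (k + 1) ω - p (w k ω)‖ ^ 2 - ‖w k ω - p (w k ω)‖ ^ 2 := by
      refine BddMeas.sub ?_ (h.bddMeas_comp_of_continuous
        (f := fun x => ‖x - p x‖ ^ 2) (by fun_prop) k)
      obtain ⟨-, B, hB⟩ := h.bddMeas_comp_of_continuous (f := fun x => ‖p x‖) (by fun_prop) k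
      refine ⟨?_, (2 * C * (k + 1) + B) ^ 2, fun ω => ?_⟩
      · exact ((h.measurable (k + 1)).sub (hpc.measurable.comp (h.measurable k))).norm.pow_const 2
      · rw [abs_of_nonneg (by positivity)]
        refine pow_le_pow_left₀ (norm_nonneg _) ((_root_.norm_sub_le _ _).trans ?_) 2
        have h1 := h.norm_le (k + 1) ω
        have h2 := (le_abs_self _).trans (hB ω)
        push_cast at h1
        linarith
    calc ∫ ω, H (w k ω) * (d (w (k + 1) ω) - d (w k ω)) ∂Pr
        ≤ ∫ ω, f (w k ω) * (‖w (k + 1) ω - p (w k ω)‖ ^ 2 - ‖w k ω - p (w k ω)‖ ^ 2) ∂Pr := by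
          refine integral_mono (hHb.mul ((hU (k + 1)).sub (hU k))).integrable
            (hfb.mul hwp).integrable fun ω => ?_
          -- The old projection is still a point of the cone, so it bounds the new distance.
          have h2 : d (w (k + 1) ω) ≤ ‖w (k + 1) ω - p (w k ω)‖ := hmin _ _ (hp _)
          have h3 : 2 * d (w k ω) * (d (w (k + 1) ω) - d (w k ω)) ≤
              ‖w (k + 1) ω - p (w k ω)‖ ^ 2 - ‖w k ω - p (w k ω)‖ ^ 2 := by
            have h4 : d (w (k + 1) ω) ^ 2 ≤ ‖w (k + 1) ω - p (w k ω)‖ ^ 2 :=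
              pow_le_pow_left₀ (hd0 _) h2 2
            have h5 : ‖w k ω - p (w k ω)‖ = d (w k ω) := rfl
            rw [h5]
            nlinarith [sq_nonneg (d (w (k + 1) ω) - d (w k ω))]
          simp only
          rw [← hfH, mul_assoc]
          exact mul_le_mul_of_nonneg_left h3 (hf0 _)
      _ ≤ _ := h1
      _ ≤ ∫ ω, -(κ / 2) * H (w k ω) ∂Pr := by
          refine integral_mono_ae (BddMeas.integrable (hfb.mul ?_))
            (hHb.const_mul _).integrable ?_
          · exact h.bddMeas_comp_of_continuous (f := fun x => 2 * (inner ℝ (x - p x) b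
              - meanSupport π O x + meanSupport π O (p x)) + 4 * C ^ 2) (by fun_prop) k
          -- The terms of `p (w k ω)` contribute nothing positive because that point has no slack.
          -- Half of the drift `-2 * κ * d` pays for `4 * C ^ 2`; the other half, divided by `2 *
          -- d`, leaves the rate `κ / 2`.
          · filter_upwards [hslack k] with ω ⟨y, hy, hyκ⟩
            by_cases hx : H (w k ω) = 0
            · simp [hf, hx]
            have h2 : U₀ ≤ d (w k ω) := hHlow _ hx
            have h3 := hKb _ (hp (w k ω))
            have h4 : κ * d (w k ω) ≤ meanSupport π O (w k ω) - inner ℝ (w k ω) b :=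
              (mul_le_mul_of_nonneg_left (hmin _ y hy) hκ.le).trans hyκ
            have h5 : 4 * C ^ 2 ≤ κ * d (w k ω) := by
              have : 4 * C ^ 2 + 1 ≤ κ * d (w k ω) := by
                rw [hU₀, div_le_iff₀ hκ] at h2; linarith
              linarith
            rw [inner_sub_left, ← hfH]
            have h6 : 2 * (inner ℝ (w k ω) b - inner ℝ (p (w k ω)) b - meanSupport π O (w k ω)
                + meanSupport π O (p (w k ω))) + 4 * C ^ 2 ≤ -(κ / 2) * (2 * d (w k ω)) := by
              linarith
            have := mul_le_mul_of_nonneg_left h6 (hf0 (w k ω))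
            linarith
      _ = _ := integral_const_mul _ _

end IsMaxWeight

/-! ### Limits of bounded sequences -/

section Limits

variable {f g : ℕ → ℝ} {B x : ℝ}

theorem isBoundedUnder_of_abs_le (hf : ∀ k, |f k| ≤ B) :
    IsBoundedUnder (· ≤ ·) atTop f ∧ IsBoundedUnder (· ≥ ·) atTop f :=
  ⟨isBoundedUnder_of ⟨B, fun k => (abs_le.1 (hf k)).2⟩,
    isBoundedUnder_of ⟨-B, fun k => (abs_le.1 (hf k)).1⟩⟩

theorem le_liminf_of_tendsto (hf : ∀ k, |f k| ≤ B) (hg : Tendsto g atTop (𝓝 x))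
    (h : ∀ᶠ k in atTop, g k ≤ f k) : x ≤ liminf f atTop := by
  rw [← hg.liminf_eq]
  exact liminf_le_liminf h hg.isBoundedUnder_ge
    (isBoundedUnder_of_abs_le hf).1.isCoboundedUnder_ge

theorem limsup_le_of_tendsto (hf : ∀ k, |f k| ≤ B) (hg : Tendsto g atTop (𝓝 x))
    (h : ∀ᶠ k in atTop, f k ≤ g k) : limsup f atTop ≤ x := by
  rw [← hg.limsup_eq]
  exact limsup_le_limsup h (isBoundedUnder_of_abs_le hf).2.isCoboundedUnder_le
    hg.isBoundedUnder_le

theorem eventually_sub_le_of_le_liminf (hf : ∀ k, |f k| ≤ B) (h : x ≤ liminf f atTop) {e : ℝ}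
    (he : 0 < e) : ∀ᶠ k in atTop, x - e ≤ f k :=
  (eventually_lt_of_lt_liminf (lt_of_lt_of_le (sub_lt_self x he) h)
    (isBoundedUnder_of_abs_le hf).2).mono fun _ hk => hk.le

theorem eventually_le_add_of_limsup_le (hf : ∀ k, |f k| ≤ B) (h : limsup f atTop ≤ x) {e : ℝ}
    (he : 0 < e) : ∀ᶠ k in atTop, f k ≤ x + e :=
  (eventually_lt_of_limsup_lt (lt_of_le_of_lt h (lt_add_of_pos_right x he))
    (isBoundedUnder_of_abs_le hf).1).mono fun _ hk => hk.le

theorem abs_average_le (hf : ∀ k, |f k| ≤ B) (K : ℕ) :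
    |(∑ k ∈ Finset.range K, f k) / K| ≤ B := by
  have hB : 0 ≤ B := (abs_nonneg _).trans (hf 0)
  rcases Nat.eq_zero_or_pos K with rfl | hK
  · simpa using hB
  · have hK : (0 : ℝ) < K := by exact_mod_cast hK
    rw [abs_div, abs_of_pos hK, div_le_iff₀ hK]
    refine (Finset.abs_sum_le_sum_abs _ _).trans ?_
    refine (Finset.sum_le_sum fun k _ => hf k).trans (le_of_eq ?_)
    simp [mul_comm]

theorem tendsto_div_of_sq_le {B : ℝ} (h0 : ∀ k, 0 ≤ f k) (h : ∀ k : ℕ, f k ^ 2 ≤ B * k) :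
    Tendsto (fun k : ℕ => f k / k) atTop (𝓝 0) := by
  have h1 : Tendsto (fun k : ℕ => √(B / k)) atTop (𝓝 0) := by
    have := (Real.continuous_sqrt.tendsto 0).comp (tendsto_const_div_atTop_nhds_zero_nat B)
    simpa [Function.comp_def] using this
  refine squeeze_zero (fun k => div_nonneg (h0 k) (Nat.cast_nonneg k)) (fun k => ?_) h1
  rcases Nat.eq_zero_or_pos k with rfl | hk
  · simp
  · have hk : (0 : ℝ) < k := by exact_mod_cast hk
    refine Real.le_sqrt_of_sq_le ?_
    rw [div_pow, div_le_div_iff₀ (by positivity) hk]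
    nlinarith [h k]

end Limits

/-! ### Outcome vectors of a slot and their averages -/

theorem rate_nonneg {p g : ℝ} (hp : 0 ≤ p) (hg : 0 ≤ g) : 0 ≤ rate p g :=
  Real.log_nonneg (by nlinarith [mul_nonneg hp hg])

theorem rate_le {p g : ℝ} (hp : 0 ≤ p) (hg : 0 ≤ g) : rate p g ≤ p * g := by
  have := Real.log_le_sub_one_of_pos (show 0 < 1 + p * g by nlinarith [mul_nonneg hp hg])
  unfold rate
  linarith

theorem norm_le_sqrt_of_abs_le {J : Type*} [Fintype J] {x : EuclideanSpace ℝ J} {B : ℝ}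
    (h : ∀ j, |x j| ≤ B) : ‖x‖ ≤ √(Fintype.card J * B ^ 2) := by
  refine Real.le_sqrt_of_sq_le ?_
  rw [EuclideanSpace.real_norm_sq_eq]
  refine (Finset.sum_le_sum (g := fun _ => B ^ 2) fun j _ => ?_).trans (le_of_eq (by simp))
  rw [← sq_abs]
  exact pow_le_pow_left₀ (abs_nonneg _) (h j) 2

namespace System

variable {nR nN : ℕ} (S : System nR nN)

/-- Space of the queues: `none` is the power queue, `some i` the queue of user `i`. -/
abbrev QueueSpace (nR nN : ℕ) : Type := EuclideanSpace ℝ (Option (User nR nN))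

open Classical in
/-- The decrease of all queues in a slot with fading state `m` and allocation `(μ, P)`. -/
def outcome (m : S.State) (μ P : User nR nN → ℝ) : QueueSpace nR nN :=
  WithLp.toLp 2 fun
    | none => -((∑ i, P i * μ i) / S.Ts)
    | some (Sum.inl i) => if μ (Sum.inl i) = 0 then 0 else 1
    | some (Sum.inr i) => μ (Sum.inr i) * rate (P (Sum.inr i)) (m (Sum.inr i))

/-- The outcomes possible in state `m`. -/
def outcomes (m : S.State) : Set (QueueSpace nR nN) :=
  {o | ∃ μ P, S.IsSlotAllocation m μ P ∧ S.outcome m μ P = o}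

/-- The increase of all queues caused by the arrivals `a`. -/
def inflow (a : User nR nN → ℝ) : QueueSpace nR nN :=
  WithLp.toLp 2 fun
    | none => -S.Pavg
    | some (Sum.inl i) => a (Sum.inl i) * S.q i
    | some (Sum.inr i) => S.L * a (Sum.inr i)

/-- The mean inflow for the NRT rates `lam`. -/
def target (lam : Fin nN → ℝ) : QueueSpace nR nN := S.inflow (Sum.elim S.rateR lam)

@[simp] theorem outcome_none (m : S.State) (μ P : User nR nN → ℝ) :
    S.outcome m μ P none = -((∑ i, P i * μ i) / S.Ts) := rfl

open Classical in
@[simp] theorem outcome_inl (m : S.State) (μ P : User nR nN → ℝ) (i : Fin nR) :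
    S.outcome m μ P (some (Sum.inl i)) = if μ (Sum.inl i) = 0 then 0 else 1 := rfl

@[simp] theorem outcome_inr (m : S.State) (μ P : User nR nN → ℝ) (i : Fin nN) :
    S.outcome m μ P (some (Sum.inr i)) =
      μ (Sum.inr i) * rate (P (Sum.inr i)) (m (Sum.inr i)) := rfl

@[simp] theorem inflow_none (a : User nR nN → ℝ) : S.inflow a none = -S.Pavg := rfl

@[simp] theorem inflow_inl (a : User nR nN → ℝ) (i : Fin nR) :
    S.inflow a (some (Sum.inl i)) = a (Sum.inl i) * S.q i := rfl

@[simp] theorem inflow_inr (a : User nR nN → ℝ) (i : Fin nN) :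
    S.inflow a (some (Sum.inr i)) = S.L * a (Sum.inr i) := rfl

@[simp] theorem target_none (lam : Fin nN → ℝ) : S.target lam none = -S.Pavg := rfl

@[simp] theorem target_inl (lam : Fin nN → ℝ) (i : Fin nR) :
    S.target lam (some (Sum.inl i)) = S.rateR i * S.q i := rfl

@[simp] theorem target_inr (lam : Fin nN → ℝ) (i : Fin nN) :
    S.target lam (some (Sum.inr i)) = S.L * lam i := rfl

theorem gain_nonneg (m : S.State) (i : User nR nN) : 0 ≤ (m i : ℝ) :=
  S.gains_nonneg _ (m i).2

/-- A bound on the gains. -/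
def gainSum : ℝ := ∑ g ∈ S.gains, g

theorem gain_le (m : S.State) (i : User nR nN) : (m i : ℝ) ≤ S.gainSum :=
  Finset.single_le_sum (f := fun g => g) (fun g hg => S.gains_nonneg g hg) (m i).2

theorem gainSum_nonneg : 0 ≤ S.gainSum := Finset.sum_nonneg fun g hg => S.gains_nonneg g hg

theorem zero_mem_outcomes (m : S.State) : (0 : QueueSpace nR nN) ∈ S.outcomes m := by
  refine ⟨0, 0, ⟨by simp, by simpa using S.Ts_pos.le, by simp, fun _ => S.Pmax_pos.le,
    by simp⟩, ?_⟩
  ext j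
  rcases j with _ | i | i <;> simp

theorem outcomes_nonempty (m : S.State) : (S.outcomes m).Nonempty := ⟨0, S.zero_mem_outcomes m⟩

namespace IsSlotAllocation

variable {S} {m : S.State} {μ P : User nR nN → ℝ} (h : S.IsSlotAllocation m μ P)

include h

theorem time_le (i : User nR nN) : μ i ≤ S.Ts :=
  (Finset.single_le_sum (fun i _ => h.time_nonneg i) (Finset.mem_univ i)).trans h.time_sum

theorem rate_nonneg (i : User nR nN) : 0 ≤ rate (P i) (m i) :=
  Downlink.rate_nonneg (h.power_nonneg i) (S.gain_nonneg m i)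

theorem service_nonneg (i : User nR nN) : 0 ≤ μ i * rate (P i) (m i) :=
  mul_nonneg (h.time_nonneg i) (h.rate_nonneg i)

/-- Since `log (1 + x) ≤ x`, transmitted bits need a proportional amount of energy. Conversely,
giving up bits spares energy, which is how power slack is obtained. -/
theorem service_le (i : User nR nN) : μ i * rate (P i) (m i) ≤ S.gainSum * (μ i * P i) := by
  have h1 := rate_le (h.power_nonneg i) (S.gain_nonneg m i)
  have h2 : P i * (m i : ℝ) ≤ P i * S.gainSum :=
    mul_le_mul_of_nonneg_left (S.gain_le m i) (h.power_nonneg i)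
  have := mul_le_mul_of_nonneg_left (h1.trans h2) (h.time_nonneg i)
  linarith

theorem energy_nonneg (i : User nR nN) : 0 ≤ P i * μ i :=
  mul_nonneg (h.power_nonneg i) (h.time_nonneg i)

theorem energy_le (i : User nR nN) : P i * μ i ≤ S.Pmax * μ i :=
  mul_le_mul_of_nonneg_right (h.power_le i) (h.time_nonneg i)

theorem sum_energy_le : ∑ i, P i * μ i ≤ S.Pmax * S.Ts := by
  refine (Finset.sum_le_sum fun i _ => h.energy_le i).trans ?_
  rw [← Finset.mul_sum]
  exact mul_le_mul_of_nonneg_left h.time_sum S.Pmax_pos.le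

-- Whole packets make the bits of an RT user equivalent to an indicator. The virtual queues count
-- the indicator and the constraints count the bits.
open Classical in
theorem service_eq (i : Fin nR) : μ (Sum.inl i) * rate (P (Sum.inl i)) (m (Sum.inl i)) =
    S.L * if μ (Sum.inl i) = 0 then 0 else 1 := by
  rcases h.whole_packet i with h0 | h1
  · simp [h0]
  · have : μ (Sum.inl i) ≠ 0 := fun h0 => by
      rw [h0, zero_mul] at h1; exact S.L_pos.ne h1
    simp [this, h1]

theorem abs_outcome_le (j : Option (User nR nN)) :
    |S.outcome m μ P j| ≤ 1 + S.Pmax + S.gainSum * (S.Pmax * S.Ts) := by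
  have hg := S.gainSum_nonneg
  have hT := S.Ts_pos
  have hP := S.Pmax_pos
  have hpos : 0 ≤ S.gainSum * (S.Pmax * S.Ts) := by positivity
  rcases j with _ | i | i
  · rw [outcome_none, abs_neg, abs_of_nonneg
      (div_nonneg (Finset.sum_nonneg fun i _ => h.energy_nonneg i) hT.le)]
    have : (∑ i, P i * μ i) / S.Ts ≤ S.Pmax := by
      rw [div_le_iff₀ hT]; exact h.sum_energy_le
    linarith
  · rw [outcome_inl]
    split_ifs
    · simp only [abs_zero]; linarith
    · simp only [abs_one]; linarith
  · rw [outcome_inr, abs_of_nonneg (h.service_nonneg _)]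
    have h1 := h.service_le (Sum.inr i)
    have h2 : μ (Sum.inr i) * P (Sum.inr i) ≤ S.Pmax * S.Ts := by
      have h3 := h.energy_le (Sum.inr i)
      have h4 := mul_le_mul_of_nonneg_left (h.time_le (Sum.inr i)) hP.le
      linarith
    have := mul_le_mul_of_nonneg_left h2 hg
    linarith

end IsSlotAllocation

/-- A bound on the norms of outcomes and inflows. -/
theorem exists_norm_bound : ∃ C : ℝ, (∀ m, ∀ o ∈ S.outcomes m, ‖o‖ ≤ C) ∧
    ∀ a : User nR nN → ℝ, (∀ i, a i ∈ Set.Icc (0 : ℝ) 1) → ‖S.inflow a‖ ≤ C := by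
  refine ⟨max (√(Fintype.card (Option (User nR nN)) *
      (1 + S.Pmax + S.gainSum * (S.Pmax * S.Ts)) ^ 2))
    (√(Fintype.card (Option (User nR nN)) * (1 + S.Pavg + S.L) ^ 2)), ?_, ?_⟩
  · rintro m _ ⟨μ, P, h, rfl⟩
    exact (norm_le_sqrt_of_abs_le h.abs_outcome_le).trans (le_max_left _ _)
  · intro a ha
    refine (norm_le_sqrt_of_abs_le fun j => ?_).trans (le_max_right _ _)
    have hL := S.L_pos
    have hP := S.Pavg_pos
    rcases j with _ | i | i
    · rw [inflow_none, abs_neg, abs_of_pos hP]; linarith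
    · obtain ⟨h1, h2⟩ := ha (Sum.inl i)
      obtain ⟨h3, h4⟩ := S.q_mem i
      rw [inflow_inl, abs_of_nonneg (mul_nonneg h1 h3)]
      nlinarith
    · obtain ⟨h1, h2⟩ := ha (Sum.inr i)
      rw [inflow_inr, abs_of_nonneg (mul_nonneg hL.le h1)]
      nlinarith

/-- The outcome of a state-dependent allocation, averaged over the fading states. -/
def meanOutcome (μ P : S.State → User nR nN → ℝ) : QueueSpace nR nN :=
  ∑ m, S.prob m • S.outcome m (μ m) (P m)

theorem meanOutcome_apply (μ P : S.State → User nR nN → ℝ) (j : Option (User nR nN)) :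
    S.meanOutcome μ P j = ∑ m, S.prob m * S.outcome m (μ m) (P m) j := by
  simp [meanOutcome]

theorem meanOutcome_none (μ P : S.State → User nR nN → ℝ) :
    S.meanOutcome μ P none = -S.meanPower μ P := by
  rw [meanOutcome_apply, meanPower, Finset.sum_div, ← Finset.sum_neg_distrib]
  refine Finset.sum_congr rfl fun m _ => ?_
  rw [outcome_none]
  have : ∑ i, P m i * μ m i = ∑ i, μ m i * P m i := by simp_rw [mul_comm]
  rw [this]
  ring

theorem meanOutcome_inr (μ P : S.State → User nR nN → ℝ) (i : Fin nN) :
    S.meanOutcome μ P (some (Sum.inr i)) = S.L * S.meanService μ P (Sum.inr i) := by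
  rw [meanOutcome_apply, meanService, mul_div_cancel₀ _ S.L_pos.ne']
  exact Finset.sum_congr rfl fun m _ => by rw [outcome_inr]; ring

theorem meanOutcome_inl {μ P : S.State → User nR nN → ℝ}
    (h : ∀ m, S.IsSlotAllocation m (μ m) (P m)) (i : Fin nR) :
    S.meanOutcome μ P (some (Sum.inl i)) = S.meanService μ P (Sum.inl i) := by
  rw [meanOutcome_apply, meanService, Finset.sum_div]
  refine Finset.sum_congr rfl fun m _ => ?_
  rw [outcome_inl, (h m).service_eq i]
  have := S.L_pos.ne'
  field_simp

theorem abs_meanOutcome_le {μ P : S.State → User nR nN → ℝ}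
    (h : ∀ m, S.IsSlotAllocation m (μ m) (P m)) (j : Option (User nR nN)) :
    |S.meanOutcome μ P j| ≤ 1 + S.Pmax + S.gainSum * (S.Pmax * S.Ts) := by
  rw [meanOutcome_apply]
  refine (Finset.abs_sum_le_sum_abs _ _).trans ?_
  calc _ ≤ ∑ m, S.prob m * (1 + S.Pmax + S.gainSum * (S.Pmax * S.Ts)) := by
        refine Finset.sum_le_sum fun m _ => ?_
        rw [abs_mul, abs_of_nonneg (S.prob_nonneg m)]
        exact mul_le_mul_of_nonneg_left ((h m).abs_outcome_le j) (S.prob_nonneg m)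
    _ = _ := by rw [← Finset.sum_mul, S.prob_sum, one_mul]

theorem inner_meanOutcome_le {μ P : S.State → User nR nN → ℝ}
    (h : ∀ m, S.IsSlotAllocation m (μ m) (P m)) (v : QueueSpace nR nN) :
    inner ℝ v (S.meanOutcome μ P) ≤ meanSupport S.prob S.outcomes v := by
  obtain ⟨C, hC, -⟩ := S.exists_norm_bound
  rw [meanOutcome, inner_sum]
  refine Finset.sum_le_sum fun m _ => ?_
  rw [inner_smul_right]
  exact mul_le_mul_of_nonneg_left (inner_le_support (hC m) v ⟨_, _, h m, rfl⟩) (S.prob_nonneg m)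

/-- Points that are asymptotically dominated by time averages satisfy the support inequality. -/
theorem inner_le_meanSupport_of_average {μ P : ℕ → S.State → User nR nN → ℝ}
    (h : ∀ k m, S.IsSlotAllocation m (μ k m) (P k m)) {x : QueueSpace nR nN}
    (hx : ∀ j, ∀ e : ℝ, 0 < e → ∀ᶠ K : ℕ in atTop,
      x j - e ≤ (∑ k ∈ Finset.range K, S.meanOutcome (μ k) (P k) j) / K)
    {v : QueueSpace nR nN} (hv : ∀ j, 0 ≤ v j) :
    inner ℝ v x ≤ meanSupport S.prob S.outcomes v := by
  refine le_of_forall_pos_le_add fun e he => ?_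
  have hs : 0 ≤ ∑ j, v j := Finset.sum_nonneg fun j _ => hv j
  -- The error is shared among the coordinates so that its weight under `v` is at most `e`; the `+
  -- 1` covers `v = 0`.
  set e' := e / (∑ j, v j + 1) with he'
  have he'0 : 0 < e' := by positivity
  obtain ⟨K, hK, hK1⟩ := ((eventually_all.2 fun j => hx j e' he'0).and
    (eventually_ge_atTop 1)).exists
  have hK0 : (0 : ℝ) < K := by exact_mod_cast hK1
  have h1 : ∑ k ∈ Finset.range K, inner ℝ v (S.meanOutcome (μ k) (P k)) ≤
      K * meanSupport S.prob S.outcomes v := by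
    refine (Finset.sum_le_sum fun k _ => S.inner_meanOutcome_le (h k) v).trans (le_of_eq ?_)
    simp
  have h2 : ∑ k ∈ Finset.range K, inner ℝ v (S.meanOutcome (μ k) (P k)) =
      K * ∑ j, v j * ((∑ k ∈ Finset.range K, S.meanOutcome (μ k) (P k) j) / K) := by
    simp only [inner_euclidean]
    rw [Finset.sum_comm, Finset.mul_sum]
    refine Finset.sum_congr rfl fun j _ => ?_
    rw [← Finset.mul_sum]
    field_simp
  rw [h2] at h1
  have h3 := le_of_mul_le_mul_left h1 hK0
  have h4 : ∑ j, v j * (x j - e') ≤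
      ∑ j, v j * ((∑ k ∈ Finset.range K, S.meanOutcome (μ k) (P k) j) / K) :=
    Finset.sum_le_sum fun j _ => mul_le_mul_of_nonneg_left (hK j) (hv j)
  have h5 : ∑ j, v j * (x j - e') = inner ℝ v x - e' * ∑ j, v j := by
    rw [inner_euclidean, Finset.mul_sum, ← Finset.sum_sub_distrib]
    exact Finset.sum_congr rfl fun j _ => by ring
  have h6 : e' * ∑ j, v j ≤ e := by
    rw [he', div_mul_eq_mul_div, div_le_iff₀ (by positivity)]
    nlinarith
  linarith

/-! ### Shortening the NRT transmissions -/

/-- Multiply the durations of the NRT users by `ρ`. -/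
def scaleNRT (ρ : Fin nN → ℝ) (μ : User nR nN → ℝ) : User nR nN → ℝ :=
  Sum.elim (fun i => μ (Sum.inl i)) fun i => ρ i * μ (Sum.inr i)

theorem IsSlotAllocation.scaleNRT {S : System nR nN} {m : S.State} {μ P : User nR nN → ℝ}
    (h : S.IsSlotAllocation m μ P) {ρ : Fin nN → ℝ} (h0 : ∀ i, 0 ≤ ρ i) (h1 : ∀ i, ρ i ≤ 1) :
    S.IsSlotAllocation m (scaleNRT ρ μ) P := by
  have hle : ∀ i, System.scaleNRT ρ μ i ≤ μ i := by
    rintro (i | i)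
    · exact le_rfl
    · exact mul_le_of_le_one_left (h.time_nonneg _) (h1 i)
  refine ⟨?_, (Finset.sum_le_sum fun i _ => hle i).trans h.time_sum, h.power_nonneg, h.power_le,
    h.whole_packet⟩
  rintro (i | i)
  · exact h.time_nonneg _
  · exact mul_nonneg (h0 i) (h.time_nonneg _)

theorem meanService_scaleNRT_inr (ρ : Fin nN → ℝ) (μ P : S.State → User nR nN → ℝ) (i : Fin nN) :
    S.meanService (fun m => scaleNRT ρ (μ m)) P (Sum.inr i) =
      ρ i * S.meanService μ P (Sum.inr i) := by
  rw [meanService, meanService, ← mul_div_assoc, Finset.mul_sum]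
  congr 1
  exact Finset.sum_congr rfl fun m _ => by simp only [scaleNRT, Sum.elim_inr]; ring

theorem meanPower_scaleNRT (ρ : Fin nN → ℝ) (μ P : S.State → User nR nN → ℝ) :
    S.meanPower (fun m => scaleNRT ρ (μ m)) P = S.meanPower μ P -
      (∑ m, (∑ i, (1 - ρ i) * (μ m (Sum.inr i) * P m (Sum.inr i))) * S.prob m) / S.Ts := by
  rw [meanPower, meanPower, ← sub_div, ← Finset.sum_sub_distrib]
  congr 1
  refine Finset.sum_congr rfl fun m _ => ?_
  rw [← sub_mul]
  congr 1
  rw [Fintype.sum_sum_type, Fintype.sum_sum_type, add_sub_assoc, ← Finset.sum_sub_distrib]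
  congr 1
  exact Finset.sum_congr rfl fun i _ => by simp only [scaleNRT, Sum.elim_inr]; ring

end System

/-! ### The Lambert region as an intersection of half-spaces -/

namespace System

variable {nR nN : ℕ} (S : System nR nN)

theorem abs_meanService_le {μ P : S.State → User nR nN → ℝ}
    (h : ∀ m, S.IsSlotAllocation m (μ m) (P m)) (i : Fin nR) :
    |S.meanService μ P (Sum.inl i)| ≤ 1 + S.Pmax + S.gainSum * (S.Pmax * S.Ts) := by
  rw [← S.meanOutcome_inl h i]; exact S.abs_meanOutcome_le h _

theorem abs_meanPower_le {μ P : S.State → User nR nN → ℝ}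
    (h : ∀ m, S.IsSlotAllocation m (μ m) (P m)) :
    |S.meanPower μ P| ≤ 1 + S.Pmax + S.gainSum * (S.Pmax * S.Ts) := by
  rw [← abs_neg, ← S.meanOutcome_none]; exact S.abs_meanOutcome_le h _

theorem meanService_nonneg {μ P : S.State → User nR nN → ℝ}
    (h : ∀ m, S.IsSlotAllocation m (μ m) (P m)) (i : User nR nN) : 0 ≤ S.meanService μ P i :=
  div_nonneg (Finset.sum_nonneg fun m _ => mul_nonneg ((h m).service_nonneg i) (S.prob_nonneg m))
    S.L_pos.le

theorem nonneg_of_mem_lambertRegion {lam : Fin nN → ℝ} (h : lam ∈ S.lambertRegion) (i : Fin nN) :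
    0 ≤ lam i := by
  obtain ⟨μ, P, hall, hN, -, -⟩ := h
  exact ge_of_tendsto' (hN i) fun K =>
    div_nonneg (Finset.sum_nonneg fun k _ => S.meanService_nonneg (hall k) _) (Nat.cast_nonneg K)

theorem inner_target_le_of_mem {lam : Fin nN → ℝ} (h : lam ∈ S.lambertRegion)
    {v : QueueSpace nR nN} (hv : ∀ j, 0 ≤ v j) :
    inner ℝ v (S.target lam) ≤ meanSupport S.prob S.outcomes v := by
  obtain ⟨μ, P, hall, hN, hR, hP⟩ := h
  refine S.inner_le_meanSupport_of_average hall (fun j e he => ?_) hv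
  rcases j with _ | i | i
  · simp only [meanOutcome_none, Finset.sum_neg_distrib, target_none, neg_div]
    filter_upwards [eventually_le_add_of_limsup_le
      (abs_average_le fun k => S.abs_meanPower_le (hall k)) hP he] with K hK
    linarith
  · simp only [S.meanOutcome_inl (hall _), target_inl]
    filter_upwards [eventually_sub_le_of_le_liminf
      (abs_average_le fun k => S.abs_meanService_le (hall k) i) (hR i) he] with K hK
    linarith [mul_comm (S.rateR i) (S.q i)]
  · simp only [meanOutcome_inr, ← Finset.mul_sum, target_inr, mul_div_assoc]
    exact (((hN i).const_mul S.L).eventually (lt_mem_nhds (sub_lt_self _ he))).mono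
      fun K hK => hK.le

/-- A positive NRT rate in the interior leaves some power unused. -/
theorem exists_slack {lam : Fin nN → ℝ} {ε : ℝ} (hε : 0 < ε)
    (h : (1 + ε) • lam ∈ S.lambertRegion) {i₀ : Fin nN} (hi₀ : 0 < lam i₀) :
    ∃ δ : ℝ, 0 < δ ∧ ∀ v : QueueSpace nR nN, (∀ j, 0 ≤ v j) →
      inner ℝ v (S.target lam) + δ * (∑ i, lam i * v (some (Sum.inr i)) + v none) ≤
        meanSupport S.prob S.outcomes v := by
  have hnn := S.nonneg_of_mem_lambertRegion h
  have hlam : ∀ i, 0 ≤ lam i := fun i => by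
    have := hnn i
    simp only [Pi.smul_apply, smul_eq_mul] at this
    exact nonneg_of_mul_nonneg_right this (by linarith)
  obtain ⟨μ, P, hall, hN, hR, hP⟩ := h
  -- Shortening by `r` takes the rates from `1 + ε` to `1 + ε / 2` times `lam`: half of the surplus
  -- stays, the other half is exchanged for power.
  set r : ℝ := (1 + ε / 2) / (1 + ε) with hr
  have hr0 : 0 ≤ r := by positivity
  have hr1 : r < 1 := by rw [hr, div_lt_one (by positivity)]; linarith
  have hgs : 0 < S.gainSum + 1 := by linarith [S.gainSum_nonneg]
  -- Power spared per packet of user `i₀` by shortening its transmissions, from `service_le`; the `+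
  -- 1` guards against vanishing gains.
  set c : ℝ := (1 - r) * S.L / ((S.gainSum + 1) * S.Ts) with hc
  have hc0 : 0 < c := by
    have := S.L_pos
    have := S.Ts_pos
    have : 0 < 1 - r := by linarith
    positivity
  set δ' : ℝ := c * ((1 + ε) * lam i₀) with hδ'
  have hδ'0 : 0 < δ' := by positivity
  set μ' : ℕ → S.State → User nR nN → ℝ := fun k m => scaleNRT (fun _ => r) (μ k m) with hμ'
  have hall' : ∀ k m, S.IsSlotAllocation m (μ' k m) (P k m) := fun k m =>
    (hall k m).scaleNRT (fun _ => hr0) fun _ => hr1.le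
  have hpow : ∀ k, S.meanPower (μ' k) (P k) ≤
      S.meanPower (μ k) (P k) - c * S.meanService (μ k) (P k) (Sum.inr i₀) := by
    intro k
    rw [hμ', S.meanPower_scaleNRT]
    refine sub_le_sub_left ?_ _
    rw [le_div_iff₀ S.Ts_pos, meanService]
    have hTs := S.Ts_pos.ne'
    have hL := S.L_pos.ne'
    have e : c * ((∑ m, μ k m (Sum.inr i₀) * rate (P k m (Sum.inr i₀)) (m (Sum.inr i₀))
        * S.prob m) / S.L) * S.Ts = ∑ m, (1 - r) / (S.gainSum + 1) *
          (μ k m (Sum.inr i₀) * rate (P k m (Sum.inr i₀)) (m (Sum.inr i₀))) * S.prob m := by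
      simp only [mul_assoc]
      rw [← Finset.mul_sum, hc]
      field_simp
    rw [e]
    refine Finset.sum_le_sum fun m _ => mul_le_mul_of_nonneg_right ?_ (S.prob_nonneg m)
    have h1 := (hall k m).service_le (Sum.inr i₀)
    have h2 : 0 ≤ μ k m (Sum.inr i₀) * P k m (Sum.inr i₀) :=
      mul_nonneg ((hall k m).time_nonneg _) ((hall k m).power_nonneg _)
    have h3 : (1 - r) * (μ k m (Sum.inr i₀) * P k m (Sum.inr i₀)) ≤
        ∑ i, (1 - r) * (μ k m (Sum.inr i) * P k m (Sum.inr i)) :=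
      Finset.single_le_sum (f := fun i => (1 - r) * (μ k m (Sum.inr i) * P k m (Sum.inr i)))
        (fun i _ => mul_nonneg (by linarith) (mul_nonneg ((hall k m).time_nonneg _)
          ((hall k m).power_nonneg _))) (Finset.mem_univ i₀)
    refine le_trans ?_ h3
    rw [div_mul_eq_mul_div, div_le_iff₀ hgs]
    have h4 := mul_le_mul_of_nonneg_left h1 (show 0 ≤ 1 - r by linarith)
    nlinarith [mul_nonneg (show 0 ≤ 1 - r by linarith) h2]
  -- The target after shortening, with the power coordinate improved by the spared power `δ'`. The
  -- slack at `lam` is read off from the support inequality at `x`.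
  set x : QueueSpace nR nN := S.target ((1 + ε / 2) • lam) +
    EuclideanSpace.single none δ' with hx
  have key : ∀ v : QueueSpace nR nN, (∀ j, 0 ≤ v j) →
      inner ℝ v x ≤ meanSupport S.prob S.outcomes v := by
    intro v hv
    refine S.inner_le_meanSupport_of_average hall' (fun j e he => ?_) hv
    rcases j with _ | i | i
    · have hx0 : x none = -S.Pavg + δ' := by simp [hx]
      simp only [meanOutcome_none, Finset.sum_neg_distrib, hx0, neg_div]
      have h1 := eventually_le_add_of_limsup_le
        (abs_average_le fun k => S.abs_meanPower_le (hall k)) hP (half_pos he)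
      have h2 := ((hN i₀).const_mul c).eventually (lt_mem_nhds (sub_lt_self _ (half_pos he)))
      filter_upwards [h1, h2] with K hK1 hK2
      have h3 : (∑ k ∈ Finset.range K, S.meanPower (μ' k) (P k)) / K ≤
          (∑ k ∈ Finset.range K, S.meanPower (μ k) (P k)) / K -
          c * ((∑ k ∈ Finset.range K, S.meanService (μ k) (P k) (Sum.inr i₀)) / K) := by
        rw [← mul_div_assoc, ← sub_div, Finset.mul_sum, ← Finset.sum_sub_distrib]
        gcongr with k
        exact hpow k
      simp only [Pi.smul_apply, smul_eq_mul, ← hδ'] at hK2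
      linarith
    · have hx0 : x (some (Sum.inl i)) = S.rateR i * S.q i := by simp [hx]
      simp only [S.meanOutcome_inl (hall' _), hx0]
      filter_upwards [eventually_sub_le_of_le_liminf
        (abs_average_le fun k => S.abs_meanService_le (hall k) i) (hR i) he] with K hK
      have : ∀ k, S.meanService (μ' k) (P k) (Sum.inl i) = S.meanService (μ k) (P k) (Sum.inl i) :=
        fun k => rfl
      simp only [this]
      linarith [mul_comm (S.rateR i) (S.q i)]
    · have hx0 : x (some (Sum.inr i)) = S.L * (r * ((1 + ε) * lam i)) := by
        have : (1 : ℝ) + ε ≠ 0 := by positivity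
        have e2 : r * ((1 + ε) * lam i) = (1 + ε / 2) * lam i := by rw [hr]; field_simp
        rw [e2]
        simp [hx]
      have e1 : ∀ k, S.meanService (μ' k) (P k) (Sum.inr i) =
          r * S.meanService (μ k) (P k) (Sum.inr i) := fun k =>
        S.meanService_scaleNRT_inr _ _ _ i
      simp only [meanOutcome_inr, e1, ← Finset.mul_sum, hx0, mul_div_assoc]
      exact ((((hN i).const_mul r).const_mul S.L).eventually
        (lt_mem_nhds (sub_lt_self _ he))).mono fun K hK => hK.le
  refine ⟨min (ε / 2 * S.L) δ', lt_min (mul_pos (half_pos hε) S.L_pos) hδ'0, fun v hv => ?_⟩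
  refine le_trans ?_ (key v hv)
  have hs : 0 ≤ ∑ i, lam i * v (some (Sum.inr i)) :=
    Finset.sum_nonneg fun i _ => mul_nonneg (hlam i) (hv _)
  have e1 : inner ℝ v x = inner ℝ v (S.target lam) +
      (ε / 2 * S.L) * ∑ i, lam i * v (some (Sum.inr i)) + δ' * v none := by
    rw [hx, inner_add_right]
    simp only [inner_euclidean, Fintype.sum_option, Fintype.sum_sum_type]
    simp [Finset.mul_sum]
    have : ∑ i, v (some (Sum.inr i)) * (S.L * ((1 + ε / 2) * lam i)) =
        ∑ i, v (some (Sum.inr i)) * (S.L * lam i) +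
          ∑ i, ε / 2 * S.L * (lam i * v (some (Sum.inr i))) := by
      rw [← Finset.sum_add_distrib]
      exact Finset.sum_congr rfl fun i _ => by ring
    rw [this]
    ring
  rw [e1, mul_add]
  have h1 := mul_le_mul_of_nonneg_right (min_le_left (ε / 2 * S.L) δ') hs
  have h2 := mul_le_mul_of_nonneg_right (min_le_right (ε / 2 * S.L) δ') (hv none)
  linarith

/-- The support inequality characterizes the Lambert region. -/
theorem mem_lambertRegion_of_support {lam : Fin nN → ℝ} (h0 : ∀ i, 0 ≤ lam i)
    (h : ∀ v : QueueSpace nR nN, (∀ j, 0 ≤ v j) →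
      inner ℝ v (S.target lam) ≤ meanSupport S.prob S.outcomes v) :
    lam ∈ S.lambertRegion := by
  obtain ⟨C, hC, -⟩ := S.exists_norm_bound
  -- Attainment of the supremum is not needed: an error of 1 per slot only adds a constant to the
  -- drift.
  have hch : ∀ (v : QueueSpace nR nN) (m : S.State), ∃ μ P : User nR nN → ℝ,
      S.IsSlotAllocation m μ P ∧ support (S.outcomes m) v - 1 < inner ℝ v (S.outcome m μ P) := by
    intro v m
    obtain ⟨_, ⟨μ, P, hall, rfl⟩, hlt⟩ :=
      exists_support_sub_lt (S.outcomes_nonempty m) v one_pos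
    exact ⟨μ, P, hall, hlt⟩
  choose μ₀ P₀ hall hopt using hch
  set d : QueueSpace nR nN → QueueSpace nR nN := fun v => S.meanOutcome (μ₀ v) (P₀ v) with hd
  have hdopt : ∀ v, meanSupport S.prob S.outcomes v - 1 ≤ inner ℝ v (d v) := by
    intro v
    simp only [hd, meanOutcome, inner_sum, inner_smul_right, meanSupport]
    rw [← S.prob_sum, ← Finset.sum_sub_distrib]
    refine Finset.sum_le_sum fun m _ => ?_
    have := mul_le_mul_of_nonneg_left (hopt v m).le (S.prob_nonneg m)
    linarith
  have hdC : ∀ v, ‖d v‖ ≤ C := by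
    intro v
    simp only [hd, meanOutcome]
    refine (norm_sum_le _ _).trans ?_
    calc _ ≤ ∑ m, S.prob m * C := by
          refine Finset.sum_le_sum fun m _ => ?_
          rw [norm_smul, Real.norm_of_nonneg (S.prob_nonneg m)]
          exact mul_le_mul_of_nonneg_left (hC m _ ⟨_, _, hall v m, rfl⟩) (S.prob_nonneg m)
      _ = C := by rw [← Finset.sum_mul, S.prob_sum, one_mul]
  set b := S.target lam with hb
  -- Deterministic queues whose inflow is the target and whose service is the near-optimal mean
  -- outcome. Bounded drift of the squared norm will give `w k / k → 0`.
  let w : ℕ → QueueSpace nR nN := fun k => Nat.rec 0 (fun _ v => posVec (v + (b - d v))) k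
  have hw0 : w 0 = 0 := rfl
  have hws : ∀ k, w (k + 1) = posVec (w k + (b - d (w k))) := fun _ => rfl
  have hwnn : ∀ k j, 0 ≤ w k j := by
    intro k j
    cases k with
    | zero => simp [hw0]
    | succ k => rw [hws]; exact le_max_right _ _
  have hgrow : ∀ k : ℕ, ‖w k‖ ^ 2 ≤ ((‖b‖ + C) ^ 2 + 2) * k := by
    intro k
    induction k with
    | zero => simp [hw0]
    | succ k ih =>
      have h1 : ‖w (k + 1)‖ ≤ ‖w k + (b - d (w k))‖ := by
        rw [hws]; simpa using norm_posVec_sub_le (w k + (b - d (w k))) (y := 0) (by simp)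
      have h2 : ‖w (k + 1)‖ ^ 2 ≤ ‖w k + (b - d (w k))‖ ^ 2 :=
        pow_le_pow_left₀ (norm_nonneg _) h1 2
      rw [norm_add_sq_real, inner_sub_right] at h2
      have h3 : ‖b - d (w k)‖ ^ 2 ≤ (‖b‖ + C) ^ 2 := by
        refine pow_le_pow_left₀ (norm_nonneg _) ((norm_sub_le _ _).trans ?_) 2
        linarith [hdC (w k)]
      have h4 := h (w k) (hwnn k)
      have h5 := hdopt (w k)
      push_cast
      linarith
  have hlim : ∀ j, Tendsto (fun k : ℕ => w k j / k) atTop (𝓝 0) := fun j =>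
    tendsto_div_of_sq_le (hwnn · j) fun k => by
      refine le_trans ?_ (hgrow k)
      rw [← sq_abs]
      exact pow_le_pow_left₀ (abs_nonneg _) (abs_coord_le_norm _ j) 2
  have hstep : ∀ k j, w (k + 1) j = max (w k j + (b j - d (w k) j)) 0 := fun k j => by
    rw [hws]; simp
  have htel : ∀ K j, ∑ k ∈ Finset.range K, (b j + w k j - w (k + 1) j) = K * b j - w K j := by
    intro K j
    induction K with
    | zero => simp [hw0]
    | succ K ih => rw [Finset.sum_range_succ, ih]; push_cast; ring
  have havg : ∀ j, Tendsto (fun K : ℕ => (∑ k ∈ Finset.range K, (b j + w k j - w (k + 1) j)) / K)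
      atTop (𝓝 (b j)) := by
    intro j
    have : Tendsto (fun K : ℕ => b j - w K j / K) atTop (𝓝 (b j - 0)) :=
      tendsto_const_nhds.sub (hlim j)
    rw [sub_zero] at this
    refine this.congr' ?_
    filter_upwards [eventually_ge_atTop 1] with K hK
    have : (K : ℝ) ≠ 0 := by positivity
    rw [htel]
    field_simp
  have hlow : ∀ k j, b j + w k j - w (k + 1) j ≤ d (w k) j := fun k j => by
    have := le_max_left (w k j + (b j - d (w k) j)) 0
    rw [hstep]; linarith
  have hdN : ∀ v i, 0 ≤ d v (some (Sum.inr i)) := fun v i => by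
    simp only [hd, meanOutcome_inr]
    exact mul_nonneg S.L_pos.le (S.meanService_nonneg (hall v) _)
  -- NRT averages must converge exactly to `lam`, not merely dominate it, so transmissions are
  -- shortened to the used fraction of the service. If the offered service is zero, so is the used
  -- one, and the default quotient 0 is harmless.
  set ρ : ℕ → Fin nN → ℝ := fun k i =>
    (b (some (Sum.inr i)) + w k (some (Sum.inr i)) - w (k + 1) (some (Sum.inr i))) /
      d (w k) (some (Sum.inr i)) with hρ
  have hbN : ∀ i, 0 ≤ b (some (Sum.inr i)) := fun i => mul_nonneg S.L_pos.le (h0 i)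
  have hserved : ∀ k i,
      0 ≤ b (some (Sum.inr i)) + w k (some (Sum.inr i)) - w (k + 1) (some (Sum.inr i)) := by
    intro k i
    rw [hstep, sub_nonneg]
    refine max_le ?_ ?_
    · linarith [hdN (w k) i]
    · linarith [hbN i, hwnn k (some (Sum.inr i))]
  have hρ0 : ∀ k i, 0 ≤ ρ k i := fun k i => div_nonneg (hserved k i) (hdN _ i)
  have hρ1 : ∀ k i, ρ k i ≤ 1 := fun k i => div_le_one_of_le₀ (hlow _ _) (hdN _ i)
  have hρd : ∀ k i, ρ k i * d (w k) (some (Sum.inr i)) =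
      b (some (Sum.inr i)) + w k (some (Sum.inr i)) - w (k + 1) (some (Sum.inr i)) := by
    intro k i
    by_cases hz : d (w k) (some (Sum.inr i)) = 0
    · have h1 := hlow k (some (Sum.inr i))
      have h2 := hserved k i
      rw [hz] at h1 ⊢
      linarith
    · rw [hρ]; field_simp
  have hall' : ∀ k m, S.IsSlotAllocation m (scaleNRT (ρ k) (μ₀ (w k) m)) (P₀ (w k) m) :=
    fun k m => (hall (w k) m).scaleNRT (hρ0 k) (hρ1 k)
  refine ⟨fun k m => scaleNRT (ρ k) (μ₀ (w k) m), fun k m => P₀ (w k) m, hall', ?_, ?_, ?_⟩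
  · intro i
    have h1 : ∀ k, S.meanService (fun m => scaleNRT (ρ k) (μ₀ (w k) m)) (fun m => P₀ (w k) m)
        (Sum.inr i) = (b (some (Sum.inr i)) + w k (some (Sum.inr i)) -
          w (k + 1) (some (Sum.inr i))) / S.L := by
      intro k
      rw [S.meanService_scaleNRT_inr, ← hρd, eq_div_iff S.L_pos.ne']
      simp only [hd, meanOutcome_inr]
      ring
    simp only [h1]
    have h2 := (havg (some (Sum.inr i))).div_const S.L
    have h3 : b (some (Sum.inr i)) / S.L = lam i := by
      rw [hb, target_inr, mul_div_cancel_left₀ _ S.L_pos.ne']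
    rw [h3] at h2
    refine h2.congr fun K => ?_
    rw [← Finset.sum_div, div_right_comm]
  · intro i
    refine le_liminf_of_tendsto (abs_average_le fun k => S.abs_meanService_le (hall' k) i)
      (g := fun K => (∑ k ∈ Finset.range K, (b (some (Sum.inl i)) + w k (some (Sum.inl i)) -
          w (k + 1) (some (Sum.inl i)))) / K) ?_ (Eventually.of_forall fun K => ?_)
    · have := havg (some (Sum.inl i))
      rwa [show b (some (Sum.inl i)) = S.q i * S.rateR i from mul_comm _ _] at this ⊢
    · gcongr with k
      refine (hlow k _).trans (le_of_eq ?_)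
      simp only [hd]
      rw [S.meanOutcome_inl (hall (w k))]
      rfl
  · refine limsup_le_of_tendsto (abs_average_le fun k => S.abs_meanPower_le (hall' k))
      (g := fun K => -((∑ k ∈ Finset.range K, (b none + w k none - w (k + 1) none)) / K)) ?_
      (Eventually.of_forall fun K => ?_)
    · have := (havg none).neg
      rwa [show -b none = S.Pavg by simp [hb]] at this
    · rw [← neg_div, ← Finset.sum_neg_distrib]
      gcongr with k
      have h1 := hlow k none
      simp only [hd, meanOutcome_none] at h1
      -- Shortening can only lower the power, so the bound for the unshortened allocation suffices.
      have h2 : S.meanPower (fun m => scaleNRT (ρ k) (μ₀ (w k) m)) (fun m => P₀ (w k) m) ≤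
          S.meanPower (μ₀ (w k)) (P₀ (w k)) := by
        rw [S.meanPower_scaleNRT]
        refine sub_le_self _ (div_nonneg (Finset.sum_nonneg fun m _ => mul_nonneg
          (Finset.sum_nonneg fun i _ => mul_nonneg (sub_nonneg.2 (hρ1 k i)) (mul_nonneg
            ((hall _ m).time_nonneg _) ((hall _ m).power_nonneg _))) (S.prob_nonneg m)) S.Ts_pos.le)
      linarith

theorem mem_lambertRegion_iff {lam : Fin nN → ℝ} : lam ∈ S.lambertRegion ↔
    (∀ i, 0 ≤ lam i) ∧ ∀ v : QueueSpace nR nN, (∀ j, 0 ≤ v j) →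
      inner ℝ v (S.target lam) ≤ meanSupport S.prob S.outcomes v :=
  ⟨fun h => ⟨S.nonneg_of_mem_lambertRegion h, fun _ hv => S.inner_target_le_of_mem h hv⟩,
    fun h => S.mem_lambertRegion_of_support h.1 h.2⟩

theorem continuous_target : Continuous (S.target : (Fin nN → ℝ) → QueueSpace nR nN) := by
  have h : Continuous fun (lam : Fin nN → ℝ) (j : Option (User nR nN)) => S.target lam j := by
    refine continuous_pi fun j => ?_
    rcases j with _ | i | i
    · simp only [target_none]
      fun_prop
    · simp only [target_inl]
      fun_prop
    · simp only [target_inr]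
      fun_prop
  exact (PiLp.continuous_toLp 2 fun _ : Option (User nR nN) => ℝ).comp h

theorem isClosed_lambertRegion : IsClosed S.lambertRegion := by
  have : S.lambertRegion = (⋂ i, {lam | 0 ≤ lam i}) ∩ ⋂ v : {v : QueueSpace nR nN // ∀ j, 0 ≤ v j},
      {lam | inner ℝ (v : QueueSpace nR nN) (S.target lam) ≤
        meanSupport S.prob S.outcomes (v : QueueSpace nR nN)} := by
    ext lam
    rw [mem_lambertRegion_iff]
    simp
  rw [this]
  have hc := S.continuous_target
  exact (isClosed_iInter fun i => isClosed_le continuous_const (continuous_apply i)).inter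
    (isClosed_iInter fun v => isClosed_le (by fun_prop) continuous_const)

end System

namespace System

/-! ### The Lambert ratio -/

/-- At `w = -1` the map `w ↦ w eʷ` equals `-1/e ≤ z/e`, and at `y = max (z/e) 0` it is at least `y ≥
z/e`. By the intermediate value theorem the value is attained, so the inverse chosen by `invFunOn`
is a genuine one. -/
theorem lambertW0_spec {z : ℝ} (hz : -1 ≤ z) : -1 ≤ lambertW0 (z / Real.exp 1) ∧
    lambertW0 (z / Real.exp 1) * Real.exp (lambertW0 (z / Real.exp 1)) = z / Real.exp 1 := by
  have hex : ∃ w ∈ Set.Ici (-1 : ℝ), (fun w : ℝ => w * Real.exp w) w = z / Real.exp 1 := by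
    set y := max (z / Real.exp 1) 0 with hy
    have hy0 : 0 ≤ y := le_max_right _ _
    have h1 : (fun w : ℝ => w * Real.exp w) (-1) ≤ z / Real.exp 1 := by
      simp only [Real.exp_neg]
      rw [div_eq_mul_inv]
      exact mul_le_mul_of_nonneg_right hz (by positivity)
    have h2 : z / Real.exp 1 ≤ (fun w : ℝ => w * Real.exp w) y := by
      refine (le_max_left _ 0).trans ?_
      exact le_mul_of_one_le_right hy0 (Real.one_le_exp hy0)
    have hcont : ContinuousOn (fun w : ℝ => w * Real.exp w) (Set.Ici (-1)) := by fun_prop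
    exact isPreconnected_Ici.intermediate_value (a := -1) (b := y) (by simp)
      (by simp only [Set.mem_Ici]; linarith) hcont ⟨h1, h2⟩
  exact ⟨Function.invFunOn_mem hex, Function.invFunOn_eq hex⟩

/-- The Lambert ratio is the inverse of `u ↦ u log u - u` on `[1, ∞)`. -/
theorem lambertRatio_spec {z : ℝ} (hz : -1 ≤ z) :
    1 ≤ lambertRatio z ∧ lambertRatio z * Real.log (lambertRatio z) - lambertRatio z = z := by
  by_cases h0 : z = 0
  · simp [lambertRatio, h0]
  · obtain ⟨h1, h2⟩ := lambertW0_spec hz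
    set w := lambertW0 (z / Real.exp 1) with hw
    have he := (Real.exp_pos 1).ne'
    -- With `u = exp (1 + w)` this reads `z = u log u - u`, and `z / w = u`.
    have hzw : z = w * Real.exp (1 + w) := by
      rw [Real.exp_add]
      field_simp at h2
      linarith
    have hw0 : w ≠ 0 := fun h => h0 (by rw [hzw, h, zero_mul])
    have hr : lambertRatio z = Real.exp (1 + w) := by
      rw [lambertRatio, if_neg h0, ← hw, div_eq_iff hw0, mul_comm]
      exact hzw
    rw [hr, Real.log_exp]
    refine ⟨Real.one_le_exp (by linarith), ?_⟩
    rw [hzw]; ring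

theorem mul_log_sub_ge {u v : ℝ} (hu : 0 < u) (hv : 0 < v) : v - u ≤ v * (Real.log v - Real.log u) := by
  have h := Real.log_le_sub_one_of_pos (div_pos hu hv)
  rw [Real.log_div hu.ne' hv.ne'] at h
  have h2 := mul_le_mul_of_nonneg_left h hv.le
  rw [mul_sub, mul_sub, mul_div_cancel₀ _ hv.ne'] at h2
  linarith

theorem mul_log_sub_self_strictMonoOn :
    StrictMonoOn (fun u : ℝ => u * Real.log u - u) (Set.Ici 1) := by
  intro u hu v hv huv
  have hu0 : 0 < u := lt_of_lt_of_le one_pos hu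
  have hv0 : 0 < v := lt_of_lt_of_le one_pos hv
  have h := Real.log_lt_sub_one_of_pos (div_pos hu0 hv0) (by
    rw [Ne, div_eq_one_iff_eq hv0.ne']; exact huv.ne)
  rw [Real.log_div hu0.ne' hv0.ne'] at h
  have h2 := mul_lt_mul_of_pos_left h hv0
  rw [mul_sub, mul_sub, mul_div_cancel₀ _ hv0.ne'] at h2
  have h3 := mul_nonneg (Real.log_nonneg hu) (sub_nonneg.2 huv.le)
  simp only
  nlinarith

theorem lambertRatio_mul_log_sub {u : ℝ} (hu : 1 ≤ u) : lambertRatio (u * Real.log u - u) = u := by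
  have hz : -1 ≤ u * Real.log u - u := by
    have := mul_log_sub_self_strictMonoOn.monotoneOn (Set.mem_Ici.2 le_rfl) hu hu
    simpa using this
  obtain ⟨h1, h2⟩ := lambertRatio_spec hz
  exact mul_log_sub_self_strictMonoOn.injOn h1 hu h2

theorem le_lambertRatio {u z : ℝ} (hz : -1 ≤ z) (hu : 1 ≤ u) (h : u * Real.log u - u ≤ z) :
    u ≤ lambertRatio z := by
  obtain ⟨h1, h2⟩ := lambertRatio_spec hz
  by_contra hlt
  push Not at hlt
  have h3 := mul_log_sub_self_strictMonoOn h1 hu hlt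
  simp only at h3
  linarith

/-- A monotone map onto `[1, ∞)` is continuous. Truncation at `-1` makes the statement one about all
of `ℝ`. -/
theorem continuous_lambertRatio_max : Continuous fun z : ℝ => lambertRatio (max z (-1)) := by
  let r : ℝ → Set.Ici (1 : ℝ) := fun z =>
    ⟨lambertRatio (max z (-1)), (lambertRatio_spec (le_max_right _ _)).1⟩
  have hmono : Monotone r := fun x y hxy => by
    refine le_lambertRatio (le_max_right _ _) (lambertRatio_spec (le_max_right _ _)).1 ?_
    rw [(lambertRatio_spec (le_max_right _ _)).2]
    exact max_le_max hxy le_rfl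
  have hsurj : Function.Surjective r := by
    rintro ⟨u, hu⟩
    refine ⟨u * Real.log u - u, Subtype.ext ?_⟩
    have hz : -1 ≤ u * Real.log u - u := by
      have := mul_log_sub_self_strictMonoOn.monotoneOn (Set.mem_Ici.2 le_rfl) hu hu
      simpa using this
    simp only [r, max_eq_left hz]
    exact lambertRatio_mul_log_sub hu
  exact continuous_subtype_val.comp (hmono.continuous_of_surjective hsurj)

/-- `(u + z) / log u` is minimal at the Lambert ratio, and decreasing before it. -/
theorem add_mul_log_le {z u v : ℝ} (hz : -1 ≤ z) (hu : 0 < u) (hv : 1 ≤ v)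
    (h : v = lambertRatio z ∨ v ≤ lambertRatio z ∧ u ≤ v) :
    (v + z) * Real.log u ≤ (u + z) * Real.log v := by
  have hv0 : 0 < v := lt_of_lt_of_le one_pos hv
  have hlog := Real.log_nonneg hv
  have h1 := mul_log_sub_ge hu hv0
  obtain ⟨h2, h3⟩ := lambertRatio_spec hz
  rcases h with h | ⟨h4, h5⟩
  -- At the Lambert ratio `v log v = v + z`, which turns the difference of the two sides into `log
  -- v` times a quantity that is nonnegative by concavity of the logarithm.
  · rw [← h] at h3
    have e : (u + z) * Real.log v - (v + z) * Real.log u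
        = Real.log v * (u - v + v * (Real.log v - Real.log u)) := by
      rw [← h3]; ring
    have := mul_nonneg hlog (show 0 ≤ u - v + v * (Real.log v - Real.log u) by linarith)
    linarith
  -- Below the ratio the stationarity equation becomes an inequality; its error has the right sign
  -- when `u ≤ v`.
  · have h6 : v * Real.log v - v ≤ z := by
      rw [← h3]
      exact mul_log_sub_self_strictMonoOn.monotoneOn hv h2 h4
    have h7 : 0 ≤ Real.log v - Real.log u := sub_nonneg.2 (Real.log_le_log hu h5)
    have h8 := mul_nonneg (sub_nonneg.2 h6) h7
    have h9 := mul_nonneg hlog (show 0 ≤ u - v + v * (Real.log v - Real.log u) by linarith)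
    nlinarith

variable {nR nN : ℕ} (S : System nR nN)

theorem rate_pos {p g : ℝ} (hp : 0 < p) (hg : 0 < g) : 0 < rate p g :=
  Real.log_pos (by nlinarith [mul_pos hp hg])

theorem rate_le_rate {p p' g : ℝ} (hp : 0 ≤ p) (hg : 0 ≤ g) (h : p ≤ p') : rate p g ≤ rate p' g := by
  refine Real.log_le_log (by nlinarith [mul_nonneg hp hg]) ?_
  nlinarith [mul_le_mul_of_nonneg_right h hg]

theorem lambertArg_ge {X c g : ℝ} (hX : 0 ≤ X) (hc : 0 ≤ c) (hg : 0 ≤ g) :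
    -1 ≤ c * S.Ts / X * g - 1 := by
  have := S.Ts_pos
  have : 0 ≤ c * S.Ts / X * g := by positivity
  linarith

theorem lambertPower_nonneg {X ψ φ g : ℝ} (hX : 0 ≤ X) (hc : 0 ≤ ψ + φ) (hg : 0 ≤ g) :
    0 ≤ S.lambertPower X ψ φ g := by
  unfold lambertPower
  split_ifs
  · exact S.Pmax_pos.le
  · refine le_min (mul_nonneg (by positivity) ?_) S.Pmax_pos.le
    linarith [(lambertRatio_spec (S.lambertArg_ge hX hc hg)).1]

theorem lambertPower_le (X ψ φ g : ℝ) : S.lambertPower X ψ φ g ≤ S.Pmax := by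
  unfold lambertPower
  split_ifs
  · exact le_rfl
  · exact min_le_right _ _

/-- The Lambert power minimizes the cost per bit. -/
theorem lambertPower_optimal {X ψ φ g p : ℝ} (hX : 0 ≤ X) (hc : 0 ≤ ψ + φ) (hg : 0 < g)
    (hp : 0 ≤ p) (hpm : p ≤ S.Pmax) :
    (X * S.lambertPower X ψ φ g / S.Ts + (ψ + φ)) * rate p g ≤
      (X * p / S.Ts + (ψ + φ)) * rate (S.lambertPower X ψ φ g) g := by
  set c := ψ + φ with hcdef
  have hT := S.Ts_pos
  by_cases hX0 : X = 0
  · simp only [lambertPower, hX0, if_true, zero_mul, zero_div, zero_add]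
    exact mul_le_mul_of_nonneg_left (rate_le_rate hp hg.le hpm) hc
  · have hXpos : 0 < X := lt_of_le_of_ne hX (Ne.symm hX0)
    have hz := S.lambertArg_ge hX hc hg.le
    set z := c * S.Ts / X * g - 1 with hzdef
    have hpow : S.lambertPower X ψ φ g = min (1 / g * (lambertRatio z - 1)) S.Pmax := by
      rw [lambertPower, if_neg hX0]
    set p' := S.lambertPower X ψ φ g with hp'
    have hp'0 : 0 ≤ p' := S.lambertPower_nonneg hX hc hg.le
    have hgp' : 0 ≤ p' * g := mul_nonneg hp'0 hg.le
    have hgp : 0 ≤ p * g := mul_nonneg hp hg.le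
    -- Either the power is the unconstrained optimum, or it is clipped at `Pmax`, and then every
    -- competitor lies below it.
    have hcase : 1 + p' * g = lambertRatio z ∨
        1 + p' * g ≤ lambertRatio z ∧ 1 + p * g ≤ 1 + p' * g := by
      rcases le_total (1 / g * (lambertRatio z - 1)) S.Pmax with h | h
      · left
        rw [hpow, min_eq_left h]
        field_simp
        ring
      · right
        rw [hpow, min_eq_right h]
        constructor
        · have := mul_le_mul_of_nonneg_right h hg.le
          have e : 1 / g * (lambertRatio z - 1) * g = lambertRatio z - 1 := by field_simp
          rw [e] at this
          linarith
        · linarith [mul_le_mul_of_nonneg_right hpm hg.le]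
    have key := add_mul_log_le hz (u := 1 + p * g) (v := 1 + p' * g) (by linarith) (by linarith)
      hcase
    -- In the variable `u = 1 + x * g` the cost per second is a multiple of `u + z`, so the cost per
    -- bit is a multiple of `(u + z) / log u`.
    have e : ∀ x : ℝ, X * x / S.Ts + c = X / (S.Ts * g) * (1 + x * g + z) := by
      intro x
      rw [hzdef]
      field_simp
      ring
    rw [e, e, mul_assoc, mul_assoc]
    exact mul_le_mul_of_nonneg_left key (by positivity)

theorem waterFilling_nonneg (X Q g : ℝ) : 0 ≤ S.waterFilling X Q g := by
  have := S.Pmax_pos.le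
  unfold waterFilling
  split_ifs
  · exact le_rfl
  · exact le_rfl
  · exact this
  · exact le_min (le_max_right _ _) this

theorem waterFilling_le (X Q g : ℝ) : S.waterFilling X Q g ≤ S.Pmax := by
  have := S.Pmax_pos.le
  unfold waterFilling
  split_ifs
  · exact this
  · exact this
  · exact le_rfl
  · exact min_le_right _ _

/-- The water-filling power maximizes the weight per second. -/
theorem le_psiN {X Q g p : ℝ} (hX : 0 ≤ X) (hQ : 0 ≤ Q) (hg : 0 ≤ g) (hp : 0 ≤ p)
    (hpm : p ≤ S.Pmax) : Q * rate p g - X * p / S.Ts ≤ S.psiN X Q g := by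
  have hT := S.Ts_pos
  unfold psiN
  by_cases hg0 : g = 0
  · simp only [waterFilling, hg0, if_true, rate, mul_zero, add_zero, Real.log_one, zero_div,
      sub_zero]
    have : 0 ≤ X * p / S.Ts := by positivity
    linarith
  by_cases hX0 : X = 0
  · by_cases hQ0 : Q = 0
    · simp [hX0, hQ0]
    · simp only [waterFilling, hg0, hX0, hQ0, if_true, if_false, zero_mul, zero_div, sub_zero]
      exact mul_le_mul_of_nonneg_left (rate_le_rate hp hg hpm) hQ
  have hgpos : 0 < g := lt_of_le_of_ne hg (Ne.symm hg0)
  have hXpos : 0 < X := lt_of_le_of_ne hX (Ne.symm hX0)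
  have hw0 := S.waterFilling_nonneg X Q g
  have hw : S.waterFilling X Q g = min (max (S.Ts * Q / X - 1 / g) 0) S.Pmax := by
    simp [waterFilling, hg0, hX0]
  set p' := S.waterFilling X Q g with hp'
  have hu : 0 < 1 + p * g := by positivity
  have hv : 0 < 1 + p' * g := by positivity
  -- The tangent of the concave rate at `p'`. It remains to check the sign of the derivative at the
  -- clipped optimum, in the three cases of clipping.
  have h1 : rate p g - rate p' g ≤ (p - p') * g / (1 + p' * g) := by
    have := Real.log_le_sub_one_of_pos (div_pos hu hv)
    rw [Real.log_div hu.ne' hv.ne'] at this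
    refine this.trans (le_of_eq ?_)
    field_simp
    ring
  have h2 := mul_le_mul_of_nonneg_left h1 hQ
  have h3 : (p - p') * (Q * g / (1 + p' * g) - X / S.Ts) ≤ 0 := by
    have hsign : Q * g / (1 + p' * g) - X / S.Ts
        = X * g / ((1 + p' * g) * S.Ts) * (S.Ts * Q / X - 1 / g - p') := by
      field_simp
      ring
    rw [hsign]
    have hpos : 0 < X * g / ((1 + p' * g) * S.Ts) := by positivity
    have h4 : (p - p') * (S.Ts * Q / X - 1 / g - p') ≤ 0 := by
      rcases le_total (S.Ts * Q / X - 1 / g) 0 with ha | ha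
      · rw [max_eq_right ha, min_eq_left S.Pmax_pos.le] at hw
        rw [hw]
        exact mul_nonpos_of_nonneg_of_nonpos (by linarith) (by linarith)
      · rw [max_eq_left ha] at hw
        rcases le_total (S.Ts * Q / X - 1 / g) S.Pmax with hb | hb
        · rw [min_eq_left hb] at hw
          rw [hw]; simp
        · rw [min_eq_right hb] at hw
          rw [hw]
          exact mul_nonpos_of_nonpos_of_nonneg (by linarith) (by linarith)
    have := mul_nonpos_of_nonneg_of_nonpos hpos.le h4
    linarith
  have e : Q * ((p - p') * g / (1 + p' * g)) - (X * p / S.Ts - X * p' / S.Ts)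
      = (p - p') * (Q * g / (1 + p' * g) - X / S.Ts) := by ring
  linarith

theorem psiN_nonneg {X Q g : ℝ} (hX : 0 ≤ X) (hQ : 0 ≤ Q) (hg : 0 ≤ g) : 0 ≤ S.psiN X Q g := by
  have := S.le_psiN hX hQ hg le_rfl S.Pmax_pos.le
  simpa [rate] using this

end System

namespace System

variable {nR nN : ℕ} (S : System nR nN)

/-! ### Plans: the candidates before the exclusion of sets -/

/-- The loop of the algorithm assigns powers `p`, durations `t` to the set `A`. -/
structure IsPlan (X ψ : ℝ) (g : Fin nR → ℝ) (A : Finset (Fin nR)) (p t : Fin nR → ℝ)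
    (tN : ℝ) : Prop where
  power : ∃ φ : ℝ, 0 ≤ φ ∧ φ * tN = 0 ∧ ∀ i ∈ A, p i = S.lambertPower X ψ φ (g i)
  packet : ∀ i ∈ A, t i * rate (p i) (g i) = S.L
  unscheduled : ∀ i, i ∉ A → p i = 0 ∧ t i = 0
  remaining : tN = S.Ts - ∑ i, t i
  remaining_nonneg : 0 ≤ tN

/-- The weight of scheduling `A` with powers `p` and durations `t`. -/
def planValue (X ψ : ℝ) (Y : Fin nR → ℝ) (A : Finset (Fin nR)) (p t : Fin nR → ℝ) : ℝ :=
  ∑ i ∈ A, (Y i - X * p i * t i / S.Ts) + ψ * (S.Ts - ∑ i ∈ A, t i)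

/-- The set `A` can be scheduled. -/
def IsFeasible (g : Fin nR → ℝ) (A : Finset (Fin nR)) : Prop :=
  (∀ i ∈ A, 0 < g i) ∧ ∑ i ∈ A, S.L / rate S.Pmax (g i) ≤ S.Ts

variable {S} {X ψ : ℝ} {Y g : Fin nR → ℝ} {A : Finset (Fin nR)} {p t : Fin nR → ℝ} {tN : ℝ}

theorem IsCandidate.isPlan (h : S.IsCandidate X ψ Y g A p t tN) : S.IsPlan X ψ g A p t tN :=
  ⟨h.power, h.packet, h.unscheduled, h.remaining, h.remaining_nonneg⟩

theorem gain_pos_of_packet {p g t : ℝ} (hg : 0 ≤ g) (h : t * rate p g = S.L) : 0 < g := by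
  refine lt_of_le_of_ne hg fun h0 => S.L_pos.ne ?_
  rw [← h, ← h0]
  simp [rate]

theorem time_nonneg_of_packet {p g t : ℝ} (hp : 0 ≤ p) (hg : 0 ≤ g) (h : t * rate p g = S.L) :
    0 ≤ t := by
  by_contra hlt
  push Not at hlt
  have := mul_nonpos_of_nonpos_of_nonneg hlt.le (Downlink.rate_nonneg hp hg)
  linarith [S.L_pos]

namespace IsPlan

variable (h : S.IsPlan X ψ g A p t tN)

include h

theorem sum_time : ∑ i, t i = ∑ i ∈ A, t i :=
  (Finset.sum_subset (Finset.subset_univ A) fun i _ hi => (h.unscheduled i hi).2).symm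

theorem candidateValue_eq : S.candidateValue X ψ Y A p t tN = S.planValue X ψ Y A p t := by
  rw [candidateValue, planValue, h.remaining, h.sum_time]

theorem power_nonneg (hX : 0 ≤ X) (hψ : 0 ≤ ψ) (hg : ∀ i, 0 ≤ g i) (i : Fin nR) : 0 ≤ p i := by
  obtain ⟨φ, hφ, -, hp⟩ := h.power
  by_cases hi : i ∈ A
  · rw [hp i hi]; exact S.lambertPower_nonneg hX (by linarith) (hg i)
  · rw [(h.unscheduled i hi).1]

theorem power_le (i : Fin nR) : p i ≤ S.Pmax := by
  obtain ⟨φ, hφ, -, hp⟩ := h.power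
  by_cases hi : i ∈ A
  · rw [hp i hi]; exact S.lambertPower_le _ _ _ _
  · rw [(h.unscheduled i hi).1]; exact S.Pmax_pos.le

theorem sum_time_le : ∑ i ∈ A, t i ≤ S.Ts := by
  have h1 := h.remaining
  have h2 := h.remaining_nonneg
  rw [h.sum_time] at h1
  linarith

/-- A plan is optimal among all ways to schedule its set. -/
theorem planValue_le (hX : 0 ≤ X) (hψ : 0 ≤ ψ) (hg : ∀ i, 0 ≤ g i) {p' t' : Fin nR → ℝ}
    (hp0 : ∀ i ∈ A, 0 ≤ p' i) (hpm : ∀ i ∈ A, p' i ≤ S.Pmax)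
    (hpk : ∀ i ∈ A, t' i * rate (p' i) (g i) = S.L) (hsum : ∑ i ∈ A, t' i ≤ S.Ts) :
    S.planValue X ψ Y A p' t' ≤ S.planValue X ψ Y A p t := by
  have hpn := h.power_nonneg hX hψ hg
  obtain ⟨φ, hφ, hcomp, hp⟩ := h.power
  have hT := S.Ts_pos
  -- Both schedules deliver exactly `L` bits, so multiplying the comparison of costs per bit by `t i
  -- * t' i` gives costs per packet.
  have hterm : ∀ i ∈ A, (X * p i / S.Ts + (ψ + φ)) * t i ≤
      (X * p' i / S.Ts + (ψ + φ)) * t' i := by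
    intro i hi
    have hgi : 0 < g i := gain_pos_of_packet (hg i) (h.packet i hi)
    have h1 := S.lambertPower_optimal hX (add_nonneg hψ hφ) hgi (hp0 i hi) (hpm i hi)
    rw [← hp i hi] at h1
    have h2 : 0 ≤ t i := time_nonneg_of_packet (hpn i) (hg i) (h.packet i hi)
    have h3 : 0 ≤ t' i := time_nonneg_of_packet (hp0 i hi) (hg i) (hpk i hi)
    have h4 := mul_le_mul_of_nonneg_left h1 (mul_nonneg h2 h3)
    have e1 : t i * t' i * ((X * p i / S.Ts + (ψ + φ)) * rate (p' i) (g i)) =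
        (X * p i / S.Ts + (ψ + φ)) * t i * S.L := by rw [← hpk i hi]; ring
    have e2 : t i * t' i * ((X * p' i / S.Ts + (ψ + φ)) * rate (p i) (g i)) =
        (X * p' i / S.Ts + (ψ + φ)) * t' i * S.L := by rw [← h.packet i hi]; ring
    rw [e1, e2] at h4
    exact le_of_mul_le_mul_right h4 S.L_pos
  have hs := Finset.sum_le_sum hterm
  -- Lagrangian form of the value, separable over users. The term `φ * ∑ s` favours the plan because
  -- complementary slackness gives it the largest possible value `φ * S.Ts`.
  have e : ∀ q s : Fin nR → ℝ, S.planValue X ψ Y A q s = ∑ i ∈ A, Y i + ψ * S.Ts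
      + φ * ∑ i ∈ A, s i - ∑ i ∈ A, (X * q i / S.Ts + (ψ + φ)) * s i := by
    intro q s
    have e1 : ∑ i ∈ A, (X * q i / S.Ts + (ψ + φ)) * s i =
        ∑ i ∈ A, X * q i * s i / S.Ts + (ψ + φ) * ∑ i ∈ A, s i := by
      rw [Finset.mul_sum, ← Finset.sum_add_distrib]
      exact Finset.sum_congr rfl fun i _ => by ring
    rw [planValue, e1, Finset.sum_sub_distrib]
    ring
  rw [e p' t', e p t]
  have h5 : φ * ∑ i ∈ A, t i = φ * S.Ts := by
    rw [h.remaining, h.sum_time] at hcomp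
    linarith
  have h6 := mul_le_mul_of_nonneg_left hsum hφ
  linarith

end IsPlan

/-- Any schedule for `A` shows that `A` is feasible. -/
theorem isFeasible_of_schedule (hg : ∀ i, 0 ≤ g i) {p' t' : Fin nR → ℝ}
    (hp0 : ∀ i ∈ A, 0 ≤ p' i) (hpm : ∀ i ∈ A, p' i ≤ S.Pmax)
    (hpk : ∀ i ∈ A, t' i * rate (p' i) (g i) = S.L) (hsum : ∑ i ∈ A, t' i ≤ S.Ts) :
    S.IsFeasible g A := by
  have hpos : ∀ i ∈ A, 0 < g i := fun i hi => gain_pos_of_packet (hg i) (hpk i hi)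
  refine ⟨hpos, (Finset.sum_le_sum fun i hi => ?_).trans hsum⟩
  rw [div_le_iff₀ (rate_pos S.Pmax_pos (hpos i hi)), ← hpk i hi]
  exact mul_le_mul_of_nonneg_left (rate_le_rate (hp0 i hi) (hg i) (hpm i hi))
    (time_nonneg_of_packet (hp0 i hi) (hg i) (hpk i hi))

/-- A plan from a value of the multiplier. -/
theorem exists_isPlan_of_multiplier {φ : ℝ} (hφ : 0 ≤ φ)
    (hr : ∀ i ∈ A, 0 < rate (S.lambertPower X ψ φ (g i)) (g i))
    (hle : ∑ i ∈ A, S.L / rate (S.lambertPower X ψ φ (g i)) (g i) ≤ S.Ts)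
    (hcomp : φ = 0 ∨ ∑ i ∈ A, S.L / rate (S.lambertPower X ψ φ (g i)) (g i) = S.Ts) :
    ∃ p t tN, S.IsPlan X ψ g A p t tN := by
  classical
  set p : Fin nR → ℝ := fun i => if i ∈ A then S.lambertPower X ψ φ (g i) else 0 with hp
  set t : Fin nR → ℝ := fun i =>
    if i ∈ A then S.L / rate (S.lambertPower X ψ φ (g i)) (g i) else 0 with ht
  have hsum : ∑ i, t i = ∑ i ∈ A, S.L / rate (S.lambertPower X ψ φ (g i)) (g i) := by
    simp [ht]
  refine ⟨p, t, S.Ts - ∑ i, t i, ⟨φ, hφ, ?_, fun i hi => by simp [hp, hi]⟩, fun i hi => ?_,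
    fun i hi => by simp [hp, ht, hi], rfl, by rw [hsum]; linarith⟩
  · rcases hcomp with h0 | h1
    · simp [h0]
    · rw [hsum, h1]; simp
  · simp only [hp, ht, hi, if_true]
    exact div_mul_cancel₀ _ (hr i hi).ne'

/-- The power depends on `ψ` and `φ` only through `c = ψ + φ`. The truncated expression agrees with
it for `c ≥ 0` and is continuous everywhere. -/
theorem lambertPower_eq_of_pos (hX : 0 < X) {c g : ℝ} (hc : 0 ≤ c) (hg : 0 ≤ g) :
    S.lambertPower X ψ (c - ψ) g =
      min (1 / g * (lambertRatio (max (c * S.Ts / X * g - 1) (-1)) - 1)) S.Pmax := by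
  rw [lambertPower, if_neg hX.ne', max_eq_left (S.lambertArg_ge hX.le hc hg)]
  simp

theorem continuous_lambertPower (X g : ℝ) : Continuous fun c : ℝ =>
    min (1 / g * (lambertRatio (max (c * S.Ts / X * g - 1) (-1)) - 1)) S.Pmax := by
  have h : Continuous fun c : ℝ => lambertRatio (max (c * S.Ts / X * g - 1) (-1)) :=
    continuous_lambertRatio_max.comp
      (((continuous_id.mul continuous_const).div_const X).mul continuous_const |>.sub
        continuous_const)
  exact (continuous_const.mul (h.sub continuous_const)).min continuous_const

theorem lambertPower_pos (hX : 0 < X) {c g : ℝ} (hc : 0 < c) (hg : 0 < g) :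
    0 < S.lambertPower X ψ (c - ψ) g := by
  rw [lambertPower, if_neg hX.ne', add_sub_cancel]
  have hT := S.Ts_pos
  have hz : -1 < c * S.Ts / X * g - 1 := by
    have : 0 < c * S.Ts / X * g := by positivity
    linarith
  obtain ⟨h1, h2⟩ := lambertRatio_spec hz.le
  have h3 : lambertRatio (c * S.Ts / X * g - 1) ≠ 1 := fun h => by
    rw [h] at h2; simp only [Real.log_one] at h2; linarith
  have h4 : 0 < lambertRatio (c * S.Ts / X * g - 1) - 1 :=
    sub_pos.2 (lt_of_le_of_ne h1 (Ne.symm h3))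
  exact lt_min (by positivity) S.Pmax_pos

theorem eventually_lambertPower_eq (hX : 0 < X) {g : ℝ} (hg : 0 < g) :
    ∀ᶠ c : ℝ in atTop, S.lambertPower X ψ (c - ψ) g = S.Pmax := by
  have hT := S.Ts_pos
  have hU : 1 ≤ 1 + S.Pmax * g := by have := mul_pos S.Pmax_pos hg; linarith
  have hlim : Tendsto (fun c : ℝ => c * S.Ts / X * g - 1) atTop atTop := by
    have : Tendsto (fun c : ℝ => c * (S.Ts / X * g)) atTop atTop :=
      tendsto_id.atTop_mul_const (by positivity)
    refine (tendsto_atTop_add_const_right _ (-1) this).congr fun c => by ring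
  filter_upwards [hlim.eventually_ge_atTop
    ((1 + S.Pmax * g) * Real.log (1 + S.Pmax * g) - (1 + S.Pmax * g)),
    hlim.eventually_ge_atTop (-1)] with c hc hc1
  rw [lambertPower, if_neg hX.ne', add_sub_cancel, min_eq_right]
  have := le_lambertRatio hc1 hU hc
  rw [one_div, inv_mul_eq_div, le_div_iff₀ hg]
  linarith

/-- Every feasible set has a plan. -/
theorem IsFeasible.exists_isPlan (h : S.IsFeasible g A) (hX : 0 ≤ X) (hψ : 0 ≤ ψ) :
    ∃ p t tN, S.IsPlan X ψ g A p t tN := by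
  obtain ⟨hg, hsum⟩ := h
  have hT := S.Ts_pos
  have hL := S.L_pos
  rcases A.eq_empty_or_nonempty with rfl | ⟨i₀, hi₀⟩
  · exact exists_isPlan_of_multiplier (φ := 0) le_rfl (by simp) (by simpa using hT.le) (Or.inl rfl)
  by_cases hX0 : X = 0
  · have e : ∀ i, S.lambertPower X ψ 0 (g i) = S.Pmax := fun i => by simp [lambertPower, hX0]
    refine exists_isPlan_of_multiplier (φ := 0) le_rfl (fun i hi => ?_) ?_ (Or.inl rfl)
    · rw [e]; exact rate_pos S.Pmax_pos (hg i hi)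
    · simpa only [e] using hsum
  have hXpos : 0 < X := lt_of_le_of_ne hX (Ne.symm hX0)
  have hrate : ∀ c : ℝ, 0 < c → ∀ i ∈ A, 0 < rate (S.lambertPower X ψ (c - ψ) (g i)) (g i) :=
    fun c hc i hi => rate_pos (lambertPower_pos hXpos hc (hg i hi)) (hg i hi)
  -- The time needed by `A` at total price `c`. Unless price `ψ` already fits into the slot, the
  -- multiplier is found by solving `T c = S.Ts` with `c ≥ ψ`.
  set T : ℝ → ℝ := fun c => ∑ i ∈ A, S.L / rate (S.lambertPower X ψ (c - ψ) (g i)) (g i) with hTdef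
  by_cases hcase : 0 < ψ ∧ T ψ ≤ S.Ts
  · obtain ⟨h1, h2⟩ := hcase
    have e : ψ - ψ = 0 := sub_self ψ
    refine exists_isPlan_of_multiplier (φ := 0) le_rfl (fun i hi => ?_) ?_ (Or.inl rfl)
    · simpa only [e] using hrate ψ h1 i hi
    · simpa only [hTdef, e] using h2
  -- If `ψ = 0`, the power tends to zero with the price, so user `i₀` alone takes more than the slot
  -- at some small positive price.
  obtain ⟨c₁, hc₁, hψc₁, hTc₁⟩ : ∃ c₁, 0 < c₁ ∧ ψ ≤ c₁ ∧ S.Ts ≤ T c₁ := by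
    rcases hψ.lt_or_eq with hpos | h0
    · exact ⟨ψ, hpos, le_rfl, le_of_not_ge fun hle => hcase ⟨hpos, hle⟩⟩
    · have hlim : Tendsto (fun c : ℝ => rate (min (1 / g i₀ *
          (lambertRatio (max (c * S.Ts / X * g i₀ - 1) (-1)) - 1)) S.Pmax) (g i₀)) (𝓝[>] 0)
          (𝓝 0) := by
        have h1 : Tendsto (fun c : ℝ => min (1 / g i₀ *
          (lambertRatio (max (c * S.Ts / X * g i₀ - 1) (-1)) - 1)) S.Pmax) (𝓝 0) (𝓝 0) := by
          have := (continuous_lambertPower (S := S) X (g i₀)).tendsto 0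
          have e : lambertRatio (-1) = 1 := by
            simpa using lambertRatio_mul_log_sub (le_refl (1 : ℝ))
          simpa [e, S.Pmax_pos.le] using this
        have h2 : Tendsto (fun p : ℝ => rate p (g i₀)) (𝓝 0) (𝓝 0) := by
          have : ContinuousAt (fun p : ℝ => Real.log (1 + p * g i₀)) 0 :=
            ContinuousAt.log (by fun_prop) (by simp)
          simpa [ContinuousAt, rate] using this
        exact (h2.comp h1).mono_left nhdsWithin_le_nhds
      have hpos : 0 < S.L / S.Ts := by positivity
      obtain ⟨c, hc, hc0⟩ := ((hlim.eventually (gt_mem_nhds hpos)).and self_mem_nhdsWithin).exists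
      have hc0 : 0 < c := hc0
      refine ⟨c, hc0, by rw [← h0]; exact hc0.le, ?_⟩
      rw [← lambertPower_eq_of_pos (ψ := ψ) hXpos hc0.le (hg i₀ hi₀).le] at hc
      have h3 : S.Ts ≤ S.L / rate (S.lambertPower X ψ (c - ψ) (g i₀)) (g i₀) := by
        rw [le_div_iff₀ (hrate c hc0 i₀ hi₀)]
        rw [lt_div_iff₀ hT] at hc
        linarith
      exact h3.trans (Finset.single_le_sum
        (f := fun i => S.L / rate (S.lambertPower X ψ (c - ψ) (g i)) (g i))
        (fun i hi => div_nonneg hL.le (hrate c hc0 i hi).le) hi₀)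
  -- For high prices all powers equal `Pmax`, where feasibility of `A` says that the slot suffices.
  obtain ⟨c₂, hc₂, hle⟩ := (((Finset.eventually_all A).2 fun i hi =>
    eventually_lambertPower_eq (S := S) (ψ := ψ) hXpos (hg i hi)).and
      (eventually_ge_atTop c₁)).exists
  have hTc₂ : T c₂ ≤ S.Ts := by
    refine le_trans (le_of_eq ?_) hsum
    exact Finset.sum_congr rfl fun i hi => by rw [hc₂ i hi]
  have hcont : ContinuousOn T (Set.Icc c₁ c₂) := by
    refine continuousOn_finsetSum _ fun i hi => ?_
    have h1 : ContinuousOn (fun c : ℝ => S.lambertPower X ψ (c - ψ) (g i)) (Set.Icc c₁ c₂) :=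
      (continuous_lambertPower (S := S) X (g i)).continuousOn.congr fun c hc =>
        lambertPower_eq_of_pos hXpos (hc₁.le.trans hc.1) (hg i hi).le
    have h2 : ContinuousOn (fun c : ℝ => rate (S.lambertPower X ψ (c - ψ) (g i)) (g i))
        (Set.Icc c₁ c₂) := by
      refine ContinuousOn.log (continuousOn_const.add (h1.mul continuousOn_const)) fun c hc => ?_
      have := mul_pos (lambertPower_pos (S := S) (ψ := ψ) hXpos (hc₁.trans_le hc.1) (hg i hi))
        (hg i hi)
      positivity
    exact continuousOn_const.div h2 fun c hc => (hrate c (hc₁.trans_le hc.1) i hi).ne'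
  obtain ⟨c, hc, hTc⟩ := intermediate_value_Icc' hle hcont ⟨hTc₂, hTc₁⟩
  exact exists_isPlan_of_multiplier (φ := c - ψ) (by linarith [hc.1])
    (hrate c (hc₁.trans_le hc.1)) hTc.le (Or.inr hTc)

/-- Replacing a scheduled user by one with larger weight and gain is an improvement. -/
theorem IsPlan.exists_better_of_swap (h : S.IsPlan X ψ g A p t tN) (hX : 0 ≤ X) (hψ : 0 ≤ ψ)
    (hg : ∀ i, 0 ≤ g i) {i j : Fin nR} (hi : i ∉ A) (hj : j ∈ A) (hY : Y j < Y i)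
    (hgij : g j < g i) :
    ∃ A' p' t', (∀ l ∈ A', 0 ≤ p' l) ∧ (∀ l ∈ A', p' l ≤ S.Pmax) ∧
      (∀ l ∈ A', t' l * rate (p' l) (g l) = S.L) ∧ ∑ l ∈ A', t' l ≤ S.Ts ∧
      S.planValue X ψ Y A p t < S.planValue X ψ Y A' p' t' := by
  classical
  have hT := S.Ts_pos
  have hgi : 0 < g i := lt_of_le_of_lt (hg j) hgij
  have hpn := h.power_nonneg hX hψ hg
  have hpj : p j * g j / g i ≤ p j := by
    rw [div_le_iff₀ hgi]; exact mul_le_mul_of_nonneg_left hgij.le (hpn j)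
  have htj : 0 ≤ t j := time_nonneg_of_packet (hpn j) (hg j) (h.packet j hj)
  -- The new user receives the time of `j` and the power giving the same received power, hence the
  -- same rate; its better gain makes this cheaper.
  set p' := Function.update p i (p j * g j / g i) with hp'
  set t' := Function.update t i (t j) with ht'
  have hne : ∀ l ∈ A.erase j, l ≠ i := fun l hl hli => hi (hli ▸ Finset.mem_of_mem_erase hl)
  have hinot : i ∉ A.erase j := fun hmem => hi (Finset.mem_of_mem_erase hmem)
  have ep : p' i = p j * g j / g i := by simp [hp']
  have et : t' i = t j := by simp [ht']
  have epl : ∀ l ∈ A.erase j, p' l = p l := fun l hl => by simp [hp', hne l hl]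
  have etl : ∀ l ∈ A.erase j, t' l = t l := fun l hl => by simp [ht', hne l hl]
  have hsum : ∑ l ∈ insert i (A.erase j), t' l = ∑ l ∈ A, t l := by
    rw [Finset.sum_insert hinot, et, Finset.sum_congr rfl etl, Finset.add_sum_erase A t hj]
  refine ⟨insert i (A.erase j), p', t', fun l hl => ?_, fun l hl => ?_, fun l hl => ?_, ?_, ?_⟩
  · rcases Finset.mem_insert.1 hl with rfl | hl
    · rw [ep]; exact div_nonneg (mul_nonneg (hpn j) (hg j)) hgi.le
    · rw [epl l hl]; exact hpn l
  · rcases Finset.mem_insert.1 hl with rfl | hl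
    · rw [ep]; exact hpj.trans (h.power_le j)
    · rw [epl l hl]; exact h.power_le l
  · rcases Finset.mem_insert.1 hl with rfl | hl
    · rw [ep, et, ← h.packet j hj, rate, rate, div_mul_cancel₀ _ hgi.ne']
    · rw [epl l hl, etl l hl]; exact h.packet l (Finset.mem_of_mem_erase hl)
  · rw [hsum]; exact h.sum_time_le
  · rw [planValue, planValue, hsum, Finset.sum_insert hinot, ep, et,
      ← Finset.add_sum_erase A (fun l => Y l - X * p l * t l / S.Ts) hj]
    have es : ∑ l ∈ A.erase j, (Y l - X * p' l * t' l / S.Ts) =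
        ∑ l ∈ A.erase j, (Y l - X * p l * t l / S.Ts) :=
      Finset.sum_congr rfl fun l hl => by rw [epl l hl, etl l hl]
    have h1 : X * (p j * g j / g i) * t j / S.Ts ≤ X * p j * t j / S.Ts := by gcongr
    linarith

/-- The value of an excluded set is exceeded by that of a candidate. -/
theorem exists_candidate_ge (hX : 0 ≤ X) (hψ : 0 ≤ ψ) (hg : ∀ i, 0 ≤ g i) :
    ∃ A p t tN, S.IsCandidate X ψ Y g A p t tN ∧
      ∀ A' p' t', (∀ l ∈ A', 0 ≤ p' l) → (∀ l ∈ A', p' l ≤ S.Pmax) →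
        (∀ l ∈ A', t' l * rate (p' l) (g l) = S.L) → ∑ l ∈ A', t' l ≤ S.Ts →
        S.planValue X ψ Y A' p' t' ≤ S.candidateValue X ψ Y A p t tN := by
  classical
  have hex : ∀ A : {A : Finset (Fin nR) // S.IsFeasible g A}, ∃ p t tN,
      S.IsPlan X ψ g A p t tN := fun A => A.2.exists_isPlan hX hψ
  choose p t tN hplan using hex
  have hne : Nonempty {A : Finset (Fin nR) // S.IsFeasible g A} :=
    ⟨∅, by simp, by simpa using S.Ts_pos.le⟩
  -- A best plan over all feasible sets cannot belong to a skipped set, since a swap would improve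
  -- it strictly. Thus skipping loses nothing.
  obtain ⟨A, hA⟩ := Finite.exists_max fun A : {A : Finset (Fin nR) // S.IsFeasible g A} =>
    S.planValue X ψ Y A (p A) (t A)
  have hbest : ∀ A' p' t', (∀ l ∈ A', 0 ≤ p' l) → (∀ l ∈ A', p' l ≤ S.Pmax) →
      (∀ l ∈ A', t' l * rate (p' l) (g l) = S.L) → ∑ l ∈ A', t' l ≤ S.Ts →
      S.planValue X ψ Y A' p' t' ≤ S.planValue X ψ Y A (p A) (t A) := by
    intro A' p' t' h0 hm hpk hs
    have hfeas := isFeasible_of_schedule hg h0 hm hpk hs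
    exact ((hplan ⟨A', hfeas⟩).planValue_le hX hψ hg h0 hm hpk hs).trans (hA ⟨A', hfeas⟩)
  have hP := hplan A
  refine ⟨A, p A, t A, tN A, ⟨?_, hP.power, hP.packet, hP.unscheduled, hP.remaining,
    hP.remaining_nonneg⟩, ?_⟩
  · rintro ⟨i, hi, j, hj, hY, hgij⟩
    obtain ⟨A', p', t', h0, hm, hpk, hs, hlt⟩ := hP.exists_better_of_swap hX hψ hg hi hj hY hgij
    exact absurd (hbest A' p' t' h0 hm hpk hs) (not_le.2 hlt)
  · rw [hP.candidateValue_eq]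
    exact hbest

/-- The algorithm can be run in every slot. -/
theorem exists_isLambertStrict (hN : 0 < nN) {Q : Fin nN → ℝ} (hX : 0 ≤ X) (hQ : ∀ i, 0 ≤ Q i)
    (m : S.State) : ∃ μ P, S.IsLambertStrict Q Y X m μ P := by
  have : Nonempty (Fin nN) := ⟨⟨0, hN⟩⟩
  obtain ⟨j, hj⟩ := Finite.exists_max fun i => S.psiN X (Q i) (m (Sum.inr i))
  have hψ : 0 ≤ S.psiN X (Q j) (m (Sum.inr j)) := S.psiN_nonneg hX (hQ j) (S.gain_nonneg m _)
  obtain ⟨A, p, t, tN, hc, hbest⟩ := exists_candidate_ge (S := S) (Y := Y) hX hψ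
    (g := fun i => m (Sum.inl i)) fun i => S.gain_nonneg m _
  classical
  refine ⟨Sum.elim t fun i => if i = j then tN else 0,
    Sum.elim p fun i => if i = j then S.waterFilling X (Q j) (m (Sum.inr j)) else 0,
    j, hj, by simp, fun i hi => by simp [hi], A, by simpa using hc, fun A' p' t' tN' h' => ?_⟩
  have hg : ∀ i : Fin nR, 0 ≤ (m (Sum.inl i) : ℝ) := fun i => S.gain_nonneg m _
  rw [h'.isPlan.candidateValue_eq]
  simpa using hbest A' p' t' (fun i _ => h'.isPlan.power_nonneg hX hψ hg i)
    (fun i _ => h'.isPlan.power_le i) h'.packet h'.isPlan.sum_time_le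

/-- The vector of all queues. -/
def queueVec (Q : Fin nN → ℝ) (Y : Fin nR → ℝ) (X : ℝ) : QueueSpace nR nN :=
  WithLp.toLp 2 fun
    | none => X
    | some (Sum.inl i) => Y i
    | some (Sum.inr i) => Q i

-- The power cost splits among the users, so the weight of an allocation is a sum of the per-user
-- weights that the algorithm compares.
open Classical in
theorem inner_queueVec_outcome (Q : Fin nN → ℝ) (Y : Fin nR → ℝ) (X : ℝ) (m : S.State)
    (μ P : User nR nN → ℝ) :
    inner ℝ (queueVec Q Y X) (S.outcome m μ P) =
      ∑ i, (Y i * (if μ (Sum.inl i) = 0 then 0 else 1) -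
        X * P (Sum.inl i) * μ (Sum.inl i) / S.Ts) +
      ∑ i, μ (Sum.inr i) * (Q i * rate (P (Sum.inr i)) (m (Sum.inr i)) -
        X * P (Sum.inr i) / S.Ts) := by
  rw [inner_euclidean, Fintype.sum_option, Fintype.sum_sum_type]
  simp only [outcome_none, outcome_inl, outcome_inr, queueVec, Fintype.sum_sum_type]
  rw [Finset.sum_sub_distrib]
  simp only [mul_sub, Finset.sum_sub_distrib]
  rw [add_div, mul_neg, mul_add, Finset.sum_div, Finset.sum_div, Finset.mul_sum, Finset.mul_sum]
  have e1 : ∀ i : Fin nR, X * (P (Sum.inl i) * μ (Sum.inl i) / S.Ts) =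
      X * P (Sum.inl i) * μ (Sum.inl i) / S.Ts := fun i => by ring
  have e2 : ∀ i : Fin nN, X * (P (Sum.inr i) * μ (Sum.inr i) / S.Ts) =
      μ (Sum.inr i) * (X * P (Sum.inr i) / S.Ts) := fun i => by ring
  have e3 : ∀ i : Fin nN, Q i * (μ (Sum.inr i) * rate (P (Sum.inr i)) (m (Sum.inr i))) =
      μ (Sum.inr i) * (Q i * rate (P (Sum.inr i)) (m (Sum.inr i))) := fun i => by ring
  simp only [e1, e2, e3]
  ring

/-- The output of the algorithm is an allocation of the whole slot, of maximal weight. -/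
theorem IsLambertStrict.optimal {Q : Fin nN → ℝ} {m : S.State} {μ P : User nR nN → ℝ}
    (h : S.IsLambertStrict Q Y X m μ P) (hX : 0 ≤ X) (hQ : ∀ i, 0 ≤ Q i) :
    S.IsSlotAllocation m μ P ∧ ∑ i, μ i = S.Ts ∧
      ∀ o ∈ S.outcomes m, inner ℝ (queueVec Q Y X) o ≤
        inner ℝ (queueVec Q Y X) (S.outcome m μ P) := by
  classical
  obtain ⟨j, hj, hPj, hother, A, hc, hmax⟩ := h
  set ψ := S.psiN X (Q j) (m (Sum.inr j)) with hψdef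
  have hψ : 0 ≤ ψ := S.psiN_nonneg hX (hQ j) (S.gain_nonneg m _)
  have hg : ∀ i : Fin nR, 0 ≤ (m (Sum.inl i) : ℝ) := fun i => S.gain_nonneg m _
  have hpl := hc.isPlan
  have hT := S.Ts_pos
  have hsumN : ∀ f : Fin nN → ℝ, (∀ i, i ≠ j → f i = 0) → ∑ i, f i = f j := fun f hf =>
    Finset.sum_eq_single j (fun i _ hi => hf i hi) fun hn => absurd (Finset.mem_univ j) hn
  have htot : ∑ i, μ i = S.Ts := by
    rw [Fintype.sum_sum_type, hsumN _ fun i hi => (hother i hi).2, hc.remaining]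
    ring
  have halloc : S.IsSlotAllocation m μ P := by
    refine ⟨?_, htot.le, ?_, ?_, fun i => ?_⟩
    · rintro (i | i)
      · by_cases hi : i ∈ A
        · exact time_nonneg_of_packet (hpl.power_nonneg hX hψ hg i) (hg i) (hc.packet i hi)
        · exact (hc.unscheduled i hi).2.ge
      · by_cases hi : i = j
        · rw [hi]; exact hc.remaining_nonneg
        · exact (hother i hi).2.ge
    · rintro (i | i)
      · exact hpl.power_nonneg hX hψ hg i
      · by_cases hi : i = j
        · rw [hi, hPj]; exact S.waterFilling_nonneg _ _ _
        · exact (hother i hi).1.ge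
    · rintro (i | i)
      · exact hpl.power_le i
      · by_cases hi : i = j
        · rw [hi, hPj]; exact S.waterFilling_le _ _ _
        · rw [(hother i hi).1]; exact S.Pmax_pos.le
    · by_cases hi : i ∈ A
      · exact Or.inr (hc.packet i hi)
      · exact Or.inl (hc.unscheduled i hi).2
  refine ⟨halloc, htot, ?_⟩
  have hval : inner ℝ (queueVec Q Y X) (S.outcome m μ P) =
      S.candidateValue X ψ Y A (fun i => P (Sum.inl i)) (fun i => μ (Sum.inl i))
        (μ (Sum.inr j)) := by
    rw [inner_queueVec_outcome, candidateValue, hsumN _ fun i hi => by rw [(hother i hi).2, zero_mul],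
      hPj]
    congr 1
    · rw [← Finset.sum_subset (Finset.subset_univ A) fun i _ hi => by
        simp [(hc.unscheduled i hi).2]]
      refine Finset.sum_congr rfl fun i hi => ?_
      have : μ (Sum.inl i) ≠ 0 := fun h0 => by
        have := hc.packet i hi
        simp only [h0, zero_mul] at this
        exact S.L_pos.ne this
      simp [this]
    · rw [mul_comm]; rfl
  rintro _ ⟨μ', P', h', rfl⟩
  obtain ⟨A₀, p₀, t₀, tN₀, hc₀, hbest⟩ := exists_candidate_ge (S := S) (Y := Y) hX hψ hg
  set A' := Finset.univ.filter fun i : Fin nR => μ' (Sum.inl i) ≠ 0 with hA'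
  have hsumA : ∑ i ∈ A', μ' (Sum.inl i) = ∑ i, μ' (Sum.inl i) :=
    Finset.sum_subset (Finset.subset_univ _) fun i _ hi => by simpa [hA'] using hi
  have htime := h'.time_sum
  rw [Fintype.sum_sum_type] at htime
  have hN0 : 0 ≤ ∑ i, μ' (Sum.inr i) := Finset.sum_nonneg fun i _ => h'.time_nonneg _
  -- The NRT time of any competitor is worth at most `ψ` per second, so it may all be given to the
  -- selected NRT user; extending it to the end of the slot does not hurt, as `ψ ≥ 0`.
  have h1 : inner ℝ (queueVec Q Y X) (S.outcome m μ' P') ≤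
      S.planValue X ψ Y A' (fun i => P' (Sum.inl i)) (fun i => μ' (Sum.inl i)) := by
    rw [inner_queueVec_outcome, planValue, hsumA]
    refine add_le_add (le_of_eq ?_) ?_
    · rw [← Finset.sum_subset (Finset.subset_univ A') fun i _ hi => by
        have : μ' (Sum.inl i) = 0 := by simpa [hA'] using hi
        simp [this]]
      refine Finset.sum_congr rfl fun i hi => ?_
      have : μ' (Sum.inl i) ≠ 0 := by simpa [hA'] using hi
      simp [this]
    · calc _ ≤ ∑ i, μ' (Sum.inr i) * ψ := Finset.sum_le_sum fun i _ =>
            mul_le_mul_of_nonneg_left ((S.le_psiN hX (hQ i) (S.gain_nonneg m _)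
              (h'.power_nonneg _) (h'.power_le _)).trans (hj i)) (h'.time_nonneg _)
        _ = ψ * ∑ i, μ' (Sum.inr i) := by rw [← Finset.sum_mul, mul_comm]
        _ ≤ _ := mul_le_mul_of_nonneg_left (by linarith) hψ
  have h2 := hbest A' (fun i => P' (Sum.inl i)) (fun i => μ' (Sum.inl i))
    (fun i _ => h'.power_nonneg _) (fun i _ => h'.power_le _)
    (fun i hi => (h'.whole_packet i).resolve_left (by simpa [hA'] using hi))
    (by rw [hsumA]; linarith)
  rw [hval]
  exact h1.trans (h2.trans (hmax A₀ p₀ t₀ tN₀ hc₀))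

end System

/-! ### Directions without slack, and slack against distance -/

theorem norm_le_sum_of_nonneg {J : Type*} [Fintype J] {x : EuclideanSpace ℝ J}
    (h : ∀ j, 0 ≤ x j) : ‖x‖ ≤ ∑ j, x j := by
  have hs : 0 ≤ ∑ j, x j := Finset.sum_nonneg fun j _ => h j
  refine (abs_le_of_sq_le_sq' ?_ hs).2
  rw [EuclideanSpace.real_norm_sq_eq, pow_two, Finset.sum_mul]
  refine Finset.sum_le_sum fun j _ => ?_
  rw [pow_two]
  exact mul_le_mul_of_nonneg_left
    (Finset.single_le_sum (fun j _ => h j) (Finset.mem_univ j)) (h j)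

namespace System

variable {nR nN : ℕ} (S : System nR nN)

/-- The directions in which the rates `lam` leave no slack. -/
def tightCone (lam : Fin nN → ℝ) : Set (QueueSpace nR nN) :=
  {y | (∀ j, 0 ≤ y j) ∧ meanSupport S.prob S.outcomes y ≤ inner ℝ y (S.target lam)}

theorem meanSupport_convex {x y : QueueSpace nR nN} {a b : ℝ} (ha : 0 ≤ a) (hb : 0 ≤ b) :
    meanSupport S.prob S.outcomes (a • x + b • y) ≤
      a * meanSupport S.prob S.outcomes x + b * meanSupport S.prob S.outcomes y := by
  obtain ⟨C, hC, -⟩ := S.exists_norm_bound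
  simp only [meanSupport, Finset.mul_sum]
  rw [← Finset.sum_add_distrib]
  refine Finset.sum_le_sum fun m _ => ?_
  have : support (S.outcomes m) (a • x + b • y) ≤
      a * support (S.outcomes m) x + b * support (S.outcomes m) y := by
    refine support_le (S.outcomes_nonempty m) fun o ho => ?_
    rw [inner_add_left, inner_smul_left, inner_smul_left]
    exact add_le_add (mul_le_mul_of_nonneg_left (inner_le_support (hC m) x ho) ha)
      (mul_le_mul_of_nonneg_left (inner_le_support (hC m) y ho) hb)
  have := mul_le_mul_of_nonneg_left this (S.prob_nonneg m)
  linarith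

theorem continuous_meanSupport : Continuous (meanSupport S.prob S.outcomes) := by
  obtain ⟨C, hC, -⟩ := S.exists_norm_bound
  unfold meanSupport
  exact continuous_finsetSum _ fun m _ =>
    continuous_const.mul (continuous_support (S.outcomes_nonempty m) (hC m))

theorem convex_tightCone (lam : Fin nN → ℝ) : Convex ℝ (S.tightCone lam) := by
  rintro x ⟨hx, hx'⟩ y ⟨hy, hy'⟩ a b ha hb -
  refine ⟨fun j => ?_, (S.meanSupport_convex ha hb).trans ?_⟩
  · simp only [PiLp.add_apply, PiLp.smul_apply, smul_eq_mul]
    exact add_nonneg (mul_nonneg ha (hx j)) (mul_nonneg hb (hy j))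
  · rw [inner_add_left, inner_smul_left, inner_smul_left]
    exact add_le_add (mul_le_mul_of_nonneg_left hx' ha) (mul_le_mul_of_nonneg_left hy' hb)

theorem isClosed_tightCone (lam : Fin nN → ℝ) : IsClosed (S.tightCone lam) := by
  have : S.tightCone lam = (⋂ j, {y | 0 ≤ y j}) ∩
      {y | meanSupport S.prob S.outcomes y ≤ inner ℝ y (S.target lam)} := by
    ext; simp [tightCone]
  rw [this]
  have := S.continuous_meanSupport
  exact (isClosed_iInter fun j => isClosed_le continuous_const (by fun_prop)).inter
    (isClosed_le (by fun_prop) (by fun_prop))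

theorem zero_mem_tightCone (lam : Fin nN → ℝ) : (0 : QueueSpace nR nN) ∈ S.tightCone lam := by
  refine ⟨by simp, ?_⟩
  have := S.meanSupport_convex (x := 0) (y := 0) (a := 0) (b := 0) le_rfl le_rfl
  simpa using this

/-- The RT part of a vector of queues. -/
def restrictRT (x : QueueSpace nR nN) : QueueSpace nR nN :=
  WithLp.toLp 2 fun
    | some (Sum.inl i) => x (some (Sum.inl i))
    | _ => 0

@[simp] theorem restrictRT_inl (x : QueueSpace nR nN) (i : Fin nR) :
    restrictRT x (some (Sum.inl i)) = x (some (Sum.inl i)) := rfl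

@[simp] theorem restrictRT_inr (x : QueueSpace nR nN) (i : Fin nN) :
    restrictRT x (some (Sum.inr i)) = 0 := rfl

@[simp] theorem restrictRT_none (x : QueueSpace nR nN) : restrictRT x none = 0 := rfl

theorem inner_restrictRT (x : QueueSpace nR nN) {y : QueueSpace nR nN} (h0 : y none = 0)
    (hN : ∀ i : Fin nN, y (some (Sum.inr i)) = 0) :
    inner ℝ (restrictRT x) y = inner ℝ y x := by
  simp only [inner_euclidean, Fintype.sum_option, Fintype.sum_sum_type]
  simp [h0, hN, mul_comm]

/-- The RT parts of the mean outcomes, relative to the target. -/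
def excessRT (lam : Fin nN → ℝ) : Set (QueueSpace nR nN) :=
  {d | ∃ μ P : S.State → User nR nN → ℝ, (∀ m, S.IsSlotAllocation m (μ m) (P m)) ∧
    d = restrictRT (S.meanOutcome μ P - S.target lam)}

/-- The RT part of a mean outcome depends only on which RT users are scheduled in which state, and
there are finitely many such patterns `χ`. This is the source of polyhedrality. -/
theorem finite_excessRT (lam : Fin nN → ℝ) : (S.excessRT lam).Finite := by
  classical
  refine (Set.finite_range fun χ : S.State → Fin nR → Bool => (WithLp.toLp 2 fun
    | some (Sum.inl i) => (∑ m, S.prob m * if χ m i then 0 else 1) - S.rateR i * S.q i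
    | _ => 0 : QueueSpace nR nN)).subset ?_
  rintro _ ⟨μ, P, -, rfl⟩
  refine ⟨fun m i => decide (μ m (Sum.inl i) = 0), ?_⟩
  ext j
  rcases j with _ | i | i
  · rfl
  · simp [meanOutcome_apply]
  · rfl

theorem le_of_forall_meanOutcome {v : QueueSpace nR nN} {c : ℝ}
    (h : ∀ μ P : S.State → User nR nN → ℝ, (∀ m, S.IsSlotAllocation m (μ m) (P m)) →
      inner ℝ v (S.meanOutcome μ P) ≤ c) : meanSupport S.prob S.outcomes v ≤ c := by
  refine le_of_forall_pos_le_add fun e he => ?_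
  have hch : ∀ m : S.State, ∃ μ P : User nR nN → ℝ,
      S.IsSlotAllocation m μ P ∧ support (S.outcomes m) v - e < inner ℝ v (S.outcome m μ P) := by
    intro m
    obtain ⟨_, ⟨μ, P, hall, rfl⟩, hlt⟩ :=
      exists_support_sub_lt (S.outcomes_nonempty m) v he
    exact ⟨μ, P, hall, hlt⟩
  choose μ P hall hlt using hch
  have h1 := h μ P hall
  have h2 : meanSupport S.prob S.outcomes v - e ≤ inner ℝ v (S.meanOutcome μ P) := by
    simp only [meanOutcome, inner_sum, inner_smul_right, meanSupport]
    rw [← one_mul e, ← S.prob_sum, Finset.sum_mul, ← Finset.sum_sub_distrib]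
    refine Finset.sum_le_sum fun m _ => ?_
    have := mul_le_mul_of_nonneg_left (hlt m).le (S.prob_nonneg m)
    linarith
  linarith

theorem meanSupport_lipschitz : ∃ C : ℝ, 0 ≤ C ∧ ∀ v v' : QueueSpace nR nN,
    meanSupport S.prob S.outcomes v ≤ meanSupport S.prob S.outcomes v' + C * ‖v - v'‖ := by
  obtain ⟨C, hC, -⟩ := S.exists_norm_bound
  refine ⟨max C 0, le_max_right _ _, fun v v' => ?_⟩
  have : ∀ m, support (S.outcomes m) v ≤ support (S.outcomes m) v' + max C 0 * ‖v - v'‖ :=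
    fun m => support_le_add (S.outcomes_nonempty m)
      (fun o ho => (hC m o ho).trans (le_max_left _ _)) v v'
  calc meanSupport S.prob S.outcomes v
      ≤ ∑ m, S.prob m * (support (S.outcomes m) v' + max C 0 * ‖v - v'‖) :=
        Finset.sum_le_sum fun m _ => mul_le_mul_of_nonneg_left (this m) (S.prob_nonneg m)
    _ = _ := by
        simp only [mul_add, Finset.sum_add_distrib]
        rw [← Finset.sum_mul, S.prob_sum, one_mul, meanSupport]

/-- In the RT directions, the slack is proportional to the distance from the tight cone. -/
theorem exists_hoffman_RT (lam : Fin nN → ℝ)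
    (hsupp : ∀ v : QueueSpace nR nN, (∀ j, 0 ≤ v j) →
      inner ℝ v (S.target lam) ≤ meanSupport S.prob S.outcomes v) :
    ∃ κ : ℝ, 0 < κ ∧ ∀ w : QueueSpace nR nN, (∀ j, 0 ≤ w j) → ∃ y ∈ S.tightCone lam,
      κ * ‖restrictRT w - y‖ ≤ meanSupport S.prob S.outcomes (restrictRT w) -
        inner ℝ (restrictRT w) (S.target lam) := by
  -- The cone cut out by `G` consists of nonnegative vectors with zero power and NRT coordinates on
  -- which no mean outcome exceeds the target; these lie in `tightCone`.
  set G : Set (QueueSpace nR nN) :=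
    (Set.range fun j => -EuclideanSpace.single j (1 : ℝ)) ∪
    ({EuclideanSpace.single none (1 : ℝ)} ∪
      (Set.range fun i : Fin nN => EuclideanSpace.single (some (Sum.inr i)) (1 : ℝ))) ∪
    S.excessRT lam with hG
  have hfin : G.Finite := ((Set.finite_range _).union ((Set.finite_singleton _).union
    (Set.finite_range _))).union (S.finite_excessRT lam)
  obtain ⟨κ, hκ, hhoff⟩ := exists_hoffman_bound hfin
  refine ⟨κ, hκ, fun w hw => ?_⟩
  set x := restrictRT w with hx
  have hx0 : ∀ j, 0 ≤ x j := by
    rintro (_ | i | i)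
    · simp [hx]
    · simpa [hx] using hw _
    · simp [hx]
  obtain ⟨y, hy, hcase⟩ := hhoff x
  have hy0 : ∀ j, 0 ≤ y j := fun j => by
    have := hy _ (Or.inl (Or.inl ⟨j, rfl⟩))
    simpa [EuclideanSpace.inner_single_left] using this
  have hynone : y none = 0 := by
    have := hy _ (Or.inl (Or.inr (Or.inl rfl)))
    simp only [EuclideanSpace.inner_single_left, map_one, one_mul] at this
    exact le_antisymm this (hy0 _)
  have hyN : ∀ i : Fin nN, y (some (Sum.inr i)) = 0 := fun i => by
    have := hy _ (Or.inl (Or.inr (Or.inr ⟨i, rfl⟩)))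
    simp only [EuclideanSpace.inner_single_left, map_one, one_mul] at this
    exact le_antisymm this (hy0 _)
  refine ⟨y, ⟨hy0, S.le_of_forall_meanOutcome fun μ P hall => ?_⟩, ?_⟩
  · have h1 := hy _ (Or.inr ⟨μ, P, hall, rfl⟩)
    rw [inner_restrictRT _ hynone hyN, inner_sub_right] at h1
    linarith
  · have hs := sub_nonneg.2 (hsupp x hx0)
    rcases hcase with h | ⟨g, hg, hle⟩
    · rw [h, sub_self, norm_zero, mul_zero, ← h]; exact hs
    -- The sign and coordinate constraints are satisfied by `x` itself, so nonnegativity of the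
    -- slack settles them. A violated excess constraint is a lower bound for the slack.
    · rcases hg with (⟨j, rfl⟩ | hg | ⟨i, rfl⟩) | ⟨μ, P, hall, rfl⟩
      · refine hle.trans (le_trans ?_ hs)
        simpa [EuclideanSpace.inner_single_left] using hx0 j
      · refine hle.trans (le_trans ?_ hs)
        rw [Set.mem_singleton_iff.1 hg]
        simp [EuclideanSpace.inner_single_left, hx]
      · refine hle.trans (le_trans ?_ hs)
        simp [EuclideanSpace.inner_single_left, hx]
      · refine hle.trans ?_
        rw [inner_restrictRT _ (by simp [hx]) (by simp [hx]), inner_sub_right]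
        linarith [S.inner_meanOutcome_le hall x]

/-- With a positive NRT rate strictly inside the region, the slack is proportional to the distance
from the tight cone. -/
theorem exists_slack_dist {lam : Fin nN → ℝ} {ε : ℝ} (hε : 0 < ε)
    (h : (1 + ε) • lam ∈ S.lambertRegion) {i₀ : Fin nN} (hi₀ : 0 < lam i₀) :
    ∃ κ : ℝ, 0 < κ ∧ ∀ w : QueueSpace nR nN, (∀ j, 0 ≤ w j) →
      (∀ i, lam i = 0 → w (some (Sum.inr i)) = 0) → ∃ y ∈ S.tightCone lam,
      κ * ‖w - y‖ ≤ meanSupport S.prob S.outcomes w - inner ℝ w (S.target lam) := by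
  have hlam : ∀ i, 0 ≤ lam i := fun i => by
    have := S.nonneg_of_mem_lambertRegion h i
    simp only [Pi.smul_apply, smul_eq_mul] at this
    exact nonneg_of_mul_nonneg_right this (by linarith)
  obtain ⟨δ, hδ, hslack⟩ := S.exists_slack hε h hi₀
  have hsupp : ∀ v : QueueSpace nR nN, (∀ j, 0 ≤ v j) →
      inner ℝ v (S.target lam) ≤ meanSupport S.prob S.outcomes v := fun v hv => by
    have h1 := hslack v hv
    have h2 : 0 ≤ ∑ i, lam i * v (some (Sum.inr i)) + v none :=
      add_nonneg (Finset.sum_nonneg fun i _ => mul_nonneg (hlam i) (hv _)) (hv _)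
    linarith [mul_nonneg hδ.le h2]
  obtain ⟨κ, hκ, hhoff⟩ := S.exists_hoffman_RT lam hsupp
  obtain ⟨C, hC, hlip⟩ := S.meanSupport_lipschitz
  set C₁ := C + ‖S.target lam‖ with hC₁
  have hC₁0 : 0 ≤ C₁ := by positivity
  -- The least positive rate, capped at 1 because the power queue enters `exists_slack` with
  -- coefficient 1.
  obtain ⟨l₀, hl₀, hl₁, hmin⟩ : ∃ l₀ : ℝ, 0 < l₀ ∧ l₀ ≤ 1 ∧ ∀ i, lam i = 0 ∨ l₀ ≤ lam i := by
    obtain ⟨i₁, hi₁, hm⟩ := (Finset.univ.filter fun i => 0 < lam i).exists_min_image lam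
      ⟨i₀, by simp [hi₀]⟩
    refine ⟨min (lam i₁) 1, lt_min (by simpa using hi₁) one_pos, min_le_right _ _, fun i => ?_⟩
    rcases (hlam i).lt_or_eq with hpos | h0
    · exact Or.inr ((min_le_left _ _).trans (hm i (by simp [hpos])))
    · exact Or.inl h0.symm
  -- Obtained from `‖w - y‖ ≤ N + (s + C₁ * N) / κ` and `N ≤ s / (δ * l₀)`, where `s` is the slack
  -- and `N` the mass outside the RT coordinates.
  set a := (1 + C₁ / κ) / (δ * l₀) + 1 / κ with ha
  have ha0 : 0 < a := by positivity
  refine ⟨1 / a, by positivity, fun w hw hw0 => ?_⟩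
  obtain ⟨y, hy, hyle⟩ := hhoff w hw
  refine ⟨y, hy, ?_⟩
  set s := meanSupport S.prob S.outcomes w - inner ℝ w (S.target lam) with hs
  set N := ∑ i : Fin nN, w (some (Sum.inr i)) + w none with hN
  have hN0 : 0 ≤ N := add_nonneg (Finset.sum_nonneg fun i _ => hw _) (hw _)
  have h1 : δ * l₀ * N ≤ s := by
    have h2 := hslack w hw
    have h3 : l₀ * N ≤ ∑ i, lam i * w (some (Sum.inr i)) + w none := by
      rw [hN, mul_add, Finset.mul_sum]
      refine add_le_add (Finset.sum_le_sum fun i _ => ?_) (mul_le_of_le_one_left (hw _) hl₁)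
      rcases hmin i with h0 | hle
      · rw [hw0 i h0, mul_zero, mul_zero]
      · exact mul_le_mul_of_nonneg_right hle (hw _)
    have h4 := mul_le_mul_of_nonneg_left h3 hδ.le
    rw [hs]
    linarith
  have hdist : ‖w - restrictRT w‖ ≤ N := by
    refine (norm_le_sum_of_nonneg ?_).trans (le_of_eq ?_)
    · rintro (_ | i | i)
      · simpa using hw _
      · simp
      · simpa using hw _
    · rw [Fintype.sum_option, Fintype.sum_sum_type, hN]
      simp [add_comm]
  have h5 : meanSupport S.prob S.outcomes (restrictRT w) -
      inner ℝ (restrictRT w) (S.target lam) ≤ s + C₁ * N := by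
    have h6 := hlip (restrictRT w) w
    rw [norm_sub_rev] at h6
    have h7 := real_inner_le_norm (w - restrictRT w) (S.target lam)
    rw [inner_sub_left] at h7
    have h8 := mul_le_mul_of_nonneg_left hdist hC
    have h9 := mul_le_mul_of_nonneg_right hdist (norm_nonneg (S.target lam))
    rw [hC₁, hs]
    linarith
  have h10 : ‖w - y‖ ≤ N + (s + C₁ * N) / κ := by
    have h11 : ‖restrictRT w - y‖ ≤ (s + C₁ * N) / κ := by
      rw [le_div_iff₀ hκ]; linarith
    have h12 := norm_add_le (w - restrictRT w) (restrictRT w - y)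
    rw [sub_add_sub_cancel] at h12
    linarith
  have h13 : N + (s + C₁ * N) / κ ≤ a * s := by
    have h14 : N ≤ s / (δ * l₀) := by
      rw [le_div_iff₀ (by positivity)]; linarith
    have h15 : (1 + C₁ / κ) * N ≤ (1 + C₁ / κ) * (s / (δ * l₀)) :=
      mul_le_mul_of_nonneg_left h14 (by positivity)
    have e1 : N + (s + C₁ * N) / κ = (1 + C₁ / κ) * N + s / κ := by ring
    have e2 : a * s = (1 + C₁ / κ) * (s / (δ * l₀)) + s / κ := by rw [ha]; ring
    rw [e1, e2]
    linarith
  rw [one_div, inv_mul_le_iff₀ ha0]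
  exact h10.trans h13

/-- Absence of slack forces the nonnegative sum in `exists_slack` to vanish. Consequently the
distance from the cone bounds every NRT queue of positive rate. -/
theorem tightCone_inr_eq_zero {lam : Fin nN → ℝ} {ε : ℝ} (hε : 0 < ε)
    (h : (1 + ε) • lam ∈ S.lambertRegion) {i₀ : Fin nN} (hi₀ : 0 < lam i₀)
    {y : QueueSpace nR nN} (hy : y ∈ S.tightCone lam) : y (some (Sum.inr i₀)) = 0 := by
  have hlam : ∀ i, 0 ≤ lam i := fun i => by
    have := S.nonneg_of_mem_lambertRegion h i
    simp only [Pi.smul_apply, smul_eq_mul] at this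
    exact nonneg_of_mul_nonneg_right this (by linarith)
  obtain ⟨δ, hδ, hslack⟩ := S.exists_slack hε h hi₀
  have h1 := hslack y hy.1
  have h2 : δ * (∑ i, lam i * y (some (Sum.inr i)) + y none) ≤ 0 := by linarith [hy.2]
  have h3 := nonpos_of_mul_nonpos_right h2 hδ
  have h4 : lam i₀ * y (some (Sum.inr i₀)) ≤ ∑ i, lam i * y (some (Sum.inr i)) :=
    Finset.single_le_sum (f := fun i => lam i * y (some (Sum.inr i)))
      (fun i _ => mul_nonneg (hlam i) (hy.1 _)) (Finset.mem_univ i₀)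
  have h5 := hy.1 none
  have h6 : lam i₀ * y (some (Sum.inr i₀)) ≤ 0 := by linarith
  exact le_antisymm (nonpos_of_mul_nonpos_right h6 hi₀) (hy.1 _)

end System

/-! ### Sample paths, laws of large numbers, causal runs of the algorithm -/

/-- A measurable function with finite range stays measurable after any map. -/
theorem measurable_comp_of_finite_range {Ω α β : Type*} {mΩ : MeasurableSpace Ω}
    [MeasurableSpace α] [MeasurableSingletonClass α] [MeasurableSpace β] {f : Ω → α}
    (hf : Measurable f) (hfin : (Set.range f).Finite) (g : α → β) : Measurable fun ω => g (f ω) := by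
  intro s _
  have : (fun ω => g (f ω)) ⁻¹' s = f ⁻¹' (Set.range f ∩ g ⁻¹' s) := by
    ext ω; simp
  rw [this]
  exact hf (hfin.inter_of_left _).measurableSet

/-- Strong law for pairwise independent events of equal probability. -/
theorem ae_tendsto_frequency {Ω : Type*} {mΩ : MeasurableSpace Ω} {Pr : Measure Ω}
    [IsProbabilityMeasure Pr] {s : ℕ → Set Ω} (hs : ∀ k, MeasurableSet (s k)) {p : ℝ}
    (hp : ∀ k, Pr.real (s k) = p)
    (hind : Pairwise fun k l => IndepFun ((s k).indicator fun _ => (1 : ℝ))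
      ((s l).indicator fun _ => (1 : ℝ)) Pr) :
    ∀ᵐ ω ∂Pr, Tendsto
      (fun K : ℕ => (∑ k ∈ Finset.range K, (s k).indicator (fun _ => (1 : ℝ)) ω) / K) atTop
      (𝓝 p) := by
  have hmeas : ∀ k, Measurable ((s k).indicator fun _ => (1 : ℝ)) := fun k =>
    measurable_const.indicator (hs k)
  have hPr : ∀ k, Pr (s k) = Pr (s 0) := fun k => by
    have := (hp k).trans (hp 0).symm
    exact (measureReal_eq_measureReal_iff).1 this
  have hlaw := strong_law_ae_real (μ := Pr) (fun k => (s k).indicator fun _ => (1 : ℝ))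
    ((integrable_const (1 : ℝ)).indicator (hs 0)) hind (fun k => by
      refine ⟨(hmeas k).aemeasurable, (hmeas 0).aemeasurable, ?_⟩
      ext t ht
      rw [Measure.map_apply (hmeas k) ht, Measure.map_apply (hmeas 0) ht]
      classical
      rw [Set.indicator_const_preimage_eq_union, Set.indicator_const_preimage_eq_union]
      split_ifs
      · simp
      · simpa using hPr k
      · simp [measure_compl (hs _), hPr k]
      · simp)
  rw [integral_indicator_const _ (hs 0), hp] at hlaw
  simpa using hlaw

namespace System

variable {nR nN : ℕ} {S : System nR nN}

section Path

variable (S)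

/-- All queues along a sample path. -/
def pathQueue (a : ℕ → User nR nN → ℝ) (g : ℕ → S.State) (μ P : ℕ → User nR nN → ℝ) (k : ℕ) :
    QueueSpace nR nN :=
  queueVec (fun i => S.queue a g μ P i k) (fun i => S.deliveryQueue a μ i k) (S.powerQueue μ P k)

theorem pathQueue_zero (a : ℕ → User nR nN → ℝ) (g : ℕ → S.State) (μ P : ℕ → User nR nN → ℝ) :
    S.pathQueue a g μ P 0 = 0 := by
  ext j
  rcases j with _ | i | i <;> rfl

theorem pathQueue_succ (a : ℕ → User nR nN → ℝ) (g : ℕ → S.State) (μ P : ℕ → User nR nN → ℝ)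
    (k : ℕ) : S.pathQueue a g μ P (k + 1) =
      posVec (S.pathQueue a g μ P k + (S.inflow (a k) - S.outcome (g k) (μ k) (P k))) := by
  ext j
  rw [posVec_apply, PiLp.add_apply, PiLp.sub_apply]
  rcases j with _ | i | i
  · rw [inflow_none, outcome_none]
    change max (S.powerQueue μ P k + (∑ i, P k i * μ k i) / S.Ts - S.Pavg) 0 =
      max (S.powerQueue μ P k + _) 0
    congr 1
    ring
  · rw [inflow_inl, outcome_inl]
    change max (S.deliveryQueue a μ i k + a k (Sum.inl i) * S.q i - _) 0 =
      max (S.deliveryQueue a μ i k + _) 0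
    rw [add_sub_assoc]
  · rw [inflow_inr, outcome_inr]
    change max (S.queue a g μ P i k + S.L * a k (Sum.inr i) - _) 0 =
      max (S.queue a g μ P i k + _) 0
    rw [add_sub_assoc]

theorem pathQueue_nonneg (a : ℕ → User nR nN → ℝ) (g : ℕ → S.State) (μ P : ℕ → User nR nN → ℝ)
    (k : ℕ) (j : Option (User nR nN)) : 0 ≤ S.pathQueue a g μ P k j := by
  cases k with
  | zero => simp [pathQueue_zero]
  | succ k => rw [pathQueue_succ]; exact le_max_right _ _

/-- The queues exceed the accumulated inflow minus the accumulated outcomes. -/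
theorem sum_le_pathQueue (a : ℕ → User nR nN → ℝ) (g : ℕ → S.State) (μ P : ℕ → User nR nN → ℝ)
    (K : ℕ) (j : Option (User nR nN)) :
    ∑ k ∈ Finset.range K, S.inflow (a k) j - ∑ k ∈ Finset.range K, S.outcome (g k) (μ k) (P k) j ≤
      S.pathQueue a g μ P K j := by
  induction K with
  | zero => simp [pathQueue_zero]
  | succ K ih =>
    rw [Finset.sum_range_succ, Finset.sum_range_succ, pathQueue_succ, posVec_apply,
      PiLp.add_apply, PiLp.sub_apply]
    refine le_trans ?_ (le_max_left _ _)
    linarith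

end Path

section Env

variable {Ω : Type*} {mΩ : MeasurableSpace Ω} {Pr : Measure Ω} [IsProbabilityMeasure Pr]
  {ℱ : Filtration ℕ mΩ} {a : ℕ → Ω → User nR nN → ℝ} {γ : ℕ → Ω → S.State} {lam : Fin nN → ℝ}

/-- The events of slot `k`. -/
abbrev currentSigma (a : ℕ → Ω → User nR nN → ℝ) (γ : ℕ → Ω → S.State) (k : ℕ) :
    MeasurableSpace Ω := MeasurableSpace.comap (fun ω => (a k ω, γ k ω)) inferInstance

namespace IsEnvironment

variable (h : S.IsEnvironment lam Pr ℱ a γ)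

include h

theorem arrival_mem (k : ℕ) (ω : Ω) (i : User nR nN) : a k ω i ∈ Set.Icc (0 : ℝ) 1 := by
  rcases h.arrival k ω i with h | h <;> simp [h]

theorem rate_mem (i : Fin nN) : lam i ∈ Set.Icc (0 : ℝ) 1 := by
  rw [← h.rate_NRT 0 i]
  exact ⟨measureReal_nonneg, measureReal_le_one⟩

theorem currentSigma_le_succ (k : ℕ) : currentSigma a γ k ≤ ℱ (k + 1) := (h.meas k).comap_le

theorem currentSigma_le (k : ℕ) : currentSigma a γ k ≤ mΩ :=
  (h.currentSigma_le_succ k).trans (ℱ.le _)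

theorem measurable_current (k : ℕ) :
    Measurable[currentSigma a γ k] (fun ω => (a k ω, γ k ω)) := comap_measurable _

theorem measurable_arrival (k : ℕ) (i : User nR nN) :
    Measurable[currentSigma a γ k] fun ω => a k ω i :=
  ((measurable_pi_apply i).comp measurable_fst).comp (h.measurable_current k)

theorem measurable_state (k : ℕ) : Measurable[currentSigma a γ k] (γ k) :=
  measurable_snd.comp (h.measurable_current k)

theorem measurableSet_arrival (k : ℕ) (i : User nR nN) :
    MeasurableSet[currentSigma a γ k] {ω | a k ω i = 1} :=
  h.measurable_arrival k i (measurableSet_singleton 1)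

theorem measurableSet_state (k : ℕ) (m : S.State) :
    MeasurableSet[currentSigma a γ k] {ω | γ k ω = m} :=
  h.measurable_state k (measurableSet_singleton m)

theorem arrival_eq_indicator (k : ℕ) (i : User nR nN) :
    (fun ω => a k ω i) = {ω | a k ω i = 1}.indicator fun _ => (1 : ℝ) := by
  funext ω
  rcases h.arrival k ω i with h | h <;> simp [h]

theorem prob_arrival (k : ℕ) (i : User nR nN) :
    Pr.real {ω | a k ω i = 1} = Sum.elim S.rateR lam i := by
  rcases i with i | i
  · exact h.rate_RT k i
  · exact h.rate_NRT k i

theorem integral_arrival (k : ℕ) (i : User nR nN) :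
    ∫ ω, a k ω i ∂Pr = Sum.elim S.rateR lam i := by
  rw [h.arrival_eq_indicator k i,
    integral_indicator_const _ (h.currentSigma_le k _ (h.measurableSet_arrival k i)),
    h.prob_arrival, smul_eq_mul, mul_one]

/-- For `k < l`, slot `k` belongs to `ℱ l`, of which slot `l` is independent. -/
theorem pairwise_indepFun {f : ℕ → Ω → ℝ} (hf : ∀ k, Measurable[currentSigma a γ k] (f k)) :
    Pairwise fun k l => IndepFun (f k) (f l) Pr := by
  have key : ∀ k l, k < l → IndepFun (f l) (f k) Pr := by
    intro k l hkl
    rw [IndepFun_iff_Indep]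
    refine indep_of_indep_of_le_left (indep_of_indep_of_le_right (h.indep l) ?_) (hf l).comap_le
    exact (hf k).comap_le.trans ((h.currentSigma_le_succ k).trans (ℱ.mono hkl))
  intro k l hne
  rcases lt_or_gt_of_ne hne with hlt | hlt
  · exact (key k l hlt).symm
  · exact key l k hlt

theorem ae_tendsto_frequency {s : ℕ → Set Ω} (hs : ∀ k, MeasurableSet[currentSigma a γ k] (s k))
    {p : ℝ} (hp : ∀ k, Pr.real (s k) = p) :
    ∀ᵐ ω ∂Pr, Tendsto
      (fun K : ℕ => (∑ k ∈ Finset.range K, (s k).indicator (fun _ => (1 : ℝ)) ω) / K) atTop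
      (𝓝 p) :=
  Downlink.ae_tendsto_frequency (fun k => h.currentSigma_le k _ (hs k)) hp
    (h.pairwise_indepFun fun k => (measurable_const (a := (1 : ℝ))).indicator (hs k))

theorem ae_tendsto_average_arrival (i : User nR nN) :
    ∀ᵐ ω ∂Pr, Tendsto (fun K : ℕ => (∑ k ∈ Finset.range K, a k ω i) / K) atTop
      (𝓝 (Sum.elim S.rateR lam i)) := by
  filter_upwards [h.ae_tendsto_frequency (fun k => h.measurableSet_arrival k i)
    fun k => h.prob_arrival k i] with ω hω
  refine hω.congr fun K => ?_
  congr 1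
  exact Finset.sum_congr rfl fun k _ => (congrFun (h.arrival_eq_indicator k i) ω).symm

theorem ae_tendsto_average_inflow (j : Option (User nR nN)) :
    ∀ᵐ ω ∂Pr, Tendsto (fun K : ℕ => (∑ k ∈ Finset.range K, S.inflow (a k ω) j) / K) atTop
      (𝓝 (S.target lam j)) := by
  rcases j with _ | i | i
  · refine ae_of_all _ fun ω => tendsto_const_nhds.congr' ?_
    filter_upwards [eventually_ge_atTop 1] with K hK
    have : (K : ℝ) ≠ 0 := by positivity
    simp only [inflow_none, target_none, Finset.sum_const, Finset.card_range, nsmul_eq_mul]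
    field_simp
  · filter_upwards [h.ae_tendsto_average_arrival (Sum.inl i)] with ω hω
    refine (hω.mul_const (S.q i)).congr fun K => ?_
    simp only [inflow_inl, ← Finset.sum_mul]
    ring
  · filter_upwards [h.ae_tendsto_average_arrival (Sum.inr i)] with ω hω
    refine (hω.const_mul S.L).congr fun K => ?_
    simp only [inflow_inr, ← Finset.mul_sum]
    ring

theorem ae_tendsto_average_state (f : S.State → ℝ) :
    ∀ᵐ ω ∂Pr, Tendsto (fun K : ℕ => (∑ k ∈ Finset.range K, f (γ k ω)) / K) atTop
      (𝓝 (∑ m, S.prob m * f m)) := by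
  classical
  have h1 : ∀ᵐ ω ∂Pr, ∀ m, Tendsto (fun K : ℕ => (∑ k ∈ Finset.range K,
      {ω | γ k ω = m}.indicator (fun _ => (1 : ℝ)) ω) / K) atTop (𝓝 (S.prob m)) :=
    ae_all_iff.2 fun m => h.ae_tendsto_frequency (fun k => h.measurableSet_state k m)
      fun k => h.state k m
  filter_upwards [h1] with ω hω
  have h2 := tendsto_finsetSum Finset.univ fun m _ => (hω m).mul_const (f m)
  refine h2.congr fun K => ?_
  simp only [div_mul_eq_mul_div, Finset.sum_mul, ← Finset.sum_div]
  congr 1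
  rw [Finset.sum_comm]
  refine Finset.sum_congr rfl fun k _ => ?_
  simp [Set.indicator_apply]

/-- The algorithm can be run causally. -/
theorem exists_policy (hN : 0 < nN) : ∃ μ P : ℕ → Ω → User nR nN → ℝ,
    IsCausal ℱ μ P ∧ S.FollowsLambertStrict a γ μ P := by
  classical
  have hsel : ∀ (v : QueueSpace nR nN) (m : S.State), ∃ μ P : User nR nN → ℝ, (∀ j, 0 ≤ v j) →
      S.IsLambertStrict (fun i => v (some (Sum.inr i))) (fun i => v (some (Sum.inl i))) (v none)
        m μ P := by
    intro v m
    by_cases hv : ∀ j, 0 ≤ v j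
    · obtain ⟨μ, P, hs⟩ := exists_isLambertStrict (S := S) (X := v none)
        (Y := fun i => v (some (Sum.inl i))) hN (hv _) (fun i => hv (some (Sum.inr i))) m
      exact ⟨μ, P, fun _ => hs⟩
    · exact ⟨0, 0, fun hv' => absurd hv' hv⟩
  choose selμ selP hselect using hsel
  let next : QueueSpace nR nN × ((User nR nN → ℝ) × S.State) → QueueSpace nR nN := fun x =>
    posVec (x.1 + (S.inflow x.2.1 - S.outcome x.2.2 (selμ x.1 x.2.2) (selP x.1 x.2.2)))
  let w : ℕ → Ω → QueueSpace nR nN := fun k =>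
    Nat.rec (fun _ => 0) (fun k v ω => next (v ω, (a k ω, γ k ω))) k
  have hw0 : ∀ ω, w 0 ω = 0 := fun _ => rfl
  have hws : ∀ k ω, w (k + 1) ω = next (w k ω, (a k ω, γ k ω)) := fun _ _ => rfl
  -- At each time the queues take only finitely many values, so the selections `selμ`, `selP`,
  -- arbitrary choice functions, cause no measurability problem.
  have hfin : ∀ k, (Set.range fun ω => (a k ω, γ k ω)).Finite := by
    intro k
    have h1 : ({f : User nR nN → ℝ | ∀ i, f i ∈ ({0, 1} : Set ℝ)}).Finite :=
      Set.Finite.pi' fun _ => Set.toFinite _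
    refine (h1.prod (Set.finite_univ (α := S.State))).subset ?_
    rintro _ ⟨ω, rfl⟩
    exact ⟨fun i => by simpa using h.arrival k ω i, trivial⟩
  have hpair : ∀ k, Measurable[ℱ k] (w k) → (Set.range (w k)).Finite →
      Measurable[ℱ (k + 1)] (fun ω => (w k ω, (a k ω, γ k ω))) ∧
      (Set.range fun ω => (w k ω, (a k ω, γ k ω))).Finite := by
    intro k hm hf
    refine ⟨(hm.mono (ℱ.mono k.le_succ) le_rfl).prodMk (h.meas k), ?_⟩
    refine (hf.prod (hfin k)).subset ?_
    rintro _ ⟨ω, rfl⟩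
    exact ⟨⟨ω, rfl⟩, ⟨ω, rfl⟩⟩
  have hw : ∀ k, Measurable[ℱ k] (w k) ∧ (Set.range (w k)).Finite := by
    intro k
    induction k with
    | zero =>
      refine ⟨measurable_const, (Set.finite_singleton (0 : QueueSpace nR nN)).subset ?_⟩
      rintro _ ⟨ω, rfl⟩
      exact hw0 ω
    | succ k ih =>
      obtain ⟨hm, hf⟩ := hpair k ih.1 ih.2
      refine ⟨measurable_comp_of_finite_range hm hf next, (hf.image next).subset ?_⟩
      rintro _ ⟨ω, rfl⟩
      exact ⟨_, ⟨ω, rfl⟩, (hws k ω).symm⟩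
  set μ : ℕ → Ω → User nR nN → ℝ := fun k ω => selμ (w k ω) (γ k ω) with hμ
  set P : ℕ → Ω → User nR nN → ℝ := fun k ω => selP (w k ω) (γ k ω) with hP
  have hwq : ∀ k ω, w k ω =
      S.pathQueue (fun l => a l ω) (fun l => γ l ω) (fun l => μ l ω) (fun l => P l ω) k := by
    intro k ω
    induction k with
    | zero => rw [hw0, pathQueue_zero]
    | succ k ih => rw [hws, pathQueue_succ, ← ih]
  refine ⟨μ, P, fun k => ?_, fun k ω => ?_⟩
  · obtain ⟨hm, hf⟩ := hpair k (hw k).1 (hw k).2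
    exact ⟨measurable_comp_of_finite_range hm hf fun x => selμ x.1 x.2.2,
      measurable_comp_of_finite_range hm hf fun x => selP x.1 x.2.2⟩
  · have h1 := hselect (w k ω) (γ k ω) (by rw [hwq]; exact S.pathQueue_nonneg _ _ _ _ k)
    have h2 := hwq k ω
    have e : ∀ v, v = S.pathQueue (fun l => a l ω) (fun l => γ l ω) (fun l => μ l ω)
        (fun l => P l ω) k → S.IsLambertStrict (fun i => v (some (Sum.inr i)))
          (fun i => v (some (Sum.inl i))) (v none) (γ k ω) (μ k ω) (P k ω) →
        S.IsLambertStrict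
          (fun i => S.queue (fun l => a l ω) (fun l => γ l ω) (fun l => μ l ω) (fun l => P l ω) i k)
          (fun i => S.deliveryQueue (fun l => a l ω) (fun l => μ l ω) i k)
          (S.powerQueue (fun l => μ l ω) (fun l => P l ω) k) (γ k ω) (μ k ω) (P k ω) := by
      rintro _ rfl hv
      exact hv
    exact e _ h2 h1

end IsEnvironment

end Env

end System

/-! ### Achievability -/

namespace System

variable {nR nN : ℕ} {S : System nR nN} {Ω : Type*} {mΩ : MeasurableSpace Ω} {Pr : Measure Ω}
  [IsProbabilityMeasure Pr] {ℱ : Filtration ℕ mΩ} {a : ℕ → Ω → User nR nN → ℝ}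
  {γ : ℕ → Ω → S.State} {lam : Fin nN → ℝ} {μ P : ℕ → Ω → User nR nN → ℝ}

theorem measurable_outcome {m₀ : MeasurableSpace Ω} {s : Ω → S.State} {u p : Ω → User nR nN → ℝ}
    (hs : Measurable[m₀] s) (hu : Measurable[m₀] u) (hp : Measurable[m₀] p)
    (j : Option (User nR nN)) : Measurable[m₀] fun ω => S.outcome (s ω) (u ω) (p ω) j := by
  have hui : ∀ i, Measurable[m₀] fun ω => u ω i := fun i => (measurable_pi_apply i).comp hu
  have hpi : ∀ i, Measurable[m₀] fun ω => p ω i := fun i => (measurable_pi_apply i).comp hp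
  rcases j with _ | i | i
  · simp only [outcome_none]
    exact ((Finset.measurable_sum _ fun i _ => (hpi i).mul (hui i)).div_const _).neg
  · simp only [outcome_inl]
    exact Measurable.ite (hui _ (measurableSet_singleton 0)) measurable_const measurable_const
  · simp only [outcome_inr, rate]
    have hsi : Measurable[m₀] fun ω => (s ω (Sum.inr i) : ℝ) :=
      measurable_subtype_coe.comp ((measurable_pi_apply (Sum.inr i)).comp hs)
    exact (hui _).mul (Real.measurable_log.comp (measurable_const.add ((hpi _).mul hsi)))

theorem measurable_queueSpace {m₀ : MeasurableSpace Ω} {f : Ω → QueueSpace nR nN}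
    (h : ∀ j, Measurable[m₀] fun ω => f ω j) : Measurable[m₀] f := by
  have : Measurable[m₀] fun ω => (fun j => f ω j : Option (User nR nN) → ℝ) :=
    measurable_pi_lambda _ h
  exact (WithLp.measurable_toLp 2 (Option (User nR nN) → ℝ)).comp this

theorem measurable_inflow {m₀ : MeasurableSpace Ω} {s : Ω → User nR nN → ℝ}
    (hs : ∀ i, Measurable[m₀] fun ω => s ω i) (j : Option (User nR nN)) :
    Measurable[m₀] fun ω => S.inflow (s ω) j := by
  rcases j with _ | i | i
  · exact measurable_const
  · exact (hs _).mul_const _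
  · exact (hs _).const_mul _

variable (S) in
/-- The queues as random vectors. -/
def randomQueue (a : ℕ → Ω → User nR nN → ℝ) (γ : ℕ → Ω → S.State)
    (μ P : ℕ → Ω → User nR nN → ℝ) (k : ℕ) (ω : Ω) : QueueSpace nR nN :=
  S.pathQueue (fun l => a l ω) (fun l => γ l ω) (fun l => μ l ω) (fun l => P l ω) k

theorem measurable_randomQueue {m₀ : ℕ → MeasurableSpace Ω} (hmono : ∀ k, m₀ k ≤ m₀ (k + 1))
    (ha : ∀ k i, Measurable[m₀ (k + 1)] fun ω => a k ω i)
    (hγ : ∀ k, Measurable[m₀ (k + 1)] (γ k)) (hμ : ∀ k, Measurable[m₀ (k + 1)] (μ k))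
    (hP : ∀ k, Measurable[m₀ (k + 1)] (P k)) (k : ℕ) :
    Measurable[m₀ k] (S.randomQueue a γ μ P k) := by
  induction k with
  | zero =>
    have : S.randomQueue a γ μ P 0 = fun _ => 0 := by
      funext ω; exact S.pathQueue_zero _ _ _ _
    rw [this]
    exact measurable_const
  | succ k ih =>
    refine measurable_queueSpace fun j => ?_
    have e : (fun ω => S.randomQueue a γ μ P (k + 1) ω j) = fun ω =>
        max (S.randomQueue a γ μ P k ω j + (S.inflow (a k ω) j -
          S.outcome (γ k ω) (μ k ω) (P k ω) j)) 0 := by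
      funext ω
      simp only [randomQueue]
      rw [S.pathQueue_succ, posVec_apply, PiLp.add_apply, PiLp.sub_apply]
    rw [e]
    have h1 : Measurable[m₀ (k + 1)] fun ω => S.randomQueue a γ μ P k ω j := by
      have h2 := ih.mono (hmono k) le_rfl
      exact (measurable_pi_apply j).comp
        ((WithLp.measurable_ofLp 2 (Option (User nR nN) → ℝ)).comp h2)
    exact (h1.add ((measurable_inflow (ha k) j).sub
      (measurable_outcome (hγ k) (hμ k) (hP k) j))).max measurable_const

theorem IsEnvironment.target_eq_integral (h : S.IsEnvironment lam Pr ℱ a γ) (k : ℕ)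
    (j : Option (User nR nN)) : ∫ ω, S.inflow (a k ω) j ∂Pr = S.target lam j := by
  rcases j with _ | i | i
  · simp
  · simp only [inflow_inl, target_inl]
    rw [integral_mul_const, h.integral_arrival, Sum.elim_inl]
  · simp only [inflow_inr, target_inr]
    rw [integral_const_mul, h.integral_arrival, Sum.elim_inr]

theorem FollowsLambertStrict.optimal (h : S.FollowsLambertStrict a γ μ P) (k : ℕ) (ω : Ω) :
    S.IsSlotAllocation (γ k ω) (μ k ω) (P k ω) ∧ ∑ i, μ k ω i = S.Ts ∧
      ∀ o ∈ S.outcomes (γ k ω), inner ℝ (S.randomQueue a γ μ P k ω) o ≤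
        inner ℝ (S.randomQueue a γ μ P k ω) (S.outcome (γ k ω) (μ k ω) (P k ω)) := by
  have hnn := S.pathQueue_nonneg (fun l => a l ω) (fun l => γ l ω) (fun l => μ l ω)
    (fun l => P l ω) k
  exact (h k ω).optimal (hnn none) fun i => hnn (some (Sum.inr i))

/-- The algorithm runs a max-weight process. -/
theorem FollowsLambertStrict.exists_isMaxWeight (henv : S.IsEnvironment lam Pr ℱ a γ)
    (hc : IsCausal ℱ μ P) (h : S.FollowsLambertStrict a γ μ P) :
    ∃ C : ℝ, IsMaxWeight Pr (fun k => ℱ k) (currentSigma a γ) S.outcomes S.prob (S.target lam) C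
      (S.randomQueue a γ μ P) (fun k ω => S.inflow (a k ω))
      (fun k ω => S.outcome (γ k ω) (μ k ω) (P k ω)) γ := by
  obtain ⟨C, hC, hC'⟩ := S.exists_norm_bound
  refine ⟨C, ?_⟩
  exact
    { zero := fun ω => S.pathQueue_zero _ _ _ _
      succ := fun k ω => S.pathQueue_succ _ _ _ _ k
      past_le := fun k => ℱ.le k
      current_le := henv.currentSigma_le
      indep := henv.indep
      meas := measurable_randomQueue (m₀ := fun k => ℱ k) (fun k => ℱ.mono k.le_succ)
        (fun k i => (henv.measurable_arrival k i).mono (henv.currentSigma_le_succ k) le_rfl)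
        (fun k => (henv.measurable_state k).mono (henv.currentSigma_le_succ k) le_rfl)
        (fun k => (hc k).1) (fun k => (hc k).2)
      meas_arrival := fun k j => measurable_inflow (henv.measurable_arrival k) j
      meas_state := henv.measurableSet_state
      mean_arrival := henv.target_eq_integral
      prob_state := henv.state
      nonempty := S.outcomes_nonempty
      bound := hC
      bound_arrival := fun k ω => hC' _ (henv.arrival_mem k ω)
      mem := fun k ω => ⟨_, _, (h.optimal k ω).1, rfl⟩
      optimal := fun k ω => (h.optimal k ω).2.2 }

/-- At rate zero there are almost surely no arrivals, and service only drains. These queues are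
treated separately because enlarging `lam` gives them no slack. -/
theorem IsEnvironment.ae_queue_eq_zero (henv : S.IsEnvironment lam Pr ℱ a γ)
    (hall : ∀ k ω, S.IsSlotAllocation (γ k ω) (μ k ω) (P k ω)) {i : Fin nN} (hi : lam i = 0) :
    ∀ᵐ ω ∂Pr, ∀ k, S.randomQueue a γ μ P k ω (some (Sum.inr i)) = 0 := by
  have h1 : ∀ᵐ ω ∂Pr, ∀ k, a k ω (Sum.inr i) = 0 := by
    refine ae_all_iff.2 fun k => ?_
    have h2 : Pr {ω | a k ω (Sum.inr i) = 1} = 0 := by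
      rw [← measureReal_eq_zero_iff, henv.rate_NRT, hi]
    have h3 : ∀ᵐ ω ∂Pr, a k ω (Sum.inr i) ≠ 1 := by
      rw [ae_iff]; simpa using h2
    filter_upwards [h3] with ω hω
    exact (henv.arrival k ω _).resolve_right hω
  filter_upwards [h1] with ω hω k
  induction k with
  | zero => simp [randomQueue, pathQueue_zero]
  | succ k ih =>
    rw [randomQueue] at ih ⊢
    rw [S.pathQueue_succ, posVec_apply, PiLp.add_apply, ih, PiLp.sub_apply, inflow_inr, hω k,
      outcome_inr]
    have := (hall k ω).service_nonneg (Sum.inr i)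
    simpa using this

/-- The target increases with the NRT rates and `v ≥ 0`. Unlike `exists_slack`, this covers `lam =
0`. -/
theorem inner_target_le_of_scaled {ε : ℝ} (hε : 0 < ε) (hmem : (1 + ε) • lam ∈ S.lambertRegion)
    {v : QueueSpace nR nN} (hv : ∀ j, 0 ≤ v j) :
    inner ℝ v (S.target lam) ≤ meanSupport S.prob S.outcomes v := by
  refine le_trans ?_ (S.inner_target_le_of_mem hmem hv)
  rw [inner_euclidean, inner_euclidean]
  refine Finset.sum_le_sum fun j _ => mul_le_mul_of_nonneg_left ?_ (hv j)
  rcases j with _ | i | i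
  · simp
  · simp
  · simp only [target_inr, Pi.smul_apply, smul_eq_mul]
    refine mul_le_mul_of_nonneg_left ?_ S.L_pos.le
    have := S.nonneg_of_mem_lambertRegion hmem i
    simp only [Pi.smul_apply, smul_eq_mul] at this
    have : 0 ≤ lam i := nonneg_of_mul_nonneg_right this (by linarith)
    nlinarith

theorem sum_average_sub_le (a' : ℕ → User nR nN → ℝ) (g' : ℕ → S.State)
    (μ' P' : ℕ → User nR nN → ℝ) (K : ℕ) (j : Option (User nR nN)) :
    (∑ k ∈ Finset.range K, S.inflow (a' k) j) / K - S.pathQueue a' g' μ' P' K j / K ≤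
      (∑ k ∈ Finset.range K, S.outcome (g' k) (μ' k) (P' k) j) / K := by
  rw [← sub_div]
  have := S.sum_le_pathQueue a' g' μ' P' K j
  gcongr
  linarith

/-- Stability of an NRT queue with positive rate. -/
theorem FollowsLambertStrict.exists_integral_queue_le (henv : S.IsEnvironment lam Pr ℱ a γ)
    (hc : IsCausal ℱ μ P) (h : S.FollowsLambertStrict a γ μ P) {ε : ℝ} (hε : 0 < ε)
    (hmem : (1 + ε) • lam ∈ S.lambertRegion) {i : Fin nN} (hi : 0 < lam i) :
    ∃ B : ℝ, ∀ k, ∫⁻ ω, ENNReal.ofReal (S.randomQueue a γ μ P k ω (some (Sum.inr i))) ∂Pr ≤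
      ENNReal.ofReal B := by
  obtain ⟨C, hMW⟩ := h.exists_isMaxWeight henv hc
  obtain ⟨κ, hκ, hslack⟩ := S.exists_slack_dist hε hmem hi
  have hzero : ∀ᵐ ω ∂Pr, ∀ i', lam i' = 0 → ∀ k,
      S.randomQueue a γ μ P k ω (some (Sum.inr i')) = 0 := by
    refine ae_all_iff.2 fun i' => ?_
    by_cases h0 : lam i' = 0
    · filter_upwards [henv.ae_queue_eq_zero (fun k ω => (h.optimal k ω).1) h0] with ω hω _
      exact hω
    · exact ae_of_all _ fun ω h1 => absurd h1 h0
  obtain ⟨p, hp, hint, B, hB⟩ := hMW.exists_integral_norm_sub_le (S.isClosed_tightCone lam)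
    (S.convex_tightCone lam) (S.zero_mem_tightCone lam) (fun y hy => hy.1) (fun y hy => hy.2) hκ
    fun k => by
      filter_upwards [hzero] with ω hω
      exact hslack _ (hMW.nonneg k ω) fun i' hi' => hω i' hi' k
  refine ⟨B, fun k => ?_⟩
  calc ∫⁻ ω, ENNReal.ofReal (S.randomQueue a γ μ P k ω (some (Sum.inr i))) ∂Pr
      ≤ ∫⁻ ω, ENNReal.ofReal ‖S.randomQueue a γ μ P k ω - p (S.randomQueue a γ μ P k ω)‖ ∂Pr := by
        refine lintegral_mono fun ω => ENNReal.ofReal_le_ofReal ?_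
        have h1 := abs_coord_le_norm (S.randomQueue a γ μ P k ω - p (S.randomQueue a γ μ P k ω))
          (some (Sum.inr i))
        -- The projection has coordinate 0 at user `i`, so the queue is at most the distance from
        -- the cone.
        rw [PiLp.sub_apply, S.tightCone_inr_eq_zero hε hmem hi (hp _), sub_zero] at h1
        exact (le_abs_self _).trans h1
    _ = ENNReal.ofReal (∫ ω, ‖S.randomQueue a γ μ P k ω - p (S.randomQueue a γ μ P k ω)‖ ∂Pr) :=
        (ofReal_integral_eq_lintegral_ofReal (hint k) (ae_of_all _ fun _ => norm_nonneg _)).symm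
    _ ≤ ENNReal.ofReal B := ENNReal.ofReal_le_ofReal (hB k)

/-- Achievability. -/
theorem FollowsLambertStrict.meetsConstraints (henv : S.IsEnvironment lam Pr ℱ a γ)
    (hc : IsCausal ℱ μ P) (h : S.FollowsLambertStrict a γ μ P) {ε : ℝ} (hε : 0 < ε)
    (hmem : (1 + ε) • lam ∈ S.lambertRegion) : S.MeetsConstraints Pr a γ μ P := by
  obtain ⟨C, hMW⟩ := h.exists_isMaxWeight henv hc
  have hlim := hMW.ae_tendsto_div fun v hv => inner_target_le_of_scaled hε hmem hv
  have hall := fun k ω => (h.optimal k ω).1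
  have hbound : ∀ ω k j, |S.outcome (γ k ω) (μ k ω) (P k ω) j| ≤
      1 + S.Pmax + S.gainSum * (S.Pmax * S.Ts) := fun ω k j => (hall k ω).abs_outcome_le j
  have hout : ∀ j, ∀ᵐ ω ∂Pr, S.target lam j ≤ liminf (fun K : ℕ =>
      (∑ k ∈ Finset.range K, S.outcome (γ k ω) (μ k ω) (P k ω) j) / K) atTop := by
    intro j
    filter_upwards [hlim, henv.ae_tendsto_average_inflow j] with ω h1 h2
    have h3 := h2.sub (h1 j)
    rw [sub_zero] at h3
    exact le_liminf_of_tendsto (abs_average_le fun k => hbound ω k j) h3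
      (Eventually.of_forall fun K => sum_average_sub_le _ _ _ _ K j)
  refine ⟨hall, fun k ω => (h.optimal k ω).2.1, fun i => ?_, fun i => ?_, ?_⟩
  · have hnn := (henv.rate_mem i).1
    rcases hnn.lt_or_eq with hpos | h0
    · obtain ⟨B, hB⟩ := h.exists_integral_queue_le henv hc hε hmem hpos
      refine lt_of_le_of_lt ?_ (ENNReal.ofReal_lt_top (r := B))
      exact limsup_le_of_le (by isBoundedDefault) (Eventually.of_forall hB)
    · have hz := henv.ae_queue_eq_zero (μ := μ) (P := P) hall h0.symm
      have : ∀ k, ∫⁻ ω, ENNReal.ofReal (S.queue (fun l => a l ω) (fun l => γ l ω)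
          (fun l => μ l ω) (fun l => P l ω) i k) ∂Pr = 0 := by
        intro k
        rw [← lintegral_zero (μ := Pr)]
        refine lintegral_congr_ae ?_
        filter_upwards [hz] with ω hω
        have h1 : S.queue (fun l => a l ω) (fun l => γ l ω) (fun l => μ l ω) (fun l => P l ω) i k
            = 0 := hω k
        rw [h1, ENNReal.ofReal_zero]
      simp [this]
  · filter_upwards [hout (some (Sum.inl i))] with ω hω
    rw [target_inl, mul_comm] at hω
    convert hω using 2
    funext K
    have hL := S.L_pos.ne'
    rw [Finset.sum_congr rfl fun k _ => (hall k ω).service_eq i, ← Finset.mul_sum,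
      mul_div_mul_left _ _ hL]
    simp
  · filter_upwards [hlim, henv.ae_tendsto_average_inflow none] with ω h1 h2
    have h3 := (h2.sub (h1 none)).neg
    rw [sub_zero, target_none, neg_neg] at h3
    have e : ∀ K : ℕ, (∑ k ∈ Finset.range K, ∑ i, P k ω i * μ k ω i) / (K * S.Ts) =
        (∑ k ∈ Finset.range K, -S.outcome (γ k ω) (μ k ω) (P k ω) none) / K := by
      intro K
      simp only [outcome_none, neg_neg]
      rw [← Finset.sum_div, div_div, mul_comm]
    simp only [e]
    refine limsup_le_of_tendsto (abs_average_le fun k => by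
      rw [abs_neg]; exact hbound ω k none) h3 (Eventually.of_forall fun K => ?_)
    have h4 := sum_average_sub_le (fun l => a l ω) (fun l => γ l ω) (fun l => μ l ω)
      (fun l => P l ω) K none
    rw [Finset.sum_neg_distrib, neg_div]
    simp only [randomQueue]
    linarith

end System

/-! ### Converse -/

namespace System

variable {nR nN : ℕ} {S : System nR nN}

section Converse

variable {Ω : Type*} {mΩ : MeasurableSpace Ω} {Pr : Measure Ω}
  [IsProbabilityMeasure Pr] {ℱ : Filtration ℕ mΩ} {a : ℕ → Ω → User nR nN → ℝ}
  {γ : ℕ → Ω → S.State} {lam : Fin nN → ℝ} {μ P : ℕ → Ω → User nR nN → ℝ}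

/-- Stable queues are infinitely often small compared to time. -/
theorem MeetsConstraints.ae_frequently_small (henv : S.IsEnvironment lam Pr ℱ a γ)
    (hm : ∀ k, Measurable (μ k) ∧ Measurable (P k)) (h : S.MeetsConstraints Pr a γ μ P) :
    ∀ᵐ ω ∂Pr, ∀ e : ℝ, 0 < e → ∃ᶠ K : ℕ in atTop, ∀ i : Fin nN,
      S.randomQueue a γ μ P K ω (some (Sum.inr i)) / K ≤ e := by
  have hmeas : ∀ k (i : Fin nN), Measurable fun ω =>
      S.randomQueue a γ μ P k ω (some (Sum.inr i)) := by
    intro k i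
    have h1 : Measurable (S.randomQueue a γ μ P k) :=
      measurable_randomQueue (m₀ := fun _ => mΩ) (fun _ => le_rfl)
        (fun k i => (henv.measurable_arrival k i).mono (henv.currentSigma_le k) le_rfl)
        (fun k => (henv.measurable_state k).mono (henv.currentSigma_le k) le_rfl)
        (fun k => (hm k).1) (fun k => (hm k).2) k
    exact (measurable_pi_apply _).comp
      ((WithLp.measurable_ofLp 2 (Option (User nR nN) → ℝ)).comp h1)
  have hnn : ∀ k ω j, 0 ≤ S.randomQueue a γ μ P k ω j := fun k ω j =>
    S.pathQueue_nonneg _ _ _ _ k j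
  set f : ℕ → Ω → ENNReal := fun K ω =>
    ∑ i : Fin nN, ENNReal.ofReal (S.randomQueue a γ μ P K ω (some (Sum.inr i))) * (K : ENNReal)⁻¹
    with hf
  have hfm : ∀ K, Measurable (f K) := fun K =>
    Finset.measurable_sum _ fun i _ => (hmeas K i).ennreal_ofReal.mul_const _
  have hint : Tendsto (fun K => ∫⁻ ω, f K ω ∂Pr) atTop (𝓝 0) := by
    have h1 : ∀ K, ∫⁻ ω, f K ω ∂Pr = ∑ i : Fin nN, (∫⁻ ω, ENNReal.ofReal
        (S.randomQueue a γ μ P K ω (some (Sum.inr i))) ∂Pr) * (K : ENNReal)⁻¹ := by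
      intro K
      rw [hf, lintegral_finsetSum _ fun i _ => (hmeas K i).ennreal_ofReal.mul_const _]
      exact Finset.sum_congr rfl fun i _ => lintegral_mul_const _ (hmeas K i).ennreal_ofReal
    simp only [h1]
    rw [show (0 : ENNReal) = ∑ i : Fin nN, 0 by simp]
    refine tendsto_finsetSum _ fun i _ => ?_
    obtain ⟨B, hB1, hB2⟩ := exists_between (h.stable i)
    have h2 : ∀ᶠ K in atTop, ∫⁻ ω, ENNReal.ofReal
        (S.randomQueue a γ μ P K ω (some (Sum.inr i))) ∂Pr ≤ B :=
      (eventually_lt_of_limsup_lt hB1).mono fun K hK => hK.le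
    have h3 : Tendsto (fun K : ℕ => B * (K : ENNReal)⁻¹) atTop (𝓝 0) := by
      have := ENNReal.Tendsto.const_mul ENNReal.tendsto_inv_nat_nhds_zero
        (Or.inr hB2.ne) (a := B)
      simpa using this
    refine tendsto_of_tendsto_of_tendsto_of_le_of_le' tendsto_const_nhds h3
      (Eventually.of_forall fun _ => zero_le) ?_
    filter_upwards [h2] with K hK
    gcongr
  -- Fatou's lemma. Bounded means need not force `Q / K → 0` almost surely, but small values at
  -- infinitely many `K` are enough. Summing over the users makes all queues small at the same `K`.
  have hlim : ∀ᵐ ω ∂Pr, liminf (fun K => f K ω) atTop = 0 := by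
    have h1 := lintegral_liminf_le (μ := Pr) (u := atTop) hfm
    rw [hint.liminf_eq] at h1
    exact (lintegral_eq_zero_iff (Measurable.liminf hfm)).1 (le_antisymm h1 (zero_le))
  filter_upwards [hlim] with ω hω e he
  have h1 : liminf (fun K => f K ω) atTop < ENNReal.ofReal e := by
    rw [hω]; simpa using he
  refine ((frequently_lt_of_liminf_lt (by isBoundedDefault) h1).and_eventually
    (eventually_ge_atTop 1)).mono fun K ⟨hK, hK1⟩ i => ?_
  have hK0 : (0 : ℝ) < K := by exact_mod_cast hK1
  have h2 : ENNReal.ofReal (S.randomQueue a γ μ P K ω (some (Sum.inr i))) * (K : ENNReal)⁻¹ ≤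
      ENNReal.ofReal e :=
    (Finset.single_le_sum (f := fun i : Fin nN => ENNReal.ofReal
      (S.randomQueue a γ μ P K ω (some (Sum.inr i))) * (K : ENNReal)⁻¹)
      (fun _ _ => zero_le) (Finset.mem_univ i)).trans hK.le
  have h3 : ENNReal.ofReal (S.randomQueue a γ μ P K ω (some (Sum.inr i)) / K) ≤
      ENNReal.ofReal e := by
    rw [ENNReal.ofReal_div_of_pos hK0, ENNReal.ofReal_natCast, div_eq_mul_inv]
    exact h2
  exact (ENNReal.ofReal_le_ofReal_iff he.le).1 h3

/-- Converse: rates for which the constraints can be met lie in the region. -/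
theorem MeetsConstraints.mem_lambertRegion (henv : S.IsEnvironment lam Pr ℱ a γ)
    (hm : ∀ k, Measurable (μ k) ∧ Measurable (P k)) (h : S.MeetsConstraints Pr a γ μ P) :
    lam ∈ S.lambertRegion := by
  refine S.mem_lambertRegion_of_support (fun i => (henv.rate_mem i).1) fun v hv => ?_
  obtain ⟨C, hC, -⟩ := S.exists_norm_bound
  -- A single path on which all almost sure statements hold suffices, since the conclusion is
  -- deterministic.
  obtain ⟨ω, hsmall, hinflow, hstate, hdel, hpow⟩ :=
    ((h.ae_frequently_small henv hm).and ((ae_all_iff.2 henv.ae_tendsto_average_inflow).and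
      ((henv.ae_tendsto_average_state fun m => support (S.outcomes m) v).and
        ((ae_all_iff.2 h.delivery).and h.avg_power)))).exists
  have hall := fun k => h.allocation k ω
  have hbound : ∀ k j, |S.outcome (γ k ω) (μ k ω) (P k ω) j| ≤
      1 + S.Pmax + S.gainSum * (S.Pmax * S.Ts) := fun k j => (hall k).abs_outcome_le j
  set x : ℕ → Option (User nR nN) → ℝ := fun K j =>
    (∑ k ∈ Finset.range K, S.outcome (γ k ω) (μ k ω) (P k ω) j) / K with hx
  refine le_of_forall_pos_le_add fun e he => ?_
  have hs : 0 ≤ ∑ j, v j := Finset.sum_nonneg fun j _ => hv j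
  set e' := e / (∑ j, v j + 1) with he'
  have he'0 : 0 < e' := by positivity
  have hRT : ∀ i : Fin nR, ∀ᶠ K in atTop,
      S.target lam (some (Sum.inl i)) - e' ≤ x K (some (Sum.inl i)) := by
    intro i
    have h1 : S.target lam (some (Sum.inl i)) ≤
        liminf (fun K => x K (some (Sum.inl i))) atTop := by
      rw [target_inl, mul_comm]
      convert hdel i using 2
      funext K
      rw [Finset.sum_congr rfl fun k _ => (hall k).service_eq i, ← Finset.mul_sum,
        mul_div_mul_left _ _ S.L_pos.ne']
      simp [hx]
    exact eventually_sub_le_of_le_liminf (abs_average_le fun k => hbound k _) h1 he'0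
  have hPow : ∀ᶠ K in atTop, S.target lam none - e' ≤ x K none := by
    have e1 : ∀ K : ℕ, (∑ k ∈ Finset.range K, ∑ i, P k ω i * μ k ω i) / (K * S.Ts) =
        (∑ k ∈ Finset.range K, -S.outcome (γ k ω) (μ k ω) (P k ω) none) / K := by
      intro K
      simp only [outcome_none, neg_neg]
      rw [← Finset.sum_div, div_div, mul_comm]
    simp only [e1] at hpow
    filter_upwards [eventually_le_add_of_limsup_le (abs_average_le fun k => by
      rw [abs_neg]; exact hbound k none) hpow he'0] with K hK
    rw [Finset.sum_neg_distrib, neg_div] at hK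
    simp only [hx, target_none]
    linarith
  have hNRT : ∀ᶠ K in atTop, ∀ i : Fin nN, S.target lam (some (Sum.inr i)) - e' / 2 ≤
      (∑ k ∈ Finset.range K, S.inflow (a k ω) (some (Sum.inr i))) / K :=
    eventually_all.2 fun i => ((hinflow _).eventually
      (lt_mem_nhds (sub_lt_self _ (half_pos he'0)))).mono fun K hK => hK.le
  have hst : ∀ᶠ K : ℕ in atTop, (∑ k ∈ Finset.range K, support (S.outcomes (γ k ω)) v) / K ≤
      meanSupport S.prob S.outcomes v + e' :=
    (hstate.eventually (gt_mem_nhds (lt_add_of_pos_right _ he'0))).mono fun K hK => hK.le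
  -- One time `K` serves all coordinates: in the NRT ones the error `e'` is half fluctuation of the
  -- arrivals and half queue. The averaged support costs another `e'`, which the `+ 1` in the
  -- definition of `e'` provides for.
  obtain ⟨K, hK1, ⟨hK2, hK3, hK4, hK5⟩⟩ := ((hsmall (e' / 2) (half_pos he'0)).and_eventually
    ((eventually_all.2 hRT).and (hPow.and (hNRT.and hst)))).exists
  have hxK : ∀ j, S.target lam j - e' ≤ x K j := by
    rintro (_ | i | i)
    · exact hK3
    · exact hK2 i
    · have h1 := sum_average_sub_le (S := S) (fun l => a l ω) (fun l => γ l ω) (fun l => μ l ω)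
        (fun l => P l ω) K (some (Sum.inr i))
      have h2 := hK1 i
      have h3 := hK4 i
      simp only [randomQueue] at h2
      simp only [hx]
      linarith
  have h1 : ∑ j, v j * x K j ≤ (∑ k ∈ Finset.range K, support (S.outcomes (γ k ω)) v) / K := by
    have e1 : ∑ j, v j * x K j =
        (∑ k ∈ Finset.range K, inner ℝ v (S.outcome (γ k ω) (μ k ω) (P k ω))) / K := by
      simp only [inner_euclidean, hx, mul_div_assoc', Finset.mul_sum]
      rw [← Finset.sum_div, Finset.sum_comm]
    rw [e1]
    gcongr with k
    exact inner_le_support (hC _) v ⟨_, _, hall k, rfl⟩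
  have h2 : ∑ j, v j * (S.target lam j - e') ≤ ∑ j, v j * x K j :=
    Finset.sum_le_sum fun j _ => mul_le_mul_of_nonneg_left (hxK j) (hv j)
  have h3 : ∑ j, v j * (S.target lam j - e') = inner ℝ v (S.target lam) - e' * ∑ j, v j := by
    rw [inner_euclidean, Finset.mul_sum, ← Finset.sum_sub_distrib]
    exact Finset.sum_congr rfl fun j _ => by ring
  have h4 : e' * ∑ j, v j + e' = e := by
    rw [he']
    field_simp
  linarith

end Converse

/-! ### An i.i.d. environment and the capacity region -/

section Environment

variable (S)

/-- The distribution of the fading state. -/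
def stateMeasure : Measure S.State := ∑ m, ENNReal.ofReal (S.prob m) • Measure.dirac m

instance : IsProbabilityMeasure S.stateMeasure := by
  refine ⟨?_⟩
  rw [stateMeasure, Measure.finsetSum_apply]
  simp only [Measure.smul_apply, measure_univ, smul_eq_mul, mul_one]
  rw [← ENNReal.ofReal_sum_of_nonneg fun m _ => S.prob_nonneg m, S.prob_sum, ENNReal.ofReal_one]

theorem stateMeasure_singleton (m : S.State) : S.stateMeasure.real {m} = S.prob m := by
  classical
  rw [Measure.real, stateMeasure, Measure.finsetSum_apply]
  simp only [Measure.smul_apply, Measure.dirac_apply, Set.indicator_apply, Set.mem_singleton_iff,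
    smul_eq_mul, Pi.one_apply, mul_ite, mul_one, mul_zero]
  rw [Finset.sum_ite_eq' Finset.univ m]
  simp [ENNReal.toReal_ofReal (S.prob_nonneg m)]

/-- The outcomes of one slot: a uniform variable for the arrivals, and the fading state. -/
abbrev Slot : Type := unitInterval × S.State

/-- The distribution of one slot. -/
def slotMeasure : Measure S.Slot := (volume : Measure unitInterval).prod S.stateMeasure

instance : IsProbabilityMeasure S.slotMeasure := by unfold slotMeasure; infer_instance

/-- The past of the sequence of slots. -/
def slotFiltration : Filtration ℕ (inferInstance : MeasurableSpace (ℕ → S.Slot)) where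
  seq k := MeasurableSpace.comap (fun (ω : ℕ → S.Slot) (l : Finset.range k) => ω l) inferInstance
  mono' k l hkl := by
    have hg : Measurable fun (x : Finset.range l → S.Slot) (i : Finset.range k) =>
        x ⟨i, Finset.mem_range.2 ((Finset.mem_range.1 i.2).trans_le hkl)⟩ :=
      measurable_pi_lambda _ fun i => measurable_pi_apply _
    exact (hg.comp (comap_measurable fun (ω : ℕ → S.Slot) (i : Finset.range l) => ω i)).comap_le
  le' k := Measurable.comap_le (measurable_pi_lambda _ fun i => measurable_pi_apply _)

open Classical in
/-- Arrival indicators with given rates, as functions of one uniform variable. -/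
def slotArrival (lam : Fin nN → ℝ) (x : S.Slot) (i : User nR nN) : ℝ :=
  if (x.1 : ℝ) ≤ Sum.elim S.rateR lam i then 1 else 0

theorem measurable_slotArrival (lam : Fin nN → ℝ) :
    Measurable fun x : S.Slot => (S.slotArrival lam x, x.2) := by
  refine Measurable.prodMk (measurable_pi_lambda _ fun i => ?_) measurable_snd
  refine Measurable.ite ?_ measurable_const measurable_const
  exact measurableSet_le (measurable_subtype_coe.comp measurable_fst) measurable_const

theorem slotMeasure_arrival {lam : Fin nN → ℝ} (hlam : ∀ i, lam i ∈ Set.Icc (0 : ℝ) 1)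
    (i : User nR nN) :
    S.slotMeasure.real {x | S.slotArrival lam x i = 1} = Sum.elim S.rateR lam i := by
  have hr : Sum.elim S.rateR lam i ∈ Set.Icc (0 : ℝ) 1 := by
    rcases i with i | i
    · exact S.rateR_mem i
    · exact hlam i
  have e : {x : S.Slot | S.slotArrival lam x i = 1} =
      Set.Iic (⟨_, hr⟩ : unitInterval) ×ˢ Set.univ := by
    ext x
    simp [slotArrival, ← Subtype.coe_le_coe]
  rw [e, slotMeasure, measureReal_prod_prod]
  simp [Measure.real, unitInterval.volume_Iic, hr.1]

theorem slotMeasure_state (m : S.State) : S.slotMeasure.real {x | x.2 = m} = S.prob m := by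
  have e : {x : S.Slot | x.2 = m} = Set.univ ×ˢ {m} := by
    ext x; simp
  rw [e, slotMeasure, measureReal_prod_prod, S.stateMeasure_singleton]
  simp

theorem infinitePi_real_eval {s : Set S.Slot} (hs : MeasurableSet s) (k : ℕ) :
    (Measure.infinitePi fun _ : ℕ => S.slotMeasure).real {ω | ω k ∈ s} = S.slotMeasure.real s := by
  have := (measurePreserving_eval_infinitePi (fun _ : ℕ => S.slotMeasure) k).measureReal_preimage
    hs.nullMeasurableSet
  exact this

/-- Independent slots form an environment. -/
theorem isEnvironment_infinitePi {lam : Fin nN → ℝ} (hlam : ∀ i, lam i ∈ Set.Icc (0 : ℝ) 1) :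
    S.IsEnvironment lam (Measure.infinitePi fun _ : ℕ => S.slotMeasure) S.slotFiltration
      (fun k ω => S.slotArrival lam (ω k)) (fun k ω => (ω k).2) := by
  have hms : ∀ i, MeasurableSet {x : S.Slot | S.slotArrival lam x i = 1} := fun i =>
    ((measurable_pi_apply i).comp (measurable_fst.comp (S.measurable_slotArrival lam)))
      (measurableSet_singleton 1)
  refine ⟨fun k ω i => ?_, fun k => ?_, fun k => ?_, fun k i => ?_, fun k i => ?_, fun k m => ?_⟩
  · by_cases h : ((ω k).1 : ℝ) ≤ Sum.elim S.rateR lam i <;> simp [slotArrival, h]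
  · refine (S.measurable_slotArrival lam).comp ?_
    exact (measurable_pi_apply (⟨k, by simp⟩ : Finset.range (k + 1))).comp
      (comap_measurable fun (ω : ℕ → S.Slot) (l : Finset.range (k + 1)) => ω l)
  · have hi : iIndepFun (fun (k : ℕ) (ω : ℕ → S.Slot) => ω k)
        (Measure.infinitePi fun _ : ℕ => S.slotMeasure) :=
      iIndepFun_infinitePi (X := fun _ x => x) fun _ => measurable_id
    have h1 := hi.indepFun_finset {k} (Finset.range k) (by simp) fun l => measurable_pi_apply l
    rw [IndepFun_iff_Indep] at h1
    refine indep_of_indep_of_le_left h1 (Measurable.comap_le ?_)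
    refine (S.measurable_slotArrival lam).comp ?_
    exact (measurable_pi_apply (⟨k, by simp⟩ : ({k} : Finset ℕ))).comp
      (comap_measurable fun (ω : ℕ → S.Slot) (l : ({k} : Finset ℕ)) => ω l)
  · exact (S.infinitePi_real_eval (hms _) k).trans (S.slotMeasure_arrival hlam (Sum.inl i))
  · exact (S.infinitePi_real_eval (hms _) k).trans (S.slotMeasure_arrival hlam (Sum.inr i))
  · exact (S.infinitePi_real_eval (measurable_snd (measurableSet_singleton m)) k).trans
      (S.slotMeasure_state m)

theorem isAdmissible_of_scaled (hN : 0 < nN) {lam : Fin nN → ℝ}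
    (hlam : ∀ i, lam i ∈ Set.Icc (0 : ℝ) 1) {ε : ℝ} (hε : 0 < ε)
    (hmem : (1 + ε) • lam ∈ S.lambertRegion) : S.IsAdmissible lam := by
  have henv := S.isEnvironment_infinitePi hlam
  obtain ⟨μ, P, hc, hf⟩ := henv.exists_policy hN
  exact ⟨_, _, _, _, _, _, μ, P, inferInstance, henv, hc, hf.meetsConstraints henv hc hε hmem⟩

theorem IsAdmissible.mem {lam : Fin nN → ℝ} (h : S.IsAdmissible lam) :
    lam ∈ S.lambertRegion ∩ Set.Icc 0 1 := by
  obtain ⟨Ω, mΩ, Pr, ℱ, a, γ, μ, P, hPr, henv, hc, hm⟩ := h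
  exact ⟨hm.mem_lambertRegion henv fun k =>
    ⟨(hc k).1.mono (ℱ.le _) le_rfl, (hc k).2.mono (ℱ.le _) le_rfl⟩,
    fun i => (henv.rate_mem i).1, fun i => (henv.rate_mem i).2⟩

/-- One inclusion is the converse together with closedness of the region. For the other, `lam` is
the limit of its multiples by `(1 + 1 / (n + 1))⁻¹`, each of which is strictly inside in the sense
required by achievability. -/
theorem closure_isAdmissible (hN : 0 < nN) :
    closure {lam : Fin nN → ℝ | S.IsAdmissible lam} = S.lambertRegion ∩ Set.Icc 0 1 := by
  refine Set.Subset.antisymm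
    (closure_minimal (fun lam h => h.mem) (S.isClosed_lambertRegion.inter isClosed_Icc)) ?_
  rintro lam ⟨hmem, h0, h1⟩
  have hlim : Tendsto (fun n : ℕ => (1 + 1 / ((n : ℝ) + 1))⁻¹ • lam) atTop (𝓝 lam) := by
    have h2 : Tendsto (fun n : ℕ => (1 + 1 / ((n : ℝ) + 1))⁻¹) atTop (𝓝 1) := by
      have := (tendsto_const_nhds (x := (1 : ℝ))).add
        (tendsto_one_div_add_atTop_nhds_zero_nat (𝕜 := ℝ))
      simpa using this.inv₀ (by norm_num)
    simpa using h2.smul_const lam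
  refine mem_closure_of_tendsto hlim (Eventually.of_forall fun n => ?_)
  have hε : (0 : ℝ) < 1 / ((n : ℝ) + 1) := by positivity
  refine S.isAdmissible_of_scaled hN (fun i => ?_) hε ?_
  · have hi0 : 0 ≤ lam i := h0 i
    have hi1 : lam i ≤ 1 := h1 i
    rw [Pi.smul_apply, smul_eq_mul]
    refine ⟨by positivity, ?_⟩
    have : (1 + 1 / ((n : ℝ) + 1))⁻¹ ≤ 1 := inv_le_one_of_one_le₀ (by linarith)
    exact mul_le_one₀ this hi0 hi1
  · rw [smul_smul, mul_inv_cancel₀ (by positivity), one_smul]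
    exact hmem

end Environment

end System

end Downlink

end

theorem mainTheorem2 {nR nN : ℕ} (hN : 0 < nN) (S : Downlink.System nR nN) :
    (∀ (Ω : Type*) (mΩ : MeasurableSpace Ω) (Pr : Measure Ω) (_ : IsProbabilityMeasure Pr)
      (ℱ : Filtration ℕ mΩ) (a : ℕ → Ω → Downlink.User nR nN → ℝ) (γ : ℕ → Ω → S.State)
      (lam : Fin nN → ℝ), S.IsEnvironment lam Pr ℱ a γ →
      -- the algorithm can be run
      (∃ μ P : ℕ → Ω → Downlink.User nR nN → ℝ,
        Downlink.System.IsCausal ℱ μ P ∧ S.FollowsLambertStrict a γ μ P) ∧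
      -- achievability
      ((∃ ε : ℝ, 0 < ε ∧ (1 + ε) • lam ∈ S.lambertRegion) →
        ∀ μ P : ℕ → Ω → Downlink.User nR nN → ℝ,
          Downlink.System.IsCausal ℱ μ P → S.FollowsLambertStrict a γ μ P →
          S.MeetsConstraints Pr a γ μ P) ∧
      -- converse, also for policies that know the future
      (lam ∉ S.lambertRegion →
        ¬ ∃ μ P : ℕ → Ω → Downlink.User nR nN → ℝ,
          (∀ k, Measurable (μ k) ∧ Measurable (P k)) ∧ S.MeetsConstraints Pr a γ μ P)) ∧
    -- the capacity region
    closure {lam : Fin nN → ℝ | S.IsAdmissible lam} = S.lambertRegion ∩ Set.Icc 0 1 := by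
  refine ⟨fun Ω mΩ Pr _ ℱ a γ lam henv => ⟨henv.exists_policy hN, ?_, ?_⟩,
    S.closure_isAdmissible hN⟩
  · rintro ⟨ε, hε, hmem⟩ μ P hc hf
    exact hf.meetsConstraints henv hc hε hmem
  · rintro hnot ⟨μ, P, hm, hmeets⟩
    exact hnot (hmeets.mem_lambertRegion henv hm)
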